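/- Let $d\ge 2$. For $1\le j\le d$ let $I_j\subset\mathbb S^1$ be the closed counter-clockwise arc from $e^{\pi i(j-1)/d}$ to $e^{\pi i j/d}$, let $I_{-j}$ be its complex conjugate, and let $C_j$ be the hyperbolic geodesic of the unit disc $\mathbb D$ with the same endpoints as $I_j$. Let $g_j$ be the Möbius automorphism of $\mathbb D$ given by reflection in $C_j$ followed by complex conjugation, let $g_{-j}:=g_j^{-1}$, and let $G_d=\langle g_1,\dots,g_d\rangle$. The Bowen–Series map $A=A_{G_d}:\mathbb S^1\to\mathbb S^1$ is given by $A|_{I_{i}}=g_{i}$ for $i\in\{\pm1,\dots,\pm d\}$. Let $$\Sigma=\{(i_1,i_2,\dots)\in\{\pm1,\dots,\pm d\}^{\mathbb N}: i_{k+1}\neq -i_k \text{ for all } k\}$$ with the product topology and the left shift $\sigma$. The Parry measure on $\Sigma$ is the Borel probability measure giving mass $\frac1{2d(2d-1)^{n}}$ to each non-empty cylinder set of rank $n+1$, $n\ge0$. Let $X$ be the Cayley tree of the free group $F_d=\langle a_1,\dots,a_d\rangle$ with respect to the standard generators, $|\cdot|$ the word length, and $\partial X$ its Gromov boundary; put $a_{-j}:=a_j^{-1}$.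 Identify $\Sigma$ with $\partial X$ by sending $(i_1,i_2,\dots)$ to the endpoint of the geodesic ray through the vertices $1, a_{i_1}^{-1}, a_{i_1}^{-1}a_{i_2}^{-1},\dots$. A Patterson–Sullivan measure on $\partial X$ (base point $1$, standard generators) is a probability measure that is the weak limit on $X\cup\partial X$ of $\big(\sum_{g} e^{-s_k|g|}\delta_g\big)/\sum_{g} e^{-s_k|g|}$ for some sequence $s_k>\delta$ with $s_k\to\delta$, where $\delta$ is the critical exponent of $\sum_{g\in F_d}e^{-s|g|}$. The (Floyd–)Cannon–Thurston map is the map $\psi:\partial X\to\mathbb S^1$ such that the orbit map $F_d\to\mathbb D$, $a_j\mapsto g_j$, $g\mapsto g\cdot 0$, together with $\psi$, is continuous on $F_d\cup\partial X$. A measure of maximal entropy of $A$ is an $A$-invariant Borel probability measure on $\mathbb S^1$ whose Kolmogorov–Sinai entropy equals the topological entropy of $A$. Then: 1. $A$ has exactly one measure of maximal entropy $\nu$; there is exactly one Patterson–Sullivan measure $\mu$ on $\partial X$; the Cannon–Thurston map $\psi$ exists and is unique; and the identification $\Sigma\to\partial X$ is a homeomorphism. 2. $\nu=\psi_*\mu$.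 3. $\mu$ is also the weak limit, as $n\to\infty$, of the measures $$\mu_n=\frac{\delta_1+\sum_{j=1}^n (2d-1)^{-j}\sum_{|g|=j}\delta_g}{1+\frac{2dn}{2d-1}},$$ and under the identification $\partial X\cong\Sigma$ it is the Parry measure. 4. Under the same identification, $\psi$ is the unique continuous surjection $\Sigma\to\mathbb S^1$ that semi-conjugates $\sigma$ to $A$ and maps each cylinder $[i]=\{i_1=i\}$ onto $I_i$, $i\in\{\pm1,\dots,\pm d\}$. -/

import Mathlib

open MeasureTheory Filter Topology Set
open scoped BoundedContinuousFunction ENNReal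

noncomputable section

/-! ## Measure-theoretic entropy and measures of maximal entropy -/

/-- Shannon entropy of the finite measurable partition `{f⁻¹(i)}` given by a labelling `f`. -/
def partitionEntropy {X ι : Type*} [MeasurableSpace X] [Fintype ι] (μ : Measure X) (f : X → ι) :
    ℝ :=
  ∑ i, Real.negMulLog (μ.real (f ⁻¹' {i}))

/-- The labelling of the join `⋁_{i<n} T⁻ⁱ ξ` of the partition `ξ` labelled by `f`. -/
def itinerary {X ι : Type*} (T : X → X) (f : X → ι) (n : ℕ) (x : X) : Fin n → ι :=
  fun i => f (T^[i] x)

/-- Entropy of `T` relative to the finite partition labelled by `f` (the `limsup` is a limit for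
invariant probability measures, by subadditivity). -/
def entropyOfPartition {X ι : Type*} [MeasurableSpace X] [Fintype ι] (μ : Measure X) (T : X → X)
    (f : X → ι) : EReal :=
  limsup (fun n : ℕ => ((partitionEntropy μ (itinerary T f n) / n : ℝ) : EReal)) atTop

/-- Kolmogorov–Sinai entropy: supremum over all finite measurable partitions. -/
def ksEntropy {X : Type*} [MeasurableSpace X] (μ : Measure X) (T : X → X) : EReal :=
  ⨆ (k : ℕ) (f : X → Fin k) (_ : Measurable f), entropyOfPartition μ T f

/-- `ν` is an invariant probability measure whose entropy is the topological entropy. -/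
structure IsMeasureOfMaximalEntropy {X : Type*} [UniformSpace X] [MeasurableSpace X]
    (T : X → X) (ν : Measure X) : Prop where
  isProbabilityMeasure : IsProbabilityMeasure ν
  measurePreserving : MeasurePreserving T ν ν
  entropy_eq : ksEntropy ν T = Dynamics.coverEntropy T univ

instance : MeasurableSpace Circle := borel Circle
instance : BorelSpace Circle := ⟨rfl⟩

namespace BowenSeries

/-! ## The group `G_d` and its Bowen–Series map

Indices are shifted by one: `j : Fin d` stands for the index `j + 1 ∈ {1, …, d}`. -/

/-- The `2d`-th roots of unity on the upper half circle: `vertex d j = exp (π i j / d)`. -/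
def vertex (d j : ℕ) : Circle := Circle.exp (Real.pi * j / d)

/-- Centre of the Euclidean circle containing the hyperbolic geodesic from `vertex d j` to
`vertex d (j + 1)`. -/
def geodesicCenter (d j : ℕ) : ℂ :=
  (Circle.exp (Real.pi * (2 * j + 1) / (2 * d)) : ℂ) / (Real.cos (Real.pi / (2 * d)) : ℂ)

/-- Radius of that circle. -/
def geodesicRadius (d : ℕ) : ℝ := Real.tan (Real.pi / (2 * d))

lemma angle_mem {d : ℕ} (hd : 2 ≤ d) :
    0 < Real.pi / (2 * d) ∧ Real.pi / (2 * d) < Real.pi / 2 := by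
  have h2 : (2 : ℝ) ≤ d := by exact_mod_cast hd
  have := Real.pi_pos
  refine ⟨by positivity, ?_⟩
  rw [div_lt_div_iff₀ (by positivity) (by norm_num)]
  nlinarith

lemma cos_angle_pos {d : ℕ} (hd : 2 ≤ d) : 0 < Real.cos (Real.pi / (2 * d)) := by
  have h := angle_mem hd
  exact Real.cos_pos_of_mem_Ioo ⟨by linarith [Real.pi_pos], h.2⟩

lemma geodesicRadius_pos {d : ℕ} (hd : 2 ≤ d) : 0 < geodesicRadius d :=
  Real.tan_pos_of_pos_of_lt_pi_div_two (angle_mem hd).1 (angle_mem hd).2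

/-- The circle is orthogonal to the unit circle. -/
lemma normSq_geodesicCenter {d : ℕ} (hd : 2 ≤ d) (j : ℕ) :
    ‖geodesicCenter d j‖ ^ 2 = 1 + geodesicRadius d ^ 2 := by
  have h := cos_angle_pos hd
  rw [geodesicCenter, norm_div, Circle.norm_coe, geodesicRadius, Complex.norm_real,
    Real.norm_eq_abs, abs_of_pos h, Real.tan_eq_sin_div_cos]
  have := Real.sin_sq_add_cos_sq (Real.pi / (2 * d))
  field_simp
  linarith

lemma norm_inversion {c z : ℂ} {R : ℝ} (hc : ‖c‖ ^ 2 = 1 + R ^ 2) (hz : z ≠ c) :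
    ‖EuclideanGeometry.inversion c R z‖ ^ 2 - 1 = (R / dist z c) ^ 2 * (‖z‖ ^ 2 - 1) := by
  have hzc : dist z c ≠ 0 := dist_ne_zero.2 hz
  have e1 : EuclideanGeometry.inversion c R z
      = (((R / dist z c) ^ 2 : ℝ) : ℂ) * (z - c) + c := by
    simp [EuclideanGeometry.inversion]
  set k : ℝ := (R / dist z c) ^ 2 with hk
  have hkd : k * dist z c ^ 2 = R ^ 2 := by rw [hk]; field_simp
  rw [e1]
  rw [Complex.dist_eq] at hkd
  rw [← Complex.normSq_eq_norm_sq, Complex.normSq_apply] at hc hkd ⊢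
  rw [← Complex.normSq_eq_norm_sq, Complex.normSq_apply]
  simp only [Complex.add_re, Complex.mul_re, Complex.ofReal_re, Complex.ofReal_im, Complex.sub_re,
    Complex.sub_im, Complex.add_im, Complex.mul_im, zero_mul, sub_zero, add_zero] at *
  linear_combination (k - 1) * hkd + (1 - k) * hc

/-- The closed unit disc. -/
abbrev ClosedDisc : Type := Metric.closedBall (0 : ℂ) 1

lemma ne_geodesicCenter {d : ℕ} (hd : 2 ≤ d) (j : ℕ) {z : ℂ} (hz : ‖z‖ ≤ 1) :
    z ≠ geodesicCenter d j := by
  rintro rfl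
  have h1 := normSq_geodesicCenter hd j
  have h2 := geodesicRadius_pos hd
  nlinarith [norm_nonneg (geodesicCenter d j)]

/-- Hyperbolic reflection in the geodesic from `vertex d j` to `vertex d (j + 1)`, acting on the
closed unit disc. -/
def reflection {d : ℕ} (hd : 2 ≤ d) (j : ℕ) : Equiv.Perm ClosedDisc :=
  Function.Involutive.toPerm
    (fun z => ⟨EuclideanGeometry.inversion (geodesicCenter d j) (geodesicRadius d) z, by
      have hz : ‖(z : ℂ)‖ ≤ 1 := mem_closedBall_zero_iff.1 z.2
      have h := norm_inversion (normSq_geodesicCenter hd j) (ne_geodesicCenter hd j hz)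
      have h3 : ‖(z : ℂ)‖ ^ 2 - 1 ≤ 0 := by nlinarith [norm_nonneg (z : ℂ)]
      rw [mem_closedBall_zero_iff]
      have h4 := mul_nonpos_of_nonneg_of_nonpos
        (sq_nonneg (geodesicRadius d / dist (z : ℂ) (geodesicCenter d j))) h3
      rw [← h] at h4
      exact (sq_le_one_iff₀ (norm_nonneg _)).1 (by linarith)⟩)
    (fun z => Subtype.ext
      (EuclideanGeometry.inversion_inversion _ (geodesicRadius_pos hd).ne' (z : ℂ)))

/-- Complex conjugation on the closed unit disc. -/
def conjugation : Equiv.Perm ClosedDisc :=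
  Function.Involutive.toPerm
    (fun z => ⟨starRingEnd ℂ z, by
      rw [mem_closedBall_zero_iff, RCLike.norm_conj]; exact mem_closedBall_zero_iff.1 z.2⟩)
    (fun z => Subtype.ext (Complex.conj_conj (z : ℂ)))

/-- The Möbius generator `g_{j+1}`: reflection in the geodesic followed by conjugation. -/
def generator {d : ℕ} (hd : 2 ≤ d) (j : Fin d) : Equiv.Perm ClosedDisc :=
  conjugation * reflection hd j

/-- The marking `F_d → G_d` sending the free generators to the Möbius generators; its range is
the group `G_d = ⟨g_1, …, g_d⟩`. -/
def marking {d : ℕ} (hd : 2 ≤ d) : FreeGroup (Fin d) →* Equiv.Perm ClosedDisc :=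
  FreeGroup.lift (generator hd)

/-- The symbols `±1, …, ±d`: the symbol `(j, true)` is `j + 1`, and `(j, false)` is `-(j + 1)`. -/
abbrev Letter (d : ℕ) : Type := Fin d × Bool

/-- The symbol `-a`. -/
def Letter.neg {d : ℕ} (a : Letter d) : Letter d := (a.1, !a.2)

/-- The pieces `g_j^{±1}`. -/
def piece {d : ℕ} (hd : 2 ≤ d) (a : Letter d) : Equiv.Perm ClosedDisc :=
  if a.2 then generator hd a.1 else (generator hd a.1)⁻¹

/-- The closed arcs `I_{±j}`. -/
def arc {d : ℕ} (a : Letter d) : Set Circle :=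
  (fun t : ℝ => Circle.exp (if a.2 then t else -t)) ''
    Icc (Real.pi * (a.1 : ℕ) / d) (Real.pi * ((a.1 : ℕ) + 1) / d)

/-- The inclusion of the circle in the closed disc. -/
def circleToDisc (x : Circle) : ClosedDisc :=
  ⟨x, mem_closedBall_zero_iff.2 x.norm_coe.le⟩

lemma norm_reflection {d : ℕ} (hd : 2 ≤ d) (j : ℕ) (z : ClosedDisc) (hz : ‖(z : ℂ)‖ = 1) :
    ‖(reflection hd j z : ℂ)‖ = 1 := by
  have h := norm_inversion (normSq_geodesicCenter hd j) (ne_geodesicCenter hd j hz.le)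
  rw [hz] at h
  have h2 : ‖(reflection hd j z : ℂ)‖ ^ 2 = 1 := by
    change ‖EuclideanGeometry.inversion (geodesicCenter d j) (geodesicRadius d) (z : ℂ)‖ ^ 2 = 1
    linarith
  exact (pow_eq_one_iff_of_nonneg (norm_nonneg _) two_ne_zero).1 h2

lemma norm_conjugation (z : ClosedDisc) : ‖(conjugation z : ℂ)‖ = ‖(z : ℂ)‖ :=
  RCLike.norm_conj (z : ℂ)

lemma piece_true {d : ℕ} (hd : 2 ≤ d) (j : Fin d) (z : ClosedDisc) :
    piece hd (j, true) z = conjugation (reflection hd j z) := rfl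

lemma piece_false {d : ℕ} (hd : 2 ≤ d) (j : Fin d) (z : ClosedDisc) :
    piece hd (j, false) z = reflection hd j (conjugation z) := rfl

lemma norm_piece {d : ℕ} (hd : 2 ≤ d) (a : Letter d) (z : ClosedDisc) (hz : ‖(z : ℂ)‖ = 1) :
    ‖(piece hd a z : ℂ)‖ = 1 := by
  obtain ⟨j, _ | _⟩ := a
  · rw [piece_false]
    exact norm_reflection hd j _ ((norm_conjugation z).trans hz)
  · rw [piece_true, norm_conjugation]
    exact norm_reflection hd j _ hz

/-- The label of an arc containing `x` (a choice is made at the common endpoints; it does not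
matter for the Bowen–Series map, see `bowenSeries_eq_piece`). -/
def arcLabel {d : ℕ} (hd : 2 ≤ d) (x : Circle) : Letter d :=
  (⟨min ⌊(d : ℝ) * |Complex.arg x| / Real.pi⌋₊ (d - 1), by omega⟩, decide (0 ≤ Complex.arg x))

/-- The Bowen–Series map `A_{G_d}` associated with the ideal polygon with vertices at the `2d`-th
roots of unity: it acts by `g_j^{±1}` on `I_{±j}`. -/
def bowenSeries {d : ℕ} (hd : 2 ≤ d) (x : Circle) : Circle :=
  ⟨(piece hd (arcLabel hd x) (circleToDisc x) : ℂ),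
    mem_sphere_zero_iff_norm.2 (norm_piece hd _ _ x.norm_coe)⟩

lemma coe_bowenSeries {d : ℕ} (hd : 2 ≤ d) (x : Circle) :
    circleToDisc (bowenSeries hd x) = piece hd (arcLabel hd x) (circleToDisc x) := rfl

lemma dist_vertex {d : ℕ} (hd : 2 ≤ d) (j : ℕ) (u : ℝ)
    (hu : u = Real.pi * j / d ∨ u = Real.pi * (j + 1) / d) :
    dist (Circle.exp u : ℂ) (geodesicCenter d j) = geodesicRadius d := by
  have hc := cos_angle_pos hd
  have hd0 : (d : ℝ) ≠ 0 := by positivity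
  set δ := Real.pi / (2 * d) with hδ
  set w : ℂ := (Circle.exp (Real.pi * (2 * j + 1) / (2 * d)) : ℂ) with hw
  have hw1 : ‖w‖ = 1 := Circle.norm_coe _
  obtain ⟨e, he, huw⟩ : ∃ e : ℝ, (e = δ ∨ e = -δ) ∧
      (Circle.exp u : ℂ) = w * (Circle.exp e : ℂ) := by
    rcases hu with hu | hu
    · refine ⟨-δ, Or.inr rfl, ?_⟩
      rw [hw, ← Circle.coe_mul, ← Circle.exp_add, hu, hδ]
      congr 2
      field_simp
      ring
    · refine ⟨δ, Or.inl rfl, ?_⟩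
      rw [hw, ← Circle.coe_mul, ← Circle.exp_add, hu, hδ]
      congr 2
      field_simp
      ring
  have hce : Real.cos e = Real.cos δ := by rcases he with rfl | rfl <;> simp
  have hse : Real.sin e ^ 2 = Real.sin δ ^ 2 := by rcases he with rfl | rfl <;> simp
  have key : (Circle.exp u : ℂ) - geodesicCenter d j
      = w * ((Circle.exp e : ℂ) - ((Real.cos δ)⁻¹ : ℝ)) := by
    rw [huw, geodesicCenter, ← hw, ← hδ]
    push_cast
    ring
  rw [Complex.dist_eq, key, norm_mul, hw1, one_mul]
  rw [← sq_eq_sq₀ (norm_nonneg _) (geodesicRadius_pos hd).le, ← Complex.normSq_eq_norm_sq,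
    Complex.normSq_apply, geodesicRadius, ← hδ, Real.tan_eq_sin_div_cos, Circle.coe_exp]
  simp only [Complex.sub_re, Complex.exp_ofReal_mul_I_re, Complex.ofReal_re, Complex.sub_im,
    Complex.exp_ofReal_mul_I_im, Complex.ofReal_im, sub_zero]
  have h1 := Real.sin_sq_add_cos_sq δ
  rw [hce, ← sq, ← sq, hse]
  field_simp
  nlinarith

lemma reflection_vertex {d : ℕ} (hd : 2 ≤ d) (j : ℕ) (u : ℝ)
    (hu : u = Real.pi * j / d ∨ u = Real.pi * (j + 1) / d) :
    reflection hd j (circleToDisc (Circle.exp u)) = circleToDisc (Circle.exp u) :=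
  Subtype.ext (EuclideanGeometry.inversion_of_mem_sphere (dist_vertex hd j u hu))

lemma conjugation_toDisc (x : Circle) : conjugation (circleToDisc x) = circleToDisc x⁻¹ :=
  Subtype.ext (Circle.coe_inv_eq_conj x).symm

lemma piece_vertex {d : ℕ} (hd : 2 ≤ d) (a : Letter d) (u : ℝ)
    (hu : u = Real.pi * (a.1 : ℕ) / d ∨ u = Real.pi * ((a.1 : ℕ) + 1) / d) (x : Circle)
    (hx : x = Circle.exp (if a.2 then u else -u)) :
    piece hd a (circleToDisc x) = circleToDisc x⁻¹ := by
  obtain ⟨j, _ | _⟩ := a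
  · simp only [Bool.false_eq_true, if_false, Circle.exp_neg] at hx
    rw [piece_false, conjugation_toDisc, hx, inv_inv]
    exact reflection_vertex hd j u hu
  · simp only [if_true] at hx
    rw [piece_true, hx, reflection_vertex hd j u hu, conjugation_toDisc]

/-- The Bowen–Series map acts on the closed arc `I_{±j}` by `g_j^{±1}`. -/
theorem bowenSeries_eq_piece {d : ℕ} (hd : 2 ≤ d) (a : Letter d) (x : Circle) (hx : x ∈ arc a) :
    (bowenSeries hd x : ℂ) = piece hd a (circleToDisc x) := by
  have hπ := Real.pi_pos
  have hd0 : (0 : ℝ) < d := by positivity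
  suffices h : piece hd (arcLabel hd x) (circleToDisc x) = piece hd a (circleToDisc x) by
    rw [← h]; rfl
  obtain ⟨t, ⟨ht1, ht2⟩, hxt⟩ := hx
  simp only at hxt
  rw [div_le_iff₀ hd0] at ht1
  rw [le_div_iff₀ hd0] at ht2
  have hj : ((a.1 : ℕ) : ℝ) + 1 ≤ d := by exact_mod_cast a.1.2
  have ht0 : 0 ≤ t := by
    have : (0 : ℝ) ≤ (a.1 : ℕ) := by positivity
    by_contra h
    nlinarith
  have htπ : t ≤ Real.pi := by
    by_contra h
    nlinarith
  have harg : |Complex.arg x| = t := by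
    rw [← hxt]
    split_ifs with h
    · rw [Circle.arg_exp (by linarith) htπ, abs_of_nonneg ht0]
    · rcases htπ.eq_or_lt with h | h
      · rw [h, show Circle.exp (-Real.pi) = Circle.exp Real.pi by
          rw [Circle.exp_neg]; ext; simp, Circle.arg_exp (by linarith) le_rfl, abs_of_pos hπ]
      · rw [Circle.arg_exp (by linarith) (by linarith), abs_neg, abs_of_nonneg ht0]
  set b := arcLabel hd x with hb
  have hxb : x = Circle.exp (if b.2 then t else -t) := by
    have h2 : b.2 = decide (0 ≤ Complex.arg x) := rfl
    rw [h2, ← harg]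
    by_cases h : 0 ≤ Complex.arg x
    · simp [h, abs_of_nonneg h]
    · simp [h, abs_of_neg (not_le.1 h)]
  have hb1 : ((b.1 : ℕ)) = min ⌊(d : ℝ) * t / Real.pi⌋₊ (d - 1) := by rw [← harg]; rfl
  have hidx : (b.1 : ℕ) = a.1 ∨ ((b.1 : ℕ) = a.1 + 1 ∧ t * d = Real.pi * ((a.1 : ℕ) + 1)) := by
    have hf1 : (a.1 : ℕ) ≤ ⌊(d : ℝ) * t / Real.pi⌋₊ := by
      rw [Nat.le_floor_iff (by positivity), le_div_iff₀ hπ]; linarith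
    have haj : (a.1 : ℕ) ≤ d - 1 := by have := a.1.2; omega
    rcases ht2.eq_or_lt with h | h
    · have hf2 : ⌊(d : ℝ) * t / Real.pi⌋₊ = a.1 + 1 := by
        rw [mul_comm, h, mul_comm, mul_div_assoc, div_self hπ.ne', mul_one]
        exact_mod_cast Nat.floor_natCast ((a.1 : ℕ) + 1)
      rw [hf2] at hb1
      by_cases h' : (a.1 : ℕ) + 1 ≤ d - 1
      · right; exact ⟨by omega, h⟩
      · left; omega
    · have hf2 : ⌊(d : ℝ) * t / Real.pi⌋₊ < a.1 + 1 := by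
        rw [Nat.floor_lt (by positivity), div_lt_iff₀ hπ]; push_cast; linarith
      left; omega
  rcases hidx with hidx | ⟨hidx, hte⟩
  · by_cases hs : b.2 = a.2
    · rw [Prod.ext (Fin.ext hidx) hs]
    · have hsin : Circle.exp t = Circle.exp (-t) := by
        have h3 := hxt.trans hxb
        cases ha2 : a.2 <;> cases hb2 : b.2 <;>
          simp only [ha2, hb2, if_true, Bool.false_eq_true, if_false] at h3 <;>
          first
          | exact absurd (hb2.trans ha2.symm) hs
          | exact h3
          | exact h3.symm
      have ht' : t = 0 ∨ t = Real.pi := by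
        have h4 : Real.sin t = 0 := by
          have h5 := congrArg (fun z : Circle => (z : ℂ).im) hsin
          simp only [Circle.coe_exp, Complex.exp_ofReal_mul_I_im, Real.sin_neg] at h5
          linarith
        rcases htπ.eq_or_lt with h | h
        · exact Or.inr h
        · exact Or.inl ((Real.sin_eq_zero_iff_of_lt_of_lt (by linarith) h).1 h4)
      have hu : t = Real.pi * (a.1 : ℕ) / d ∨ t = Real.pi * ((a.1 : ℕ) + 1) / d := by
        rcases ht' with h | h
        · left
          rw [eq_div_iff hd0.ne']
          have : (0 : ℝ) ≤ Real.pi * (a.1 : ℕ) := by positivity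
          rw [h] at ht1 ⊢
          linarith
        · right
          rw [eq_div_iff hd0.ne']
          rw [h] at ht2 ⊢
          nlinarith
      rw [piece_vertex hd a t hu x hxt.symm,
        piece_vertex hd b t (by rw [hidx]; exact hu) x hxb]
  · rw [piece_vertex hd a t (Or.inr (by rw [eq_div_iff hd0.ne']; exact hte)) x hxt.symm,
      piece_vertex hd b t (Or.inl (by
        rw [eq_div_iff hd0.ne', hidx]; push_cast; exact hte)) x hxb]

/-! ## The subshift of finite type and its Parry measure -/

/-- The transition matrix of the Markov partition `{I_{±j}}`: all entries are `1`, except those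
in position `(a, -a)`, which are `0`. -/
def transitionMatrix (d : ℕ) : Matrix (Letter d) (Letter d) ℕ :=
  fun a b => if b = a.neg then 0 else 1

/-- The one-sided subshift `Σ_M⁺` of admissible infinite words. -/
def ShiftSpace (d : ℕ) : Type :=
  {ω : ℕ → Letter d // ∀ k, transitionMatrix d (ω k) (ω (k + 1)) = 1}

instance (d : ℕ) : TopologicalSpace (ShiftSpace d) := instTopologicalSpaceSubtype
instance (d : ℕ) : MeasurableSpace (ShiftSpace d) := borel _
instance (d : ℕ) : BorelSpace (ShiftSpace d) := ⟨rfl⟩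

/-- The left shift `σ`. -/
def shift {d : ℕ} (ω : ShiftSpace d) : ShiftSpace d :=
  ⟨fun k => ω.1 (k + 1), fun k => ω.2 (k + 1)⟩

/-- The cylinder set of rank `n` containing `ω`. -/
def cylinder {d : ℕ} (ω : ShiftSpace d) (n : ℕ) : Set (ShiftSpace d) :=
  {η | ∀ k < n, η.1 k = ω.1 k}

/-- The Parry measure: the uniform Markov measure, giving mass `1 / (2d (2d-1)ⁿ)` to each
(non-empty) cylinder set of rank `n + 1`. -/
structure IsParryMeasure {d : ℕ} (P : Measure (ShiftSpace d)) : Prop where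
  isProbabilityMeasure : IsProbabilityMeasure P
  measure_cylinder : ∀ (ω : ShiftSpace d) (n : ℕ),
    P (cylinder ω (n + 1)) = ENNReal.ofReal (1 / (2 * d * (2 * d - 1) ^ n))

/-- `ψ : Σ_M⁺ → S¹` is a continuous surjection which semi-conjugates the shift to the
Bowen–Series map and carries each rank one cylinder `[±j]` onto `I_{±j}`. -/
structure IsSymbolicCoding {d : ℕ} (hd : 2 ≤ d) (ψ : ShiftSpace d → Circle) : Prop where
  continuous : Continuous ψ
  surjective : Function.Surjective ψ
  semiconj : Function.Semiconj ψ shift (bowenSeries hd)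
  image_cylinder : ∀ a : Letter d, ψ '' {ω | ω.1 0 = a} = arc a

/-! ## The Cayley tree of `F_d`, its Gromov boundary and compactification -/

instance (d : ℕ) : TopologicalSpace (FreeGroup (Fin d)) := ⊥
instance (d : ℕ) : DiscreteTopology (FreeGroup (Fin d)) := ⟨rfl⟩

/-- Word metric of `F_d` with respect to the standard generators. -/
def wordDist {d : ℕ} (g h : FreeGroup (Fin d)) : ℕ := (g⁻¹ * h).norm

/-- `c` is a geodesic of length `R ∈ [0, ∞]` in the Cayley tree that starts at the base point `1`,
continued by a constant after time `R`. -/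
structure IsGeneralizedRay {d : ℕ} (c : ℕ → FreeGroup (Fin d)) (R : ℕ∞) : Prop where
  base : c 0 = 1
  geodesic : ∀ m k : ℕ, ((m + k : ℕ) : ℕ∞) ≤ R → wordDist (c m) (c (m + k)) = k
  constant : ∀ m k : ℕ, R ≤ (m : ℕ∞) → c (m + k) = c m

/-- The Gromov boundary `∂X` of the Cayley tree `X`: geodesic rays issuing from `1`, with the
topology of pointwise convergence. As `X` is a tree, distinct geodesic rays from `1` are not
asymptotic, so that each boundary point is represented by exactly one such ray. -/
def Boundary (d : ℕ) : Type := {c : ℕ → FreeGroup (Fin d) // IsGeneralizedRay c ⊤}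

/-- The compactification `X ∪ ∂X` (vertices and boundary points): generalized rays issuing
from `1`, with the topology of pointwise convergence. A vertex `g` corresponds to the geodesic
from `1` to `g`. -/
def Compactification (d : ℕ) : Type :=
  {c : ℕ → FreeGroup (Fin d) // ∃ R, IsGeneralizedRay c R}

instance (d : ℕ) : TopologicalSpace (Boundary d) := instTopologicalSpaceSubtype
instance (d : ℕ) : MeasurableSpace (Boundary d) := borel _
instance (d : ℕ) : BorelSpace (Boundary d) := ⟨rfl⟩
instance (d : ℕ) : TopologicalSpace (Compactification d) := instTopologicalSpaceSubtype
instance (d : ℕ) : MeasurableSpace (Compactification d) := borel _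
instance (d : ℕ) : BorelSpace (Compactification d) := ⟨rfl⟩

lemma wordDist_mk_take {d : ℕ} (L : List (Letter d)) (hL : FreeGroup.IsReduced L) (m k : ℕ)
    (h : m + k ≤ L.length) :
    wordDist (FreeGroup.mk (L.take m)) (FreeGroup.mk (L.take (m + k))) = k := by
  have h1 : L.take (m + k) = L.take m ++ (L.drop m).take k := List.take_add
  have h2 : FreeGroup.IsReduced ((L.drop m).take k) :=
    hL.infix ((List.take_prefix _ _).isInfix.trans (List.drop_suffix _ _).isInfix)
  rw [wordDist, h1, ← FreeGroup.mul_mk, inv_mul_cancel_left, FreeGroup.norm, FreeGroup.toWord_mk,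
    h2.reduce_eq, List.length_take, List.length_drop]
  omega

/-- The inclusion of the vertex set `F_d` of `X` in `X ∪ ∂X`. -/
def ofVertex {d : ℕ} (g : FreeGroup (Fin d)) : Compactification d :=
  ⟨fun n => FreeGroup.mk (g.toWord.take n), g.norm,
    by simp [FreeGroup.one_eq_mk],
    fun m k h => wordDist_mk_take _ FreeGroup.isReduced_toWord m k (by exact_mod_cast h),
    fun m k h => by
      have h' : g.toWord.length ≤ m := by exact_mod_cast h
      rw [List.take_of_length_le h', List.take_of_length_le (by omega)]⟩

/-- The inclusion of `∂X` in `X ∪ ∂X`. -/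
def ofBoundary {d : ℕ} (ξ : Boundary d) : Compactification d := ⟨ξ.1, ⊤, ξ.2⟩

/-- The prefix of length `n` of the infinite reduced word `i₁⁻¹ i₂⁻¹ i₃⁻¹ ⋯` in the free
generators and their inverses. -/
def inversePrefix {d : ℕ} (ω : ShiftSpace d) (n : ℕ) : List (Letter d) :=
  (List.range n).map fun k => (ω.1 k).neg

lemma isReduced_inversePrefix {d : ℕ} (ω : ShiftSpace d) (n : ℕ) :
    FreeGroup.IsReduced (inversePrefix ω n) := by
  rw [FreeGroup.IsReduced, inversePrefix, List.isChain_map]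
  rw [List.isChain_iff_getElem]
  intro i hi
  simp only [List.getElem_range, Letter.neg]
  intro h
  have h2 := ω.2 i
  by_contra hne
  have : ω.1 (i + 1) = (ω.1 i).neg := by
    refine Prod.ext h.symm ?_
    revert hne
    simp only [Letter.neg]
    cases (ω.1 i).2 <;> cases (ω.1 (i + 1)).2 <;> simp
  rw [transitionMatrix, if_pos this] at h2
  exact zero_ne_one h2

lemma take_inversePrefix {d : ℕ} (ω : ShiftSpace d) (m k : ℕ) :
    (inversePrefix ω (m + k)).take m = inversePrefix ω m := by
  rw [inversePrefix, ← List.map_take, List.take_range, Nat.min_eq_left (by omega)]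
  rfl

/-- The identification `Σ_M⁺ ≅ ∂X`. A point of the circle with itinerary `(i₁, i₂, …)` lies behind
the tiles `g_{i₁}⁻¹ ⋯ g_{iₙ}⁻¹ R` of the tessellation, so the word `(i₁, i₂, …)` is sent to the
geodesic ray through the vertices `i₁⁻¹ ⋯ iₙ⁻¹`. -/
def toBoundary {d : ℕ} (ω : ShiftSpace d) : Boundary d :=
  ⟨fun n => FreeGroup.mk (inversePrefix ω n), by simp [inversePrefix, FreeGroup.one_eq_mk],
    fun m k _ => by
      have h := wordDist_mk_take _ (isReduced_inversePrefix ω (m + k)) m k (by simp [inversePrefix])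
      rwa [take_inversePrefix, List.take_of_length_le (by simp [inversePrefix])] at h,
    fun m k h => absurd h (by simp)⟩

/-- `ψ` is the (Floyd–)Cannon–Thurston map: the orbit map `g ↦ g · 0` from the vertex set of the
Cayley tree to the disc, together with `ψ` on `∂X`, is continuous on `X ∪ ∂X`. -/
def IsCannonThurston {d : ℕ} (hd : 2 ≤ d) (ψ : Boundary d → Circle) : Prop :=
  ∃ Φ : Compactification d → ClosedDisc, Continuous Φ ∧
    (∀ g, Φ (ofVertex g) = marking hd g ⟨0, by simp⟩) ∧
    ∀ ξ, Φ (ofBoundary ξ) = circleToDisc (ψ ξ)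

/-! ## Patterson–Sullivan measures -/

/-- The normalized orbit measure `(∑ w(|g|) δ_g) / ∑ w(|g|)` for a weight depending only on the
distance to the base point `1`. -/
def orbitMeasure (d : ℕ) (w : ℕ → ℝ) : Measure (Compactification d) :=
  (∑' g : FreeGroup (Fin d), ENNReal.ofReal (w g.norm))⁻¹ •
    Measure.sum fun g : FreeGroup (Fin d) => ENNReal.ofReal (w g.norm) • Measure.dirac (ofVertex g)

/-- The measures `m k` on `X ∪ ∂X` converge weakly to the measure `μ` on `∂X`. -/
def TendstoWeakly {d : ℕ} (m : ℕ → Measure (Compactification d)) (μ : Measure (Boundary d)) :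
    Prop :=
  ∀ f : Compactification d →ᵇ ℝ,
    Tendsto (fun k => ∫ x, f x ∂(m k)) atTop (𝓝 (∫ x, f x ∂(μ.map ofBoundary)))

/-- The critical exponent of the Poincaré series `∑ exp (-s |g|)` of `F_d`. -/
def criticalExponent (d : ℕ) : ℝ :=
  sInf {s : ℝ | Summable fun g : FreeGroup (Fin d) => Real.exp (-s * g.norm)}

/-- `μ` is a Patterson–Sullivan measure on `∂X` (base point `1`, standard generators): a weak
limit of the normalized orbit measures with weights `exp (-s |g|)`, along some sequence of
exponents `s` that decreases to the critical exponent. -/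
structure IsPattersonSullivan {d : ℕ} (μ : Measure (Boundary d)) : Prop where
  isProbabilityMeasure : IsProbabilityMeasure μ
  exists_tendsto : ∃ s : ℕ → ℝ, (∀ k, criticalExponent d < s k) ∧
    Tendsto s atTop (𝓝 (criticalExponent d)) ∧
    TendstoWeakly (fun k => orbitMeasure d fun r => Real.exp (-s k * r)) μ

/-- The atomic measure `(δ_1 + ∑_{1≤j≤n} (2d-1)^{-j} ∑_{|g|=j} δ_g) / (1 + 2dn / (2d-1))`. -/
def sphereAverage (d n : ℕ) : Measure (Compactification d) :=
  (ENNReal.ofReal (1 + 2 * d * n / (2 * d - 1)))⁻¹ •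
    Measure.sum fun g : FreeGroup (Fin d) =>
      (if g.norm ≤ n then ENNReal.ofReal (1 / (2 * d - 1) ^ g.norm) else 0) •
        Measure.dirac (ofVertex g)

end BowenSeries

/-! Everything reduces to the shift space `ShiftSpace d` with its Parry measure P.

Geometry. The Euclidean discs cut off by the geodesics are pairwise disjoint or tangent, and the
piece of a letter a exchanges the half disc of a with the outside of the half disc of -a. By the
distance formula for inversions it does not expand outside the half disc of a, and it strictly
contracts distances inside every other half disc. Tangencies rule out a uniform contraction ratio.
Compactness still gives a definite loss of distance for points at least ε apart, so long reduced
words contract uniformly (`exists_length_dist_wordAct_lt`). Hence the orbit of 0 is uniformly Cauchy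
along rays and the orbit map extends continuously to X ∪ ∂X. Read on the shift space, the boundary
map is `coding`. A point whose n-th iterate lies in the n-th arc of an admissible word is the image
of that word (`eq_coding_of_forall_mem_arc`), which characterises the coding.

Patterson–Sullivan measures. Pushing P to the n-th vertex of a ray gives the uniform distribution on
the sphere of radius n, and these distributions converge to P on the boundary. Every orbit measure
with radial weights is a mixture of them. When the relative weight of each fixed sphere tends to
zero, Toeplitz averaging forces the limit to be P (`tendstoWeakly_orbitMeasure`). This covers the
Poincaré weights, whose total mass diverges at the critical exponent log (2d-1), and also the
averages over balls.

Entropy. Coding by words bounds the topological entropy by log (2d-1). The (2d-1)^n preimages of a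
point under the n-th iterate are separated, which gives equality. An invariant measure on the circle
lifts to the shift through the itinerary with respect to half-open arcs, and is a factor of its
lift. On the shift, each increment of the entropies of word partitions bounds the Kolmogorov–Sinai
entropy. An increment is at most log (2d-1), with equality only if the next letter is uniformly
distributed given the past. A lift of maximal entropy therefore has uniform transitions;
stationarity makes the first letter uniform, so the lift is P (`isParryMeasure_of_le_ksEntropy`).
Conversely the image of P is maximal: outside a null set, the labels of the arcs visited recover the
word. -/

namespace BowenSeries

/-! ## Plane geometry of the generators -/

/-- Position of the arc `I_a` in counter-clockwise order, starting at `1`. -/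
def letterIndex {d : ℕ} (a : Letter d) : ℕ := if a.2 then a.1 else 2 * d - 1 - a.1

lemma letterIndex_lt {d : ℕ} (a : Letter d) : letterIndex a < 2 * d := by
  have := a.1.2
  unfold letterIndex
  split_ifs <;> omega

lemma letterIndex_injective {d : ℕ} : Function.Injective (letterIndex (d := d)) := by
  rintro ⟨i, s⟩ ⟨j, t⟩ h
  have hi := i.2
  have hj := j.2
  have hval : i.1 = j.1 ∧ s = t := by
    cases s <;> cases t <;> simp [letterIndex] at h ⊢ <;> omega
  exact Prod.ext (Fin.ext hval.1) hval.2

lemma exists_letterIndex_eq {d k : ℕ} (hk : k < 2 * d) : ∃ a : Letter d, letterIndex a = k := by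
  by_cases h : k < d
  · exact ⟨(⟨k, h⟩, true), by simp [letterIndex]⟩
  · exact ⟨(⟨2 * d - 1 - k, by omega⟩, false), by simp [letterIndex]; omega⟩

@[simp] lemma Letter.neg_neg {d : ℕ} (a : Letter d) : a.neg.neg = a := by simp [Letter.neg]

lemma Letter.neg_injective {d : ℕ} : Function.Injective (Letter.neg (d := d)) :=
  Function.LeftInverse.injective Letter.neg_neg

lemma Letter.neg_ne {d : ℕ} (a : Letter d) : a.neg ≠ a := fun h => by
  have := congrArg Prod.snd h
  simp [Letter.neg] at this

lemma letterIndex_neg {d : ℕ} (a : Letter d) : letterIndex a.neg + letterIndex a + 1 = 2 * d := by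
  have := a.1.2
  obtain ⟨i, _ | _⟩ := a <;> simp [letterIndex, Letter.neg] at * <;> omega

/-- Initial point of the arc `I_a`, in counter-clockwise order. -/
def arcStart {d : ℕ} (a : Letter d) : Circle := vertex d (letterIndex a)

/-- Final point of the arc `I_a`, in counter-clockwise order. -/
def arcEnd {d : ℕ} (a : Letter d) : Circle := vertex d (letterIndex a + 1)

/-- Half of the angle under which an arc `I_a` is seen from the origin. -/
def halfAngle (d : ℕ) : ℝ := Real.pi / (2 * d)

/-- Argument of the midpoint of the arc `I_a`. -/
def midAngle {d : ℕ} (a : Letter d) : ℝ := (2 * letterIndex a + 1) * halfAngle d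

/-- Centre of the Euclidean circle containing the geodesic with the same end points as `I_a`. -/
def center {d : ℕ} (a : Letter d) : ℂ :=
  if a.2 then geodesicCenter d a.1 else starRingEnd ℂ (geodesicCenter d a.1)

lemma center_neg {d : ℕ} (a : Letter d) : center a.neg = starRingEnd ℂ (center a) := by
  obtain ⟨i, _ | _⟩ := a <;> simp [center, Letter.neg]

lemma halfAngle_pos {d : ℕ} (hd : 2 ≤ d) : 0 < halfAngle d := (angle_mem hd).1

lemma natCast_mul_halfAngle {d : ℕ} (hd : 2 ≤ d) : (d : ℝ) * halfAngle d = Real.pi / 2 := by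
  have : (0 : ℝ) < d := by positivity
  rw [halfAngle]; field_simp

lemma halfAngle_le {d : ℕ} (hd : 2 ≤ d) : halfAngle d ≤ Real.pi / 4 := by
  have h2 : (2 : ℝ) ≤ d := by exact_mod_cast hd
  have := natCast_mul_halfAngle hd
  nlinarith [halfAngle_pos hd]

lemma vertex_eq {d : ℕ} (j : ℕ) : vertex d j = Circle.exp (2 * j * halfAngle d) := by
  rw [vertex, halfAngle]
  congr 1
  by_cases h : (d : ℝ) = 0
  · simp [h]
  · field_simp

lemma exp_two_pi_sub (t : ℝ) : Circle.exp (2 * Real.pi - t) = (Circle.exp t)⁻¹ := by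
  rw [Circle.exp_sub, Circle.exp_two_pi, one_div]

/-- One formula in the cyclic index replaces the two cases of `center`, so upper and lower arcs need
no separate treatment in distance computations. Conjugation replaces an angle t by 2π - t. -/
lemma center_eq {d : ℕ} (hd : 2 ≤ d) (a : Letter d) :
    center a = (Circle.exp (midAngle a) : ℂ) / (Real.cos (halfAngle d) : ℂ) := by
  have hpi := natCast_mul_halfAngle hd
  have key : ∀ j : ℕ, geodesicCenter d j
      = (Circle.exp ((2 * j + 1) * halfAngle d) : ℂ) / (Real.cos (halfAngle d) : ℂ) := by
    intro j
    rw [geodesicCenter, halfAngle]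
    congr 3
    ring
  obtain ⟨i, _ | _⟩ := a
  · have h : midAngle ((i, false) : Letter d) = 2 * Real.pi - (2 * (i : ℕ) + 1) * halfAngle d := by
      have h1 : letterIndex ((i, false) : Letter d) + i + 1 = 2 * d := by
        have := i.2
        simp [letterIndex]; omega
      have h2 : (letterIndex ((i, false) : Letter d) : ℝ) + i + 1 = 2 * d := by exact_mod_cast h1
      rw [midAngle]
      linear_combination (2 * halfAngle d) * h2 + 4 * hpi
    rw [h, exp_two_pi_sub, Circle.coe_inv_eq_conj]
    simp only [center, Bool.false_eq_true, if_false, key, map_div₀, Complex.conj_ofReal]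
  · simp only [center, if_true, key]
    simp [midAngle, letterIndex]

lemma normSq_center {d : ℕ} (hd : 2 ≤ d) (a : Letter d) :
    ‖center a‖ ^ 2 = 1 + geodesicRadius d ^ 2 := by
  rw [← normSq_geodesicCenter hd a.1, center]
  split_ifs
  · rfl
  · rw [RCLike.norm_conj]

lemma ne_center {d : ℕ} (hd : 2 ≤ d) (a : Letter d) {z : ℂ} (hz : ‖z‖ ≤ 1) : z ≠ center a := by
  rintro rfl
  nlinarith [norm_nonneg (center a), normSq_center hd a, geodesicRadius_pos hd]

lemma sq_norm_exp_sub_exp (s t : ℝ) :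
    ‖(Circle.exp s : ℂ) - Circle.exp t‖ ^ 2 = (2 * Real.sin ((s - t) / 2)) ^ 2 := by
  rw [← Complex.normSq_eq_norm_sq, Complex.normSq_apply]
  simp only [Circle.coe_exp, Complex.sub_re, Complex.exp_ofReal_mul_I_re, Complex.sub_im,
    Complex.exp_ofReal_mul_I_im]
  have h1 : Real.cos (s - t) = 1 - 2 * Real.sin ((s - t) / 2) ^ 2 := by
    rw [show s - t = 2 * ((s - t) / 2) by ring, Real.cos_two_mul, Real.cos_sq']
    ring_nf
  rw [Real.cos_sub] at h1
  nlinarith [Real.sin_sq_add_cos_sq s, Real.sin_sq_add_cos_sq t]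

/-- With θ the half angle, the centres lie on the circle of radius 1 / cos θ at angles differing by
2kθ, so their distance is 2 sin (kθ) / cos θ. As 1 ≤ k ≤ 2d - 1, the angle kθ lies between θ and π -
θ and its sine is at least sin θ. Equality occurs for neighbours, whose discs are tangent. -/
lemma dist_center_center {d : ℕ} (hd : 2 ≤ d) {a b : Letter d} (hab : a ≠ b) :
    2 * geodesicRadius d ≤ dist (center a) (center b) := by
  wlog hlt : letterIndex b < letterIndex a generalizing a b
  · rw [dist_comm]
    refine this hab.symm ?_
    have := letterIndex_injective.ne hab
    omega
  have hc : 0 < Real.cos (halfAngle d) := cos_angle_pos hd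
  have hpi := natCast_mul_halfAngle hd
  have h0 := halfAngle_pos hd
  have hsin : 0 < Real.sin (halfAngle d) :=
    Real.sin_pos_of_pos_of_lt_pi h0 (by linarith [halfAngle_le hd, Real.pi_pos])
  rw [center_eq hd, center_eq hd, Complex.dist_eq, ← sub_div, norm_div, Complex.norm_real,
    Real.norm_eq_abs, abs_of_pos hc, geodesicRadius, Real.tan_eq_sin_div_cos, ← halfAngle,
    ← mul_div_assoc]
  refine div_le_div_of_nonneg_right ?_ hc.le
  refine le_of_sq_le_sq ?_ (norm_nonneg _)
  rw [sq_norm_exp_sub_exp]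
  have e : (midAngle a - midAngle b) / 2
      = ((letterIndex a : ℝ) - letterIndex b) * halfAngle d := by
    rw [midAngle, midAngle]; ring
  rw [e]
  have hk1 : (letterIndex b : ℝ) + 1 ≤ letterIndex a := by exact_mod_cast hlt
  have hk2 : (letterIndex a : ℝ) + 1 ≤ 2 * d := by exact_mod_cast letterIndex_lt a
  have hk3 : (0 : ℝ) ≤ letterIndex b := by positivity
  set u := ((letterIndex a : ℝ) - letterIndex b) * halfAngle d with hu
  have hu1 : halfAngle d ≤ u := by rw [hu]; nlinarith
  have hu2 : u ≤ Real.pi - halfAngle d := by rw [hu]; nlinarith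
  have hs : Real.sin (halfAngle d) ≤ Real.sin u := by
    rcases le_total u (Real.pi / 2) with h | h
    · exact Real.sin_le_sin_of_le_of_le_pi_div_two (by linarith) h hu1
    · rw [← Real.sin_pi_sub u]
      exact Real.sin_le_sin_of_le_of_le_pi_div_two (by linarith) (by linarith) (by linarith)
  nlinarith

/-- Two of the half discs meet in at most one point, on the boundary of both. -/
lemma dist_center_eq_and_eq_midpoint {d : ℕ} (hd : 2 ≤ d) {a b : Letter d} (hab : a ≠ b) {z : ℂ}
    (ha : dist z (center a) ≤ geodesicRadius d) (hb : dist z (center b) ≤ geodesicRadius d) :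
    dist z (center a) = geodesicRadius d ∧ 2 * z = center a + center b := by
  have h1 := dist_center_center hd hab
  have h2 := dist_triangle_left (center a) (center b) z
  refine ⟨by linarith, ?_⟩
  have ha' : dist z (center a) = geodesicRadius d := by linarith
  have hb' : dist z (center b) = geodesicRadius d := by linarith
  have hz : z = midpoint ℝ (center a) (center b) := by
    apply eq_midpoint_of_dist_eq_half
    · rw [dist_comm, ha']; linarith
    · rw [hb']; linarith
  rw [hz, midpoint_eq_smul_add, Complex.real_smul, invOf_eq_inv]
  push_cast
  ring

lemma le_dist_center_of_ne {d : ℕ} (hd : 2 ≤ d) {a b : Letter d} (hab : a ≠ b) {z : ℂ}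
    (ha : dist z (center a) ≤ geodesicRadius d) : geodesicRadius d ≤ dist z (center b) := by
  have h1 := dist_center_center hd hab
  have h2 := dist_triangle_left (center a) (center b) z
  linarith

/-- No point lies in three of the half discs. -/
lemma eq_of_mem_three {d : ℕ} (hd : 2 ≤ d) {a b c : Letter d} (hab : a ≠ b) (hac : a ≠ c) {z : ℂ}
    (ha : dist z (center a) ≤ geodesicRadius d) (hb : dist z (center b) ≤ geodesicRadius d)
    (hc : dist z (center c) ≤ geodesicRadius d) : b = c := by
  by_contra hbc
  have h1 := (dist_center_eq_and_eq_midpoint hd hab ha hb).2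
  have h2 := (dist_center_eq_and_eq_midpoint hd hac ha hc).2
  -- The point is the midpoint of the centres of a, b and also of those of a, c.
  have h3 : center b = center c := by linear_combination h2 - h1
  have h4 := dist_center_center hd hbc
  rw [h3, dist_self] at h4
  linarith [geodesicRadius_pos hd]

/-! ### Arcs -/

lemma mem_arc_iff_exists {d : ℕ} (hd : 2 ≤ d) (a : Letter d) (x : Circle) :
    x ∈ arc a ↔ ∃ t, |t - midAngle a| ≤ halfAngle d ∧ Circle.exp t = x := by
  have hpi := natCast_mul_halfAngle hd
  have hd0 : (0 : ℝ) < d := by positivity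
  have e1 : ∀ j : ℝ, Real.pi * j / d = 2 * j * halfAngle d := by
    intro j; rw [halfAngle]; field_simp
  obtain ⟨i, _ | _⟩ := a
  · have h1 : letterIndex ((i, false) : Letter d) + i + 1 = 2 * d := by
      have := i.2
      simp [letterIndex]; omega
    have h2 : (letterIndex ((i, false) : Letter d) : ℝ) + i + 1 = 2 * d := by exact_mod_cast h1
    have h3 : midAngle ((i, false) : Letter d) = 2 * Real.pi - (2 * (i : ℕ) + 1) * halfAngle d := by
      rw [midAngle]
      linear_combination (2 * halfAngle d) * h2 + 4 * hpi
    simp only [arc, Bool.false_eq_true, if_false, mem_image, mem_Icc, e1, h3, abs_le]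
    constructor
    · rintro ⟨t, ht, rfl⟩
      refine ⟨2 * Real.pi - t, ⟨by linarith [ht.2], by linarith [ht.1]⟩, ?_⟩
      rw [exp_two_pi_sub, Circle.exp_neg]
    · rintro ⟨t, ht, rfl⟩
      refine ⟨2 * Real.pi - t, ⟨by linarith [ht.2], by linarith [ht.1]⟩, ?_⟩
      rw [Circle.exp_neg, exp_two_pi_sub, inv_inv]
  · simp only [arc, if_true, mem_image, mem_Icc, e1, midAngle, letterIndex, abs_le]
    constructor
    · rintro ⟨t, ht, rfl⟩
      exact ⟨t, ⟨by linarith [ht.1], by linarith [ht.2]⟩, rfl⟩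
    · rintro ⟨t, ht, rfl⟩
      exact ⟨t, ⟨by linarith [ht.1], by linarith [ht.2]⟩, rfl⟩

/-- The power of a point of the unit circle with respect to the geodesic's circle, by the law of
cosines. It turns membership in a disc into a comparison of cosines. -/
lemma sq_dist_exp_center {d : ℕ} (hd : 2 ≤ d) (a : Letter d) (t : ℝ) :
    dist (Circle.exp t : ℂ) (center a) ^ 2 - geodesicRadius d ^ 2
      = 2 * (Real.cos (halfAngle d) - Real.cos (t - midAngle a)) / Real.cos (halfAngle d) := by
  have hc : 0 < Real.cos (halfAngle d) := cos_angle_pos hd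
  have e : center a = ((Real.cos (halfAngle d))⁻¹ : ℝ) * (Circle.exp (midAngle a) : ℂ) := by
    rw [center_eq hd]; push_cast; field_simp
  rw [Complex.dist_eq, ← Complex.normSq_eq_norm_sq, Complex.normSq_apply, geodesicRadius,
    ← halfAngle, Real.tan_eq_sin_div_cos, e, Circle.coe_exp, Circle.coe_exp]
  simp only [Complex.sub_re, Complex.exp_ofReal_mul_I_re, Complex.sub_im,
    Complex.exp_ofReal_mul_I_im, Complex.re_ofReal_mul, Complex.im_ofReal_mul]
  have h1 := Real.sin_sq_add_cos_sq t
  have h2 := Real.sin_sq_add_cos_sq (midAngle a)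
  have h3 := Real.sin_sq_add_cos_sq (halfAngle d)
  rw [Real.cos_sub]
  field_simp
  linear_combination h2 + Real.cos (halfAngle d) ^ 2 * h1 - h3

/-- The bridge between arcs described by angles and the half discs on which inversions are easy to
estimate. -/
lemma mem_arc_iff {d : ℕ} (hd : 2 ≤ d) (a : Letter d) (x : Circle) :
    x ∈ arc a ↔ dist (x : ℂ) (center a) ≤ geodesicRadius d := by
  have hc : 0 < Real.cos (halfAngle d) := cos_angle_pos hd
  have hpi := natCast_mul_halfAngle hd
  have h0 := halfAngle_pos hd
  have h4 := halfAngle_le hd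
  have hπ := Real.pi_pos
  have hcos : ∀ t, dist (Circle.exp t : ℂ) (center a) ≤ geodesicRadius d ↔
      Real.cos (halfAngle d) ≤ Real.cos (t - midAngle a) := by
    intro t
    rw [← sq_le_sq₀ dist_nonneg (geodesicRadius_pos hd).le, ← sub_nonpos, sq_dist_exp_center hd,
      div_nonpos_iff]
    constructor
    · rintro (h | h) <;> linarith
    · intro h
      exact Or.inr ⟨by linarith, hc.le⟩
  rw [mem_arc_iff_exists hd]
  constructor
  · rintro ⟨t, ht, rfl⟩
    rw [hcos, ← Real.cos_abs (t - _)]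
    exact Real.cos_le_cos_of_nonneg_of_le_pi (abs_nonneg _) (by linarith) ht
  · intro h
    -- The argument is chosen within π of the midpoint, where the cosine is decreasing in the
    -- distance to the midpoint.
    obtain ⟨t, ht, rfl⟩ : ∃ t ∈ Ico (midAngle a - Real.pi) (midAngle a - Real.pi + 2 * Real.pi),
        Circle.exp t = x := by
      have hx := Circle.exp_arg x
      refine ⟨toIcoMod Real.two_pi_pos (midAngle a - Real.pi) (Complex.arg x),
        toIcoMod_mem_Ico _ _ _, ?_⟩
      rw [← self_sub_toIcoDiv_zsmul, Circle.exp_sub]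
      simp [hx]
    refine ⟨t, ?_, rfl⟩
    rw [hcos, ← Real.cos_abs (t - _)] at h
    by_contra hlt
    push Not at hlt
    have : |t - midAngle a| ≤ Real.pi := by
      rw [abs_le]; constructor <;> linarith [ht.1, ht.2]
    exact absurd h (not_le.2 (Real.cos_lt_cos_of_nonneg_of_le_pi h0.le this hlt))

lemma midAngle_sub_halfAngle {d : ℕ} (a : Letter d) :
    Circle.exp (midAngle a - halfAngle d) = arcStart a := by
  rw [arcStart, vertex_eq, midAngle]; congr 1; ring

lemma midAngle_add_halfAngle {d : ℕ} (a : Letter d) :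
    Circle.exp (midAngle a + halfAngle d) = arcEnd a := by
  rw [arcEnd, vertex_eq, midAngle]; congr 1; push_cast; ring

/-- The points of `I_a` on the geodesic are the end points of `I_a`. -/
lemma eq_arcStart_or_arcEnd {d : ℕ} (hd : 2 ≤ d) (a : Letter d) {x : Circle}
    (hx : dist (x : ℂ) (center a) = geodesicRadius d) : x = arcStart a ∨ x = arcEnd a := by
  have hc : 0 < Real.cos (halfAngle d) := cos_angle_pos hd
  have h0 := halfAngle_pos hd
  have h4 := halfAngle_le hd
  have hπ := Real.pi_pos
  obtain ⟨t, ht, rfl⟩ := (mem_arc_iff_exists hd a x).1 ((mem_arc_iff hd a x).2 hx.le)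
  have h1 := sq_dist_exp_center hd a t
  rw [hx, sub_self, eq_comm, div_eq_zero_iff, or_iff_left hc.ne'] at h1
  rw [← Real.cos_abs (t - _)] at h1
  have h2 : |t - midAngle a| = halfAngle d :=
    Real.injOn_cos ⟨abs_nonneg _, by linarith⟩ ⟨h0.le, by linarith⟩ (by linarith)
  rcases (abs_eq h0.le).1 h2 with h | h
  · right; rw [← midAngle_add_halfAngle]; congr 1; linarith
  · left; rw [← midAngle_sub_halfAngle]; congr 1; linarith

/-- Conjugation exchanges the arcs of a and -a and reverses orientation, hence swaps initial and
final points. -/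
lemma arcEnd_neg {d : ℕ} (hd : 2 ≤ d) (a : Letter d) : arcEnd a.neg = (arcStart a)⁻¹ := by
  rw [arcEnd, arcStart, vertex_eq, vertex_eq, ← exp_two_pi_sub]
  congr 1
  have h : (letterIndex a.neg : ℝ) + letterIndex a + 1 = 2 * d := by
    exact_mod_cast letterIndex_neg a
  push_cast
  linear_combination (2 * halfAngle d) * h + 4 * natCast_mul_halfAngle hd

lemma arcStart_injective {d : ℕ} (hd : 2 ≤ d) : Function.Injective (arcStart (d := d)) := by
  intro a b h
  have hpi := natCast_mul_halfAngle hd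
  have h0 := halfAngle_pos hd
  rw [arcStart, arcStart, vertex_eq, vertex_eq] at h
  have hb : ∀ c : Letter d, 2 * (letterIndex c : ℝ) * halfAngle d ∈ Ico 0 (0 + 2 * Real.pi) := by
    intro c
    have : (letterIndex c : ℝ) + 1 ≤ 2 * d := by exact_mod_cast letterIndex_lt c
    exact ⟨by positivity, by nlinarith⟩
  rw [Circle.exp_eq_exp] at h
  obtain ⟨m, hm⟩ := h
  have h1 := hb a
  have h2 := hb b
  have hm0 : m = 0 := by
    have hπ := Real.pi_pos
    have h3 : (m : ℝ) < 1 := by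
      by_contra hge; push Not at hge
      nlinarith [h1.2, h2.1]
    have h4 : (-1 : ℝ) < m := by
      by_contra hge; push Not at hge
      nlinarith [h1.1, h2.2]
    have h5 : m < 1 := by exact_mod_cast h3
    have h6 : -1 < m := by exact_mod_cast h4
    omega
  subst hm0
  apply letterIndex_injective
  have : (letterIndex a : ℝ) = letterIndex b := by
    have := mul_right_cancel₀ h0.ne' (by simpa using hm : 2 * (letterIndex a : ℝ) * halfAngle d = 2 * (letterIndex b : ℝ) * halfAngle d)
    linarith
  exact_mod_cast this

/-- Every point of the circle lies on an arc of which it is not the final point. -/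
lemma exists_mem_arc_ne_arcEnd {d : ℕ} (hd : 2 ≤ d) (x : Circle) :
    ∃ a : Letter d, x ∈ arc a ∧ x ≠ arcEnd a := by
  have hpi := natCast_mul_halfAngle hd
  have h0 := halfAngle_pos hd
  obtain ⟨t, ht, rfl⟩ : ∃ t ∈ Ico (0 : ℝ) (0 + 2 * Real.pi), Circle.exp t = x := by
    refine ⟨toIcoMod Real.two_pi_pos 0 (Complex.arg x), toIcoMod_mem_Ico _ _ _, ?_⟩
    rw [← self_sub_toIcoDiv_zsmul, Circle.exp_sub]
    simp [Circle.exp_arg x]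
  have hk0 : 0 ≤ t / (2 * halfAngle d) := div_nonneg ht.1 (by linarith)
  -- Each arc has length 2 `halfAngle d`; the integer part of the number of arcs traversed is the
  -- index of the half-open arc containing the point.
  have hk : ⌊t / (2 * halfAngle d)⌋₊ < 2 * d := by
    rw [Nat.floor_lt hk0, div_lt_iff₀ (by linarith)]
    push_cast
    nlinarith [ht.2]
  obtain ⟨a, ha⟩ := exists_letterIndex_eq hk
  have h1 := Nat.floor_le hk0
  have h2 := Nat.lt_floor_add_one (t / (2 * halfAngle d))
  rw [← ha] at h1 h2
  rw [le_div_iff₀ (by linarith)] at h1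
  rw [div_lt_iff₀ (by linarith)] at h2
  have hmem : |t - midAngle a| ≤ halfAngle d := by
    rw [abs_le, midAngle]; constructor <;> linarith
  refine ⟨a, (mem_arc_iff_exists hd a _).2 ⟨t, hmem, rfl⟩, ?_⟩
  intro he
  rw [← midAngle_add_halfAngle, Circle.exp_eq_exp] at he
  obtain ⟨m, hm⟩ := he
  rw [midAngle] at hm
  have h3 : (0 : ℝ) < -m := by nlinarith [Real.pi_pos]
  have h4 : (-m : ℝ) < 1 := by
    by_contra hge; push Not at hge
    nlinarith [Real.pi_pos, halfAngle_le hd]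
  have h5 : 0 < -m := by exact_mod_cast h3
  have h6 : -m < 1 := by exact_mod_cast h4
  omega

/-- The arcs without their final points are pairwise disjoint. -/
lemma eq_of_mem_arc_ne_arcEnd {d : ℕ} (hd : 2 ≤ d) {a b : Letter d} {x : Circle}
    (ha : x ∈ arc a) (ha' : x ≠ arcEnd a) (hb : x ∈ arc b) (hb' : x ≠ arcEnd b) : a = b := by
  by_contra hab
  rw [mem_arc_iff hd] at ha hb
  have h1 := (eq_arcStart_or_arcEnd hd a
    (dist_center_eq_and_eq_midpoint hd hab ha hb).1).resolve_right ha'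
  have h2 := (eq_arcStart_or_arcEnd hd b
    (dist_center_eq_and_eq_midpoint hd (Ne.symm hab) hb ha).1).resolve_right hb'
  exact hab (arcStart_injective hd (h1.symm.trans h2))

/-! ## The action of reduced words on the closed disc -/

lemma inversion_conj (c z : ℂ) (R : ℝ) :
    EuclideanGeometry.inversion (starRingEnd ℂ c) R (starRingEnd ℂ z)
      = starRingEnd ℂ (EuclideanGeometry.inversion c R z) := by
  have h : dist (starRingEnd ℂ z) (starRingEnd ℂ c) = dist z c := Complex.dist_conj_conj z c
  simp [EuclideanGeometry.inversion, h]

/-- Generators and inverses take the same form: conjugating and then reflecting is the same as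
reflecting in the mirror circle, whose centre belongs to the negative letter, and then conjugating.
-/
lemma coe_piece {d : ℕ} (hd : 2 ≤ d) (a : Letter d) (z : ClosedDisc) :
    (piece hd a z : ℂ) = starRingEnd ℂ
      (EuclideanGeometry.inversion (center a) (geodesicRadius d) z) := by
  obtain ⟨j, _ | _⟩ := a
  · rw [piece_false, ← inversion_conj]
    simp only [center, Bool.false_eq_true, if_false, Complex.conj_conj]
    rfl
  · rfl

lemma piece_neg {d : ℕ} (hd : 2 ≤ d) (a : Letter d) : piece hd a.neg = (piece hd a)⁻¹ := by
  obtain ⟨j, _ | _⟩ := a <;> simp [piece, Letter.neg]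

@[simp] lemma piece_neg_piece {d : ℕ} (hd : 2 ≤ d) (a : Letter d) (z : ClosedDisc) :
    piece hd a.neg (piece hd a z) = z := by simp [piece_neg]

@[simp] lemma piece_piece_neg {d : ℕ} (hd : 2 ≤ d) (a : Letter d) (z : ClosedDisc) :
    piece hd a (piece hd a.neg z) = z := by simp [piece_neg]

lemma coe_ne_center {d : ℕ} (hd : 2 ≤ d) (a : Letter d) (z : ClosedDisc) : (z : ℂ) ≠ center a :=
  ne_center hd a (mem_closedBall_zero_iff.1 z.2)

lemma dist_piece_center {d : ℕ} (hd : 2 ≤ d) (a : Letter d) (z : ClosedDisc) :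
    dist (piece hd a z : ℂ) (center a.neg) = geodesicRadius d ^ 2 / dist (z : ℂ) (center a) := by
  rw [coe_piece, center_neg, Complex.dist_conj_conj, EuclideanGeometry.dist_inversion_center]

/-- The distortion factor is at most 1 as soon as both points lie outside the half disc of a; all
contraction estimates come from it. -/
lemma dist_piece_piece {d : ℕ} (hd : 2 ≤ d) (a : Letter d) (y z : ClosedDisc) :
    dist (piece hd a y) (piece hd a z) = geodesicRadius d ^ 2 /
      (dist (y : ℂ) (center a) * dist (z : ℂ) (center a)) * dist y z := by
  rw [Subtype.dist_eq, coe_piece, coe_piece, Complex.dist_conj_conj,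
    EuclideanGeometry.dist_inversion_inversion (coe_ne_center hd a y) (coe_ne_center hd a z),
    Subtype.dist_eq]

lemma continuous_piece {d : ℕ} (hd : 2 ≤ d) (a : Letter d) : Continuous (piece hd a) := by
  refine Continuous.subtype_mk (f := fun z => (piece hd a z : ℂ)) ?_ (fun z => (piece hd a z).2)
  simp only [coe_piece]
  exact Complex.continuous_conj.comp (continuous_const.inversion continuous_const
    continuous_subtype_val fun z => coe_ne_center hd a z)

/-- The closed half disc bounded by `C_a` and `I_a`. -/
def halfDisc {d : ℕ} (a : Letter d) : Set ClosedDisc :=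
  {z | dist (z : ℂ) (center a) ≤ geodesicRadius d}

lemma isClosed_halfDisc {d : ℕ} (a : Letter d) : IsClosed (halfDisc a) :=
  isClosed_le (continuous_subtype_val.dist continuous_const) continuous_const

/-- The closure of the complement of `halfDisc a`. -/
def coHalfDisc {d : ℕ} (a : Letter d) : Set ClosedDisc :=
  {z | geodesicRadius d ≤ dist (z : ℂ) (center a)}

lemma halfDisc_subset_coHalfDisc {d : ℕ} (hd : 2 ≤ d) {a b : Letter d} (h : a ≠ b) :
    halfDisc a ⊆ coHalfDisc b := fun _ hz => le_dist_center_of_ne hd h hz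

/-- Ping-pong: the distances to the two centres multiply to the squared radius, so outside becomes
inside. -/
lemma piece_mem_halfDisc {d : ℕ} (hd : 2 ≤ d) {a : Letter d} {z : ClosedDisc}
    (hz : z ∈ coHalfDisc a) : piece hd a z ∈ halfDisc a.neg := by
  have hR := geodesicRadius_pos hd
  rw [halfDisc, mem_ofPred_eq, dist_piece_center, div_le_iff₀ (hR.trans_le hz), sq]
  exact mul_le_mul_of_nonneg_left hz hR.le

lemma piece_mem_coHalfDisc {d : ℕ} (hd : 2 ≤ d) {a : Letter d} {z : ClosedDisc}
    (hz : z ∈ halfDisc a) : piece hd a z ∈ coHalfDisc a.neg := by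
  have hR := geodesicRadius_pos hd
  have h0 : 0 < dist (z : ℂ) (center a) := dist_pos.2 (coe_ne_center hd a z)
  rw [coHalfDisc, mem_ofPred_eq, dist_piece_center, le_div_iff₀ h0, sq]
  exact mul_le_mul_of_nonneg_left hz hR.le

lemma dist_piece_le {d : ℕ} (hd : 2 ≤ d) {a : Letter d} {y z : ClosedDisc}
    (hy : y ∈ coHalfDisc a) (hz : z ∈ coHalfDisc a) :
    dist (piece hd a y) (piece hd a z) ≤ dist y z := by
  have hR := geodesicRadius_pos hd
  have h : 0 < dist (y : ℂ) (center a) * dist (z : ℂ) (center a) :=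
    mul_pos (hR.trans_le hy) (hR.trans_le hz)
  rw [dist_piece_piece]
  refine mul_le_of_le_one_left dist_nonneg ((div_le_one h).2 ?_)
  rw [sq]
  exact mul_le_mul hy hz hR.le (hR.le.trans hy)

/-- The factor equals 1 only if both points lie on the boundary of the half disc of a. The half disc
of b meets it in at most one point, so two distinct points cannot both be there. -/
lemma dist_piece_lt {d : ℕ} (hd : 2 ≤ d) {a b : Letter d} (hab : b ≠ a) {y z : ClosedDisc}
    (hy : y ∈ halfDisc b) (hz : z ∈ halfDisc b) (hyz : y ≠ z) :
    dist (piece hd a y) (piece hd a z) < dist y z := by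
  have hR := geodesicRadius_pos hd
  have hy' := halfDisc_subset_coHalfDisc hd hab hy
  have hz' := halfDisc_subset_coHalfDisc hd hab hz
  have h : 0 < dist (y : ℂ) (center a) * dist (z : ℂ) (center a) :=
    mul_pos (hR.trans_le hy') (hR.trans_le hz')
  rw [dist_piece_piece]
  refine mul_lt_of_lt_one_left (dist_pos.2 hyz) ((div_lt_one h).2 ?_)
  rw [sq]
  by_contra hle
  push Not at hle
  rw [coHalfDisc, mem_ofPred_eq] at hy' hz'
  have h1 : dist (y : ℂ) (center a) ≤ geodesicRadius d := by
    by_contra hlt; push Not at hlt; nlinarith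
  have h2 : dist (z : ℂ) (center a) ≤ geodesicRadius d := by
    by_contra hlt; push Not at hlt; nlinarith
  have e1 := (dist_center_eq_and_eq_midpoint hd hab hy h1).2
  have e2 := (dist_center_eq_and_eq_midpoint hd hab hz h2).2
  exact hyz (Subtype.ext (mul_left_cancel₀ two_ne_zero (e1.trans e2.symm)))

/-- On pairs of points at distance at least `ε` the contraction is definite. -/
lemma exists_dist_piece_le_sub {d : ℕ} (hd : 2 ≤ d) {ε : ℝ} (hε : 0 < ε) :
    ∃ δ > 0, ∀ a b : Letter d, b ≠ a → ∀ y ∈ halfDisc b, ∀ z ∈ halfDisc b, ε ≤ dist y z →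
      dist (piece hd a y) (piece hd a z) ≤ dist y z - δ := by
  have key : ∀ p : Letter d × Letter d, ∃ δ > 0, p.2 ≠ p.1 → ∀ y ∈ halfDisc p.2,
      ∀ z ∈ halfDisc p.2, ε ≤ dist y z →
        dist (piece hd p.1 y) (piece hd p.1 z) ≤ dist y z - δ := by
    rintro ⟨a, b⟩
    by_cases hab : b = a
    · exact ⟨1, one_pos, fun h => absurd hab h⟩
    -- At a tangency the distortion factor approaches 1, so no contraction ratio works uniformly.
    -- The loss of distance is however continuous and positive on this compact set of pairs, and δ
    -- is its minimum.
    let K : Set (ClosedDisc × ClosedDisc) :=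
      (halfDisc b ×ˢ halfDisc b) ∩ {q | ε ≤ dist q.1 q.2}
    have hK : IsCompact K := (((isClosed_halfDisc b).prod (isClosed_halfDisc b)).inter
      (isClosed_le continuous_const continuous_dist)).isCompact
    have hc := continuous_piece hd a
    have hf : Continuous fun q : ClosedDisc × ClosedDisc =>
        dist q.1 q.2 - dist (piece hd a q.1) (piece hd a q.2) := by fun_prop
    rcases K.eq_empty_or_nonempty with hKe | hKn
    · refine ⟨1, one_pos, fun _ y hy z hz hyz => ?_⟩
      exact absurd (show (y, z) ∈ K from ⟨⟨hy, hz⟩, hyz⟩) (by simp [hKe])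
    · obtain ⟨q, hq, hmin⟩ := hK.exists_isMinOn hKn hf.continuousOn
      refine ⟨_, sub_pos.2 (dist_piece_lt hd hab hq.1.1 hq.1.2 ?_), fun _ y hy z hz hyz => ?_⟩
      · exact dist_pos.1 (hε.trans_le hq.2)
      · have := hmin (show (y, z) ∈ K from ⟨⟨hy, hz⟩, hyz⟩)
        simp only [mem_ofPred_eq] at this
        linarith
  choose δ hδ h using key
  have : Nonempty (Letter d) := ⟨(⟨0, by omega⟩, true)⟩
  obtain ⟨p, hp⟩ := Finite.exists_min δ
  refine ⟨δ p, hδ p, fun a b hab y hy z hz hyz => ?_⟩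
  have := h (a, b) hab y hy z hz hyz
  linarith [hp (a, b)]

/-- The action of a word in the generators. -/
def wordAct {d : ℕ} (hd : 2 ≤ d) (L : List (Letter d)) : Equiv.Perm ClosedDisc :=
  (L.map (piece hd)).prod

lemma marking_mk {d : ℕ} (hd : 2 ≤ d) (L : List (Letter d)) :
    marking hd (FreeGroup.mk L) = wordAct hd L := by
  rw [marking, FreeGroup.lift_mk, wordAct]
  congr 1
  refine List.map_congr_left fun a _ => ?_
  obtain ⟨j, _ | _⟩ := a <;> rfl

@[simp] lemma wordAct_nil {d : ℕ} (hd : 2 ≤ d) (z : ClosedDisc) : wordAct hd [] z = z := rfl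

@[simp] lemma wordAct_cons {d : ℕ} (hd : 2 ≤ d) (a : Letter d) (L : List (Letter d))
    (z : ClosedDisc) : wordAct hd (a :: L) z = piece hd a (wordAct hd L z) := by
  simp [wordAct]

lemma wordAct_append {d : ℕ} (hd : 2 ≤ d) (L M : List (Letter d)) (z : ClosedDisc) :
    wordAct hd (L ++ M) z = wordAct hd L (wordAct hd M z) := by
  simp [wordAct]

lemma norm_wordAct {d : ℕ} (hd : 2 ≤ d) (L : List (Letter d)) {z : ClosedDisc}
    (hz : ‖(z : ℂ)‖ = 1) : ‖(wordAct hd L z : ℂ)‖ = 1 := by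
  induction L with
  | nil => exact hz
  | cons a L ih => rw [wordAct_cons]; exact norm_piece hd a _ ih

lemma Letter.eq_neg_iff {d : ℕ} (a b : Letter d) : b = a.neg ↔ a.1 = b.1 ∧ a.2 ≠ b.2 := by
  obtain ⟨i, s⟩ := a
  obtain ⟨j, t⟩ := b
  cases s <;> cases t <;> simp [Letter.neg, eq_comm]

lemma isReduced_cons_cons_iff {d : ℕ} {a b : Letter d} {L : List (Letter d)} :
    FreeGroup.IsReduced (a :: b :: L) ↔ b ≠ a.neg ∧ FreeGroup.IsReduced (b :: L) := by
  rw [FreeGroup.isReduced_cons_cons, Ne, Letter.eq_neg_iff]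
  simp

/-- The points of the disc on which the last letter of the word `L` acts as a contraction. -/
def wordDomain {d : ℕ} (L : List (Letter d)) : Set ClosedDisc :=
  {z | ∀ b ∈ L.getLast?, z ∈ coHalfDisc b}

lemma wordDomain_cons_cons {d : ℕ} (a b : Letter d) (L : List (Letter d)) :
    wordDomain (a :: b :: L) = wordDomain (b :: L) := by
  simp [wordDomain, List.getLast?_cons_cons]

/-- The base point of the disc. -/
def origin : ClosedDisc := ⟨0, by simp⟩

lemma origin_mem_coHalfDisc {d : ℕ} (hd : 2 ≤ d) (a : Letter d) : origin ∈ coHalfDisc a := by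
  rw [coHalfDisc, mem_ofPred_eq, origin, dist_comm, dist_zero_right]
  nlinarith [normSq_center hd a, norm_nonneg (center a), geodesicRadius_pos hd]

lemma origin_mem_wordDomain {d : ℕ} (hd : 2 ≤ d) (L : List (Letter d)) :
    origin ∈ wordDomain L := fun b _ => origin_mem_coHalfDisc hd b

/-- Ping-pong along the word, from its last letter: after acting by b the point is in the half disc
of -b, and since the word is reduced this differs from the half disc of the letter acting next. -/
lemma wordAct_mem_halfDisc {d : ℕ} (hd : 2 ≤ d) {a : Letter d} {L : List (Letter d)}
    (hL : FreeGroup.IsReduced (a :: L)) {z : ClosedDisc} (hz : z ∈ wordDomain (a :: L)) :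
    wordAct hd (a :: L) z ∈ halfDisc a.neg := by
  induction L generalizing a with
  | nil => exact piece_mem_halfDisc hd (hz a (by simp))
  | cons b L ih =>
    rw [isReduced_cons_cons_iff] at hL
    rw [wordDomain_cons_cons] at hz
    rw [wordAct_cons]
    refine piece_mem_halfDisc hd (halfDisc_subset_coHalfDisc hd ?_ (ih hL.2 hz))
    rw [Ne, ← Letter.neg_injective.eq_iff, Letter.neg_neg]
    exact hL.1

/-- Long reduced words contract uniformly. -/
lemma exists_length_dist_wordAct_lt {d : ℕ} (hd : 2 ≤ d) {ε : ℝ} (hε : 0 < ε) :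
    ∃ n : ℕ, ∀ L : List (Letter d), FreeGroup.IsReduced L → n ≤ L.length →
      ∀ y ∈ wordDomain L, ∀ z ∈ wordDomain L,
        dist (wordAct hd L y) (wordAct hd L z) < ε := by
  obtain ⟨δ, hδ, h⟩ := exists_dist_piece_le_sub hd hε
  -- If the final distance is still at least ε, so were all intermediate ones, because no letter
  -- expands. Starting from the diameter 2 of the disc, every letter but the last of the word then
  -- costs δ; the last one only moves the points into a half disc.
  have key : ∀ (L : List (Letter d)) (a : Letter d), FreeGroup.IsReduced (a :: L) →
      ∀ y ∈ wordDomain (a :: L), ∀ z ∈ wordDomain (a :: L),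
        ε ≤ dist (wordAct hd (a :: L) y) (wordAct hd (a :: L) z) →
        dist (wordAct hd (a :: L) y) (wordAct hd (a :: L) z) ≤ 2 - δ * L.length := by
    intro L
    induction L with
    | nil =>
      intro a _ y hy z hz _
      have h1 := dist_le_norm_add_norm (wordAct hd [a] y : ℂ) (wordAct hd [a] z)
      have h2 := mem_closedBall_zero_iff.1 (wordAct hd [a] y).2
      have h3 := mem_closedBall_zero_iff.1 (wordAct hd [a] z).2
      rw [Subtype.dist_eq]
      simp only [List.length_nil, Nat.cast_zero, mul_zero, sub_zero]
      linarith
    | cons b L ih =>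
      intro a hL y hy z hz hε'
      have hL' := isReduced_cons_cons_iff.1 hL
      rw [wordDomain_cons_cons] at hy hz
      have hy' := wordAct_mem_halfDisc hd hL'.2 hy
      have hz' := wordAct_mem_halfDisc hd hL'.2 hz
      have hne : b.neg ≠ a := by
        rw [Ne, ← Letter.neg_injective.eq_iff, Letter.neg_neg]
        exact hL'.1
      rw [wordAct_cons hd a, wordAct_cons hd a] at hε' ⊢
      have h1 := dist_piece_le hd (halfDisc_subset_coHalfDisc hd hne hy')
        (halfDisc_subset_coHalfDisc hd hne hz')
      have h2 := h a b.neg hne _ hy' _ hz' (hε'.trans h1)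
      have h3 := ih b hL'.2 y hy z hz (hε'.trans h1)
      push_cast [List.length_cons]
      linarith
  obtain ⟨n, hn⟩ := exists_nat_gt (2 / δ)
  -- One letter more than the number of losses needed, as the last letter of the word gives none.
  refine ⟨n + 1, fun L hL hlen y hy z hz => ?_⟩
  obtain _ | ⟨a, L⟩ := L
  · simp at hlen
  by_contra hge
  push Not at hge
  have h1 := key L a hL y hy z hz hge
  have h2 : (n : ℝ) ≤ L.length := by
    have : n ≤ L.length := by simpa using hlen
    exact_mod_cast this
  rw [div_lt_iff₀ hδ] at hn
  nlinarith

lemma getLast?_append_cons {d : ℕ} {L M : List (Letter d)} {a b : Letter d}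
    (h : FreeGroup.IsReduced (L ++ a :: M)) (hb : b ∈ L.getLast?) : a ≠ b.neg := by
  rw [FreeGroup.IsReduced, List.isChain_append] at h
  have := h.2.2 b hb a (by simp)
  rw [Ne, Letter.eq_neg_iff]
  tauto

/-- Points in the domain of a reduced word that is continued are moved into the domain of the
prefix. -/
lemma wordAct_mem_wordDomain {d : ℕ} (hd : 2 ≤ d) {L M : List (Letter d)}
    (h : FreeGroup.IsReduced (L ++ M)) {z : ClosedDisc} (hM : M ≠ [])
    (hz : z ∈ wordDomain M) : wordAct hd M z ∈ wordDomain L := by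
  obtain _ | ⟨a, M⟩ := M
  · exact absurd rfl hM
  · intro b hb
    have h1 := wordAct_mem_halfDisc hd (h.infix (List.suffix_append _ _).isInfix) hz
    refine halfDisc_subset_coHalfDisc hd ?_ h1
    rw [Ne, ← Letter.neg_injective.eq_iff, Letter.neg_neg]
    exact getLast?_append_cons h hb

lemma wordAct_origin_mem_wordDomain {d : ℕ} (hd : 2 ≤ d) {L M : List (Letter d)}
    (h : FreeGroup.IsReduced (L ++ M)) : wordAct hd M origin ∈ wordDomain L := by
  by_cases hM : M = []
  · subst hM
    exact origin_mem_wordDomain hd L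
  · exact wordAct_mem_wordDomain hd h hM (origin_mem_wordDomain hd M)

/-! ## Rays in the Cayley tree -/

/-- The reduced word of a product is a sublist of the concatenation of the reduced words; as the
norm grows by the full amount, nothing cancels. -/
lemma toWord_mul_of_norm_eq_one {d : ℕ} {g h : FreeGroup (Fin d)} (h1 : wordDist g h = 1)
    (h2 : h.norm = g.norm + 1) : ∃ a : Letter d, h.toWord = g.toWord ++ [a] := by
  obtain ⟨a, ha⟩ := List.length_eq_one_iff.1 (h1 : (g⁻¹ * h).toWord.length = 1)
  have hs := FreeGroup.toWord_mul_sublist g (g⁻¹ * h)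
  rw [mul_inv_cancel_left, ha] at hs
  exact ⟨a, hs.eq_of_length (by rw [List.length_append]; exact h2)⟩

namespace IsGeneralizedRay

variable {d : ℕ} {c : ℕ → FreeGroup (Fin d)} {R : ℕ∞}

lemma norm_eq (hc : IsGeneralizedRay c R) {n : ℕ} (hn : (n : ℕ∞) ≤ R) : (c n).norm = n := by
  have := hc.geodesic 0 n (by simpa using hn)
  rwa [zero_add, wordDist, hc.base, inv_one, one_mul] at this

lemma succ (hc : IsGeneralizedRay c R) (n : ℕ) :
    (∃ a, (c (n + 1)).toWord = (c n).toWord ++ [a]) ∨ c (n + 1) = c n := by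
  rcases le_or_gt ((n + 1 : ℕ) : ℕ∞) R with h | h
  · left
    refine toWord_mul_of_norm_eq_one (hc.geodesic n 1 h) ?_
    rw [hc.norm_eq h, hc.norm_eq (le_trans (by exact_mod_cast Nat.le_succ n) h)]
  · right
    refine hc.constant n 1 ?_
    rw [Nat.cast_add, Nat.cast_one] at h
    exact Order.le_of_lt_add_one h

lemma toWord_prefix (hc : IsGeneralizedRay c R) (m k : ℕ) :
    (c m).toWord <+: (c (m + k)).toWord := by
  induction k with
  | zero => exact List.prefix_rfl
  | succ k ih =>
    rcases hc.succ (m + k) with ⟨a, ha⟩ | h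
    · rw [← add_assoc, ha]; exact ih.trans (List.prefix_append _ _)
    · rw [← add_assoc, h]; exact ih

lemma norm_eq_or_constant (hc : IsGeneralizedRay c R) (n : ℕ) :
    (c n).norm = n ∨ ∀ k, c (n + k) = c n := by
  rcases le_total (n : ℕ∞) R with h | h
  · exact Or.inl (hc.norm_eq h)
  · exact Or.inr fun k => hc.constant n k h

lemma norm_le (hc : IsGeneralizedRay c R) (n : ℕ) : (c n).norm ≤ n := by
  have h := hc.constant
  rcases le_total (n : ℕ∞) R with h | h
  · exact (hc.norm_eq h).le
  · lift R to ℕ using (h.trans_lt (ENat.natCast_lt_top n)).ne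
    have hRn : R ≤ n := by exact_mod_cast h
    obtain ⟨k, rfl⟩ := Nat.exists_eq_add_of_le hRn
    rw [hc.constant R k le_rfl, hc.norm_eq le_rfl]
    exact hRn

/-- A ray runs through the prefixes of a growing reduced word, so up to time m it agrees with the
geodesic to any later vertex. Hence its vertices converge to it in the compactification. -/
lemma toWord_eq_take (hc : IsGeneralizedRay c R) (m k : ℕ) :
    (c m).toWord = (c (m + k)).toWord.take m := by
  rcases hc.norm_eq_or_constant m with h | h
  · have := List.prefix_iff_eq_take.1 (hc.toWord_prefix m k)
    rwa [show (c m).toWord.length = m from h] at this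
  · rw [h k, List.take_of_length_le (hc.norm_le m)]

end IsGeneralizedRay

instance (d : ℕ) : T2Space (Compactification d) := inferInstanceAs (T2Space (Subtype _))
instance (d : ℕ) : TopologicalSpace.MetrizableSpace (Compactification d) :=
  have : SecondCountableTopology (Compactification d) :=
    TopologicalSpace.Subtype.secondCountableTopology
      {c : ℕ → FreeGroup (Fin d) | ∃ R, IsGeneralizedRay c R}
  have : T3Space (Compactification d) := inferInstanceAs (T3Space (Subtype _))
  TopologicalSpace.metrizableSpace_of_t3_secondCountable _
instance (d : ℕ) : T2Space (Boundary d) := inferInstanceAs (T2Space (Subtype _))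

lemma ofVertex_apply {d : ℕ} (g : FreeGroup (Fin d)) {n : ℕ} (hn : g.norm ≤ n) :
    (ofVertex g).1 n = g := by
  change FreeGroup.mk (g.toWord.take n) = g
  rw [List.take_of_length_le hn, FreeGroup.mk_toWord]

/-- Every point of the compactification is the limit of the vertices on the ray towards it. -/
lemma tendsto_ofVertex {d : ℕ} (c : Compactification d) :
    Tendsto (fun n => ofVertex (c.1 n)) atTop (𝓝 c) := by
  obtain ⟨c, R, hc⟩ := c
  refine (IsEmbedding.subtypeVal (p := fun c : ℕ → FreeGroup (Fin d) =>
    ∃ R, IsGeneralizedRay c R)).tendsto_nhds_iff.2 (tendsto_pi_nhds.2 fun m => ?_)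
  refine tendsto_const_nhds.congr' ?_
  filter_upwards [eventually_ge_atTop m] with n hn
  obtain ⟨k, rfl⟩ := Nat.exists_eq_add_of_le hn
  change c m = FreeGroup.mk ((c (m + k)).toWord.take m)
  rw [← hc.toWord_eq_take m k, FreeGroup.mk_toWord]

lemma denseRange_ofVertex (d : ℕ) : DenseRange (ofVertex (d := d)) := fun c =>
  mem_closure_of_tendsto (tendsto_ofVertex c) (Eventually.of_forall fun _ => mem_range_self _)

lemma isEmbedding_ofBoundary (d : ℕ) : IsEmbedding (ofBoundary (d := d)) := by
  refine IsEmbedding.of_comp (g := Subtype.val) ?_ continuous_subtype_val ?_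
  · exact Continuous.subtype_mk (f := fun ξ : Boundary d => ξ.1) continuous_subtype_val
      fun ξ => ⟨⊤, ξ.2⟩
  · exact IsEmbedding.subtypeVal

/-! ## The Cannon–Thurston map -/

/-- The orbit of the base point of the disc along a ray. -/
def rayOrbit {d : ℕ} (hd : 2 ≤ d) (n : ℕ) (c : Compactification d) : ClosedDisc :=
  marking hd (c.1 n) origin

lemma continuous_rayOrbit {d : ℕ} (hd : 2 ≤ d) (n : ℕ) : Continuous (rayOrbit hd n) := by
  have : Continuous fun c : Compactification d => c.1 n :=
    (continuous_apply n).comp continuous_subtype_val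
  exact (continuous_of_discreteTopology (f := fun g => marking hd g origin)).comp this

lemma marking_eq_wordAct {d : ℕ} (hd : 2 ≤ d) (g : FreeGroup (Fin d)) :
    marking hd g = wordAct hd g.toWord := by
  conv_lhs => rw [← FreeGroup.mk_toWord (x := g)]
  exact marking_mk hd _

/-- If the word of `c (n + k)` is that of `c n` followed by M, the two orbit points are the images
of M · 0 and 0 under the long word of `c n`, which contracts its domain to diameter below ε. The
bound is independent of the ray. -/
lemma exists_dist_rayOrbit_lt {d : ℕ} (hd : 2 ≤ d) {ε : ℝ} (hε : 0 < ε) :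
    ∃ N : ℕ, ∀ n ≥ N, ∀ c : Compactification d, ∀ k,
      dist (rayOrbit hd (n + k) c) (rayOrbit hd n c) < ε := by
  obtain ⟨N, hN⟩ := exists_length_dist_wordAct_lt hd hε
  refine ⟨N, fun n hn c k => ?_⟩
  obtain ⟨c, R, hc⟩ := c
  rcases hc.norm_eq_or_constant n with h | h
  · obtain ⟨M, hM⟩ := hc.toWord_prefix n k
    have hred : FreeGroup.IsReduced ((c n).toWord ++ M) := hM ▸ FreeGroup.isReduced_toWord
    simp only [rayOrbit, marking_eq_wordAct]
    rw [← hM, wordAct_append]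
    exact hN _ FreeGroup.isReduced_toWord (hn.trans h.ge) _
      (wordAct_origin_mem_wordDomain hd hred) _ (origin_mem_wordDomain hd _)
  · simp only [rayOrbit, h k, dist_self, hε]

lemma exists_tendsto_rayOrbit {d : ℕ} (hd : 2 ≤ d) (c : Compactification d) :
    ∃ z, Tendsto (fun n => rayOrbit hd n c) atTop (𝓝 z) := by
  refine cauchySeq_tendsto_of_complete (Metric.cauchySeq_iff'.2 fun ε hε => ?_)
  obtain ⟨N, hN⟩ := exists_dist_rayOrbit_lt hd hε
  refine ⟨N, fun n hn => ?_⟩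
  obtain ⟨k, rfl⟩ := Nat.exists_eq_add_of_le hn
  exact hN N le_rfl c k

/-- The extension of the orbit map to the compactification. -/
def orbitExtension {d : ℕ} (hd : 2 ≤ d) (c : Compactification d) : ClosedDisc :=
  (exists_tendsto_rayOrbit hd c).choose

lemma tendsto_rayOrbit {d : ℕ} (hd : 2 ≤ d) (c : Compactification d) :
    Tendsto (fun n => rayOrbit hd n c) atTop (𝓝 (orbitExtension hd c)) :=
  (exists_tendsto_rayOrbit hd c).choose_spec

/-- A uniform limit of the maps `rayOrbit hd n`, which depend only on the n-th vertex and are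
therefore locally constant. -/
lemma continuous_orbitExtension {d : ℕ} (hd : 2 ≤ d) : Continuous (orbitExtension hd) := by
  refine TendstoUniformly.continuous (F := rayOrbit hd) (p := atTop) ?_
    (Frequently.of_forall fun n => continuous_rayOrbit hd n)
  rw [Metric.tendstoUniformly_iff]
  intro ε hε
  obtain ⟨N, hN⟩ := exists_dist_rayOrbit_lt hd (half_pos hε)
  filter_upwards [eventually_ge_atTop N] with n hn c
  refine lt_of_le_of_lt ?_ (half_lt_self hε)
  refine le_of_tendsto ((tendsto_rayOrbit hd c).dist tendsto_const_nhds) ?_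
  filter_upwards [eventually_ge_atTop n] with m hm
  obtain ⟨k, rfl⟩ := Nat.exists_eq_add_of_le hm
  exact (hN n hn c k).le

lemma orbitExtension_ofVertex {d : ℕ} (hd : 2 ≤ d) (g : FreeGroup (Fin d)) :
    orbitExtension hd (ofVertex g) = marking hd g origin := by
  refine tendsto_nhds_unique (tendsto_rayOrbit hd _) (tendsto_const_nhds.congr' ?_)
  filter_upwards [eventually_ge_atTop g.norm] with n hn
  rw [rayOrbit, ofVertex_apply g hn]

/-! ### The identification of the shift space with the boundary -/

lemma ShiftSpace.ne_neg {d : ℕ} (ω : ShiftSpace d) (k : ℕ) : ω.1 (k + 1) ≠ (ω.1 k).neg := by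
  intro h
  have := ω.2 k
  rw [transitionMatrix, if_pos h] at this
  exact zero_ne_one this

/-- The element of the shift space given by an admissible sequence. -/
def ShiftSpace.mk' {d : ℕ} (w : ℕ → Letter d) (h : ∀ k, w (k + 1) ≠ (w k).neg) : ShiftSpace d :=
  ⟨w, fun k => by rw [transitionMatrix, if_neg (h k)]⟩

lemma inversePrefix_succ {d : ℕ} (ω : ShiftSpace d) (n : ℕ) :
    inversePrefix ω (n + 1) = inversePrefix ω n ++ [(ω.1 n).neg] := by
  simp [inversePrefix, List.range_succ]

lemma inversePrefix_succ' {d : ℕ} (ω : ShiftSpace d) (n : ℕ) :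
    inversePrefix ω (n + 1) = (ω.1 0).neg :: inversePrefix (shift ω) n := by
  simp [inversePrefix, List.range_succ_eq_map, shift, Function.comp_def]

lemma length_inversePrefix {d : ℕ} (ω : ShiftSpace d) (n : ℕ) :
    (inversePrefix ω n).length = n := by simp [inversePrefix]

lemma toWord_mk_inversePrefix {d : ℕ} (ω : ShiftSpace d) (n : ℕ) :
    (FreeGroup.mk (inversePrefix ω n)).toWord = inversePrefix ω n := by
  rw [FreeGroup.toWord_mk, (isReduced_inversePrefix ω n).reduce_eq]

lemma inversePrefix_eq_iff {d : ℕ} (ω η : ShiftSpace d) (n : ℕ) :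
    inversePrefix ω n = inversePrefix η n ↔ ω ∈ cylinder η n := by
  rw [inversePrefix, inversePrefix, List.map_inj_left]
  simp [cylinder, Letter.neg_injective.eq_iff]

lemma mk_inversePrefix_eq_iff {d : ℕ} (ω η : ShiftSpace d) (n : ℕ) :
    FreeGroup.mk (inversePrefix ω n) = FreeGroup.mk (inversePrefix η n) ↔ ω ∈ cylinder η n := by
  rw [← inversePrefix_eq_iff, ← FreeGroup.toWord_inj, toWord_mk_inversePrefix,
    toWord_mk_inversePrefix]

lemma continuous_coord {d : ℕ} (n : ℕ) : Continuous fun ω : ShiftSpace d => ω.1 n :=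
  (continuous_apply n).comp continuous_subtype_val

lemma continuous_mk_inversePrefix {d : ℕ} (n : ℕ) :
    Continuous fun ω : ShiftSpace d => FreeGroup.mk (inversePrefix ω n) := by
  let F : (Fin n → Letter d) → FreeGroup (Fin d) := fun w =>
    FreeGroup.mk ((List.finRange n).map fun k => (w k).neg)
  have hF : (fun ω : ShiftSpace d => FreeGroup.mk (inversePrefix ω n))
      = F ∘ fun ω k => ω.1 k := by
    funext ω
    simp only [F, Function.comp, inversePrefix]
    congr 1
    rw [← List.map_coe_finRange_eq_range, List.map_map]
    rfl
  rw [hF]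
  exact continuous_of_discreteTopology.comp (continuous_pi fun k => continuous_coord k.1)

lemma continuous_toBoundary (d : ℕ) : Continuous (toBoundary (d := d)) :=
  Continuous.subtype_mk (continuous_pi continuous_mk_inversePrefix) fun ω => (toBoundary ω).2

lemma injective_toBoundary (d : ℕ) : Function.Injective (toBoundary (d := d)) := by
  intro ω η h
  refine Subtype.ext (funext fun k => ?_)
  have h1 : FreeGroup.mk (inversePrefix ω (k + 1)) = FreeGroup.mk (inversePrefix η (k + 1)) :=
    congrFun (congrArg Subtype.val h) (k + 1)
  exact (mk_inversePrefix_eq_iff ω η (k + 1)).1 h1 k (Nat.lt_succ_self k)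

lemma surjective_toBoundary (d : ℕ) : Function.Surjective (toBoundary (d := d)) := by
  rintro ⟨c, hc⟩
  have hnorm : ∀ n, (c n).norm = n := fun n => hc.norm_eq le_top
  have hstep : ∀ n, ∃ a, (c (n + 1)).toWord = (c n).toWord ++ [a] := fun n =>
    (hc.succ n).resolve_right fun h => by
      have h1 := hnorm (n + 1)
      rw [h, hnorm] at h1
      omega
  choose a ha using hstep
  change ℕ → Letter d at a
  have hadm : ∀ k, Letter.neg (a (k + 1)) ≠ (Letter.neg (a k)).neg := by
    intro k h
    have h1 : FreeGroup.IsReduced ((c k).toWord ++ [a k] ++ [a (k + 1)]) := by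
      rw [← ha, ← ha]; exact FreeGroup.isReduced_toWord
    refine getLast?_append_cons h1 (b := a k) (by simp) ?_
    exact Letter.neg_injective h
  refine ⟨ShiftSpace.mk' (fun k => Letter.neg (a k)) hadm, Subtype.ext (funext fun n => ?_)⟩
  have : ∀ n, inversePrefix (ShiftSpace.mk' (fun k => Letter.neg (a k)) hadm) n = (c n).toWord := by
    intro n
    induction n with
    | zero => simp [inversePrefix, hc.base]
    | succ n ih => rw [inversePrefix_succ, ih, ha]; simp [ShiftSpace.mk']
  change FreeGroup.mk (inversePrefix _ n) = c n
  rw [this, FreeGroup.mk_toWord]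

instance (d : ℕ) : CompactSpace (ShiftSpace d) := by
  have : IsClosed {ω : ℕ → Letter d | ∀ k, transitionMatrix d (ω k) (ω (k + 1)) = 1} := by
    simp only [ofPred_forall]
    refine isClosed_iInter fun k => ?_
    have hc : Continuous fun ω : ℕ → Letter d => (ω k, ω (k + 1)) :=
      (continuous_apply k).prodMk (continuous_apply (k + 1))
    exact IsClosed.preimage (t := {p | transitionMatrix d p.1 p.2 = 1}) hc (isClosed_discrete _)
  exact isCompact_iff_compactSpace.1 this.isCompact

theorem isHomeomorph_toBoundary (d : ℕ) : IsHomeomorph (toBoundary (d := d)) :=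
  isHomeomorph_iff_continuous_bijective.2
    ⟨continuous_toBoundary d, injective_toBoundary d, surjective_toBoundary d⟩

/-! ### The coding map -/

/-- The image of the infinite word `ω` under the Cannon–Thurston map, as a point of the disc. -/
def discCoding {d : ℕ} (hd : 2 ≤ d) (ω : ShiftSpace d) : ClosedDisc :=
  orbitExtension hd (ofBoundary (toBoundary ω))

lemma continuous_discCoding {d : ℕ} (hd : 2 ≤ d) : Continuous (discCoding hd) :=
  (continuous_orbitExtension hd).comp
    ((isEmbedding_ofBoundary d).continuous.comp (continuous_toBoundary d))

lemma tendsto_discCoding {d : ℕ} (hd : 2 ≤ d) (ω : ShiftSpace d) :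
    Tendsto (fun n => wordAct hd (inversePrefix ω n) origin) atTop (𝓝 (discCoding hd ω)) := by
  refine (tendsto_rayOrbit hd _).congr fun n => ?_
  change marking hd (FreeGroup.mk (inversePrefix ω n)) origin = _
  rw [marking_mk]

/-- The prefix of length n ends in the inverse of the preceding letter, which by admissibility is
not the n-th letter. -/
lemma halfDisc_subset_wordDomain {d : ℕ} (hd : 2 ≤ d) (ω : ShiftSpace d) (n : ℕ) :
    halfDisc (ω.1 n) ⊆ wordDomain (inversePrefix ω n) := by
  intro z hz b hb
  refine halfDisc_subset_coHalfDisc hd ?_ hz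
  have h := isReduced_inversePrefix ω (n + 1)
  rw [inversePrefix_succ] at h
  rw [Ne, ← Letter.neg_injective.eq_iff]
  exact getLast?_append_cons h hb

/-- The nested images of half discs along an infinite word shrink to a point. -/
lemma tendsto_wordAct {d : ℕ} (hd : 2 ≤ d) (ω : ShiftSpace d) {z : ℕ → ClosedDisc}
    (hz : ∀ n, z n ∈ halfDisc (ω.1 n)) :
    Tendsto (fun n => wordAct hd (inversePrefix ω n) (z n)) atTop (𝓝 (discCoding hd ω)) := by
  refine tendsto_of_tendsto_of_dist (tendsto_discCoding hd ω) ?_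
  rw [Metric.tendsto_atTop]
  intro ε hε
  obtain ⟨N, hN⟩ := exists_length_dist_wordAct_lt hd hε
  refine ⟨N, fun n hn => ?_⟩
  rw [Real.dist_0_eq_abs, abs_of_nonneg dist_nonneg]
  exact hN _ (isReduced_inversePrefix ω n) (by rwa [length_inversePrefix]) _
    (origin_mem_wordDomain hd _) _ (halfDisc_subset_wordDomain hd ω n (hz n))

lemma arcStart_mem_arc {d : ℕ} (hd : 2 ≤ d) (a : Letter d) : arcStart a ∈ arc a :=
  (mem_arc_iff_exists hd a _).2 ⟨midAngle a - halfAngle d,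
    by rw [sub_sub_cancel_left, abs_neg, abs_of_pos (halfAngle_pos hd)], midAngle_sub_halfAngle a⟩

lemma arcEnd_mem_arc {d : ℕ} (hd : 2 ≤ d) (a : Letter d) : arcEnd a ∈ arc a :=
  (mem_arc_iff_exists hd a _).2 ⟨midAngle a + halfAngle d,
    by rw [add_sub_cancel_left, abs_of_pos (halfAngle_pos hd)], midAngle_add_halfAngle a⟩

lemma circleToDisc_mem_halfDisc {d : ℕ} (hd : 2 ≤ d) {a : Letter d} {x : Circle} :
    circleToDisc x ∈ halfDisc a ↔ x ∈ arc a := (mem_arc_iff hd a x).symm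

/-- Uniform contraction allows the origin to be replaced by points of the arcs without changing the
limit, and words preserve the unit circle. -/
lemma norm_discCoding {d : ℕ} (hd : 2 ≤ d) (ω : ShiftSpace d) : ‖(discCoding hd ω : ℂ)‖ = 1 := by
  have h := tendsto_wordAct hd ω (z := fun n => circleToDisc (arcStart (ω.1 n)))
    fun n => (circleToDisc_mem_halfDisc hd).2 (arcStart_mem_arc hd _)
  have h2 := ((continuous_norm.comp continuous_subtype_val).tendsto _).comp h
  refine tendsto_nhds_unique h2 (tendsto_const_nhds.congr fun n => ?_)
  exact (norm_wordAct hd _ (Circle.norm_coe _)).symm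

/-- The image of the infinite word `ω` under the Cannon–Thurston map. -/
def coding {d : ℕ} (hd : 2 ≤ d) (ω : ShiftSpace d) : Circle :=
  ⟨discCoding hd ω, mem_sphere_zero_iff_norm.2 (norm_discCoding hd ω)⟩

lemma circleToDisc_coding {d : ℕ} (hd : 2 ≤ d) (ω : ShiftSpace d) :
    circleToDisc (coding hd ω) = discCoding hd ω := rfl

lemma circleToDisc_injective : Function.Injective circleToDisc := fun _ _ h =>
  Circle.ext (congrArg (fun z : ClosedDisc => (z : ℂ)) h)

lemma continuous_circleToDisc : Continuous circleToDisc :=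
  Continuous.subtype_mk (continuous_subtype_val (p := (· ∈ Submonoid.unitSphere ℂ))) _

lemma continuous_coding {d : ℕ} (hd : 2 ≤ d) : Continuous (coding hd) :=
  Continuous.subtype_mk (continuous_subtype_val.comp (continuous_discCoding hd)) _

lemma discCoding_eq_piece {d : ℕ} (hd : 2 ≤ d) (ω : ShiftSpace d) :
    discCoding hd ω = piece hd (ω.1 0).neg (discCoding hd (shift ω)) := by
  have h1 := (tendsto_discCoding hd ω).comp (tendsto_add_atTop_nat 1)
  have h2 := ((continuous_piece hd (ω.1 0).neg).tendsto _).comp (tendsto_discCoding hd (shift ω))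
  refine tendsto_nhds_unique h1 (h2.congr fun n => ?_)
  simp only [Function.comp, inversePrefix_succ', wordAct_cons]

lemma coding_mem_arc {d : ℕ} (hd : 2 ≤ d) (ω : ShiftSpace d) : coding hd ω ∈ arc (ω.1 0) := by
  rw [← circleToDisc_mem_halfDisc hd, circleToDisc_coding]
  refine (isClosed_halfDisc _).mem_of_tendsto
    ((tendsto_discCoding hd ω).comp (tendsto_add_atTop_nat 1)) (Eventually.of_forall fun n => ?_)
  simp only [Function.comp]
  have h := isReduced_inversePrefix ω (n + 1)
  rw [inversePrefix_succ'] at h ⊢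
  have := wordAct_mem_halfDisc hd h (origin_mem_wordDomain hd _)
  rwa [Letter.neg_neg] at this

lemma circleToDisc_bowenSeries {d : ℕ} (hd : 2 ≤ d) {a : Letter d} {x : Circle} (hx : x ∈ arc a) :
    circleToDisc (bowenSeries hd x) = piece hd a (circleToDisc x) :=
  Subtype.ext (bowenSeries_eq_piece hd a x hx)

lemma bowenSeries_coding {d : ℕ} (hd : 2 ≤ d) (ω : ShiftSpace d) :
    bowenSeries hd (coding hd ω) = coding hd (shift ω) := by
  apply circleToDisc_injective
  rw [circleToDisc_bowenSeries hd (coding_mem_arc hd ω), circleToDisc_coding, circleToDisc_coding,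
    discCoding_eq_piece, piece_piece_neg]

/-- A point of the circle is determined by an admissible itinerary. -/
lemma eq_coding_of_forall_mem_arc {d : ℕ} (hd : 2 ≤ d) (ω : ShiftSpace d) {x : Circle}
    (hx : ∀ n, (bowenSeries hd)^[n] x ∈ arc (ω.1 n)) : x = coding hd ω := by
  apply circleToDisc_injective
  have h := tendsto_wordAct hd ω (z := fun n => circleToDisc ((bowenSeries hd)^[n] x))
    fun n => (circleToDisc_mem_halfDisc hd).2 (hx n)
  -- The sequence is constant: the prefix of length n undoes n steps of the Bowen–Series map along
  -- the given arcs.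
  refine tendsto_nhds_unique (tendsto_const_nhds.congr fun n => ?_) h
  induction n with
  | zero => simp [inversePrefix]
  | succ n ih =>
    rw [ih, inversePrefix_succ, wordAct_append, Function.iterate_succ_apply', wordAct_cons,
      wordAct_nil, circleToDisc_bowenSeries hd (hx n), piece_neg_piece]

/-- Vertices are dense in the compactification, so the orbit map has at most one continuous
extension, and `orbitExtension` is one. -/
theorem isCannonThurston_iff {d : ℕ} (hd : 2 ≤ d) (ψ : Boundary d → Circle) :
    IsCannonThurston hd ψ ↔ ψ ∘ toBoundary = coding hd := by
  constructor
  · rintro ⟨Φ, hΦ, h1, h2⟩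
    have hE : Φ = orbitExtension hd := (denseRange_ofVertex d).equalizer hΦ
      (continuous_orbitExtension hd)
      (funext fun g => (h1 g).trans (orbitExtension_ofVertex hd g).symm)
    funext ω
    apply circleToDisc_injective
    rw [Function.comp, ← h2, hE, circleToDisc_coding, discCoding]
  · intro h
    refine ⟨orbitExtension hd, continuous_orbitExtension hd, orbitExtension_ofVertex hd,
      fun ξ => ?_⟩
    obtain ⟨ω, rfl⟩ := surjective_toBoundary d ξ
    have := congrFun h ω
    rw [Function.comp] at this
    rw [this, circleToDisc_coding, discCoding]

theorem existsUnique_isCannonThurston {d : ℕ} (hd : 2 ≤ d) :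
    ∃! ψ : Boundary d → Circle, IsCannonThurston hd ψ := by
  let e := (isHomeomorph_toBoundary d).homeomorph
  refine ⟨coding hd ∘ e.symm, ?_, fun ψ hψ => ?_⟩
  · refine (isCannonThurston_iff hd _).2 ?_
    funext ω
    exact congrArg (coding hd) (e.symm_apply_apply ω)
  · rw [← (isCannonThurston_iff hd ψ).1 hψ]
    funext ξ
    exact congrArg ψ (e.apply_symm_apply ξ).symm

/-! ## The symbolic coding of the Bowen–Series map -/

lemma isEmbedding_circleToDisc : IsEmbedding circleToDisc :=
  (continuous_circleToDisc.isClosedEmbedding circleToDisc_injective).isEmbedding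

lemma isClosed_arc {d : ℕ} (hd : 2 ≤ d) (a : Letter d) : IsClosed (arc a) := by
  have : arc a = circleToDisc ⁻¹' halfDisc a :=
    Set.ext fun x => (circleToDisc_mem_halfDisc hd).symm
  rw [this]
  exact (isClosed_halfDisc a).preimage continuous_circleToDisc

/-- Pasting over the finite closed cover by arcs; `bowenSeries_eq_piece` contains the agreement of
the pieces at common end points. -/
lemma continuous_bowenSeries {d : ℕ} (hd : 2 ≤ d) : Continuous (bowenSeries hd) := by
  refine (locallyFinite_of_finite (arc (d := d))).continuous ?_ (isClosed_arc hd) fun a => ?_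
  · refine Set.eq_univ_of_forall fun x => mem_iUnion.2 ?_
    obtain ⟨a, ha, -⟩ := exists_mem_arc_ne_arcEnd hd x
    exact ⟨a, ha⟩
  · rw [isEmbedding_circleToDisc.continuousOn_iff]
    refine ((continuous_piece hd a).comp continuous_circleToDisc).continuousOn.congr fun x hx => ?_
    exact circleToDisc_bowenSeries hd hx

/-- The label of the arc containing `x`, the one starting at `x` if there are two of them. -/
def ccwLabel {d : ℕ} (hd : 2 ≤ d) (x : Circle) : Letter d :=
  (exists_mem_arc_ne_arcEnd hd x).choose

lemma mem_arc_ccwLabel {d : ℕ} (hd : 2 ≤ d) (x : Circle) : x ∈ arc (ccwLabel hd x) :=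
  (exists_mem_arc_ne_arcEnd hd x).choose_spec.1

lemma ne_arcEnd_ccwLabel {d : ℕ} (hd : 2 ≤ d) (x : Circle) : x ≠ arcEnd (ccwLabel hd x) :=
  (exists_mem_arc_ne_arcEnd hd x).choose_spec.2

lemma ccwLabel_eq_iff {d : ℕ} (hd : 2 ≤ d) (x : Circle) (a : Letter d) :
    ccwLabel hd x = a ↔ x ∈ arc a ∧ x ≠ arcEnd a := by
  constructor
  · rintro rfl
    exact ⟨mem_arc_ccwLabel hd x, ne_arcEnd_ccwLabel hd x⟩
  · exact fun h =>
      eq_of_mem_arc_ne_arcEnd hd (mem_arc_ccwLabel hd x) (ne_arcEnd_ccwLabel hd x) h.1 h.2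

lemma measurable_ccwLabel {d : ℕ} (hd : 2 ≤ d) : Measurable (ccwLabel hd) := by
  refine measurable_to_countable' fun a => ?_
  have : ccwLabel hd ⁻¹' {a} = arc a \ {arcEnd a} := Set.ext fun x => ccwLabel_eq_iff hd x a
  rw [this]
  exact (isClosed_arc hd a).measurableSet.diff (measurableSet_singleton _)

lemma coe_piece_of_dist_eq {d : ℕ} (hd : 2 ≤ d) {a : Letter d} {z : ClosedDisc}
    (hz : dist (z : ℂ) (center a) = geodesicRadius d) :
    (piece hd a z : ℂ) = starRingEnd ℂ z := by
  rw [coe_piece, EuclideanGeometry.inversion_of_mem_sphere hz]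

lemma bowenSeries_of_dist_eq {d : ℕ} (hd : 2 ≤ d) {a : Letter d} {x : Circle}
    (hx : dist (x : ℂ) (center a) = geodesicRadius d) : bowenSeries hd x = x⁻¹ := by
  refine Circle.ext ?_
  rw [Circle.coe_inv_eq_conj, bowenSeries_eq_piece hd a x ((mem_arc_iff hd a x).2 hx.le)]
  exact coe_piece_of_dist_eq hd hx

/-- A half disc is turned inside out, so only its bounding circle can land in the opposite half
disc. -/
lemma dist_center_eq_of_piece_mem {d : ℕ} (hd : 2 ≤ d) {a : Letter d} {z : ClosedDisc}
    (hz : z ∈ halfDisc a) (h : piece hd a z ∈ halfDisc a.neg) :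
    dist (z : ℂ) (center a) = geodesicRadius d := by
  have hR := geodesicRadius_pos hd
  have h0 : 0 < dist (z : ℂ) (center a) := dist_pos.2 (coe_ne_center hd a z)
  have h1 : dist (piece hd a z : ℂ) (center a.neg) = geodesicRadius d :=
    le_antisymm h (piece_mem_coHalfDisc hd hz)
  rw [dist_piece_center, div_eq_iff h0.ne', sq] at h1
  exact (mul_left_cancel₀ hR.ne' h1).symm

/-- A point of the arc of a can be mapped into the arc of -a only if it is the initial point of its
arc. It is then conjugated to the final point of the arc of -a, which the half-open convention
excludes. So itineraries are admissible at the vertices too. -/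
lemma ccwLabel_bowenSeries_ne {d : ℕ} (hd : 2 ≤ d) (x : Circle) :
    ccwLabel hd (bowenSeries hd x) ≠ (ccwLabel hd x).neg := by
  set a := ccwLabel hd x with ha
  intro h
  rw [ccwLabel_eq_iff, arcEnd_neg hd] at h
  have hx : x ∈ arc a := mem_arc_ccwLabel hd x
  have h1 := (circleToDisc_mem_halfDisc hd).2 h.1
  rw [circleToDisc_bowenSeries hd hx] at h1
  have h2 : dist (x : ℂ) (center a) = geodesicRadius d :=
    dist_center_eq_of_piece_mem hd ((circleToDisc_mem_halfDisc hd).2 hx) h1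
  have h3 := (eq_arcStart_or_arcEnd hd a h2).resolve_right (ne_arcEnd_ccwLabel hd x)
  exact h.2 (by rw [bowenSeries_of_dist_eq hd h2, ← h3])

/-- The itinerary of a point of the circle with respect to the half-open arcs. -/
def ccwItinerary {d : ℕ} (hd : 2 ≤ d) (x : Circle) : ShiftSpace d :=
  ShiftSpace.mk' (fun n => ccwLabel hd ((bowenSeries hd)^[n] x)) fun n => by
    rw [Function.iterate_succ_apply']
    exact ccwLabel_bowenSeries_ne hd _

lemma ccwItinerary_apply {d : ℕ} (hd : 2 ≤ d) (x : Circle) (n : ℕ) :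
    (ccwItinerary hd x).1 n = ccwLabel hd ((bowenSeries hd)^[n] x) := rfl

/-- Gives a measurable section of `coding` which, by `shift_ccwItinerary`, commutes with the
dynamics. Invariant measures on the circle are lifted with it. -/
lemma coding_ccwItinerary {d : ℕ} (hd : 2 ≤ d) (x : Circle) :
    coding hd (ccwItinerary hd x) = x := by
  refine (eq_coding_of_forall_mem_arc hd (ccwItinerary hd x) fun n => ?_).symm
  rw [ccwItinerary_apply]
  exact mem_arc_ccwLabel hd _

lemma shift_ccwItinerary {d : ℕ} (hd : 2 ≤ d) (x : Circle) :
    shift (ccwItinerary hd x) = ccwItinerary hd (bowenSeries hd x) :=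
  Subtype.ext (funext fun n => by
    simp only [shift, ccwItinerary_apply, Function.iterate_succ_apply])

/-- The Borel σ-algebra of a countable product of finite discrete spaces is the product σ-algebra,
so the coordinates generate that of the subshift. -/
lemma measurable_shiftSpace {d : ℕ} {X : Type*} [MeasurableSpace X] {f : X → ShiftSpace d}
    (hf : ∀ n, Measurable fun x => (f x).1 n) : Measurable f := by
  have h : borel (ShiftSpace d) = MeasurableSpace.comap Subtype.val MeasurableSpace.pi := by
    rw [(inferInstance : BorelSpace (ℕ → Letter d)).measurable_eq]
    exact borel_comap
  intro s hs
  change MeasurableSet[borel (ShiftSpace d)] s at hs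
  rw [h] at hs
  obtain ⟨t, ht, rfl⟩ := hs
  exact measurable_pi_iff.2 hf ht

lemma measurable_coord {d : ℕ} (n : ℕ) : Measurable fun ω : ShiftSpace d => ω.1 n :=
  (continuous_coord n).measurable

lemma continuous_shift {d : ℕ} : Continuous (shift (d := d)) :=
  Continuous.subtype_mk (continuous_pi fun k => continuous_coord (k + 1)) _

lemma measurable_ccwItinerary {d : ℕ} (hd : 2 ≤ d) : Measurable (ccwItinerary hd) :=
  measurable_shiftSpace fun n =>
    (measurable_ccwLabel hd).comp ((continuous_bowenSeries hd).measurable.iterate n)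

lemma shift_iterate_apply {d : ℕ} (ω : ShiftSpace d) (n k : ℕ) :
    (shift^[n] ω).1 k = ω.1 (k + n) := by
  induction n generalizing k with
  | zero => rfl
  | succ n ih =>
    rw [Function.iterate_succ_apply', shift]
    simp only [ih]
    rw [add_right_comm, add_assoc]

lemma semiconj_coding {d : ℕ} (hd : 2 ≤ d) :
    Function.Semiconj (coding hd) shift (bowenSeries hd) := fun ω => (bowenSeries_coding hd ω).symm

/-- The half-open itinerary supplies a preimage for all points of the arc except the final one,
which is reached because the image is compact. -/
lemma coding_image_cylinder {d : ℕ} (hd : 2 ≤ d) (a : Letter d) :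
    coding hd '' {ω | ω.1 0 = a} = arc a := by
  apply Subset.antisymm
  · rintro _ ⟨ω, rfl, rfl⟩
    exact coding_mem_arc hd ω
  · have hcl : IsClosed {ω : ShiftSpace d | ω.1 0 = a} :=
      (isClosed_discrete {a}).preimage (continuous_coord 0)
    have hcl' : IsClosed (coding hd '' {ω | ω.1 0 = a}) :=
      (hcl.isCompact.image (continuous_coding hd)).isClosed
    have hsub : ∀ x ∈ arc a, x ≠ arcEnd a → x ∈ coding hd '' {ω | ω.1 0 = a} := fun x hx hx' =>
      ⟨ccwItinerary hd x, (ccwLabel_eq_iff hd x a).2 ⟨hx, hx'⟩, coding_ccwItinerary hd x⟩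
    have h0 := halfAngle_pos hd
    have hend : arcEnd a ∈ coding hd '' {ω | ω.1 0 = a} := by
      have ht : Tendsto (fun t : ℝ => Circle.exp t) (𝓝[<] (midAngle a + halfAngle d))
          (𝓝 (arcEnd a)) := by
        rw [← midAngle_add_halfAngle]
        exact (Circle.exp.continuous.tendsto _).mono_left nhdsWithin_le_nhds
      refine hcl'.mem_of_tendsto ht ?_
      have hmem : Ioo (midAngle a) (midAngle a + halfAngle d) ∈ 𝓝[<] (midAngle a + halfAngle d) :=
        Ioo_mem_nhdsLT (by linarith)
      filter_upwards [hmem] with t ht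
      refine hsub _ ((mem_arc_iff_exists hd a _).2 ⟨t, ?_, rfl⟩) ?_
      · rw [abs_le]; constructor <;> linarith [ht.1, ht.2]
      · rw [← midAngle_add_halfAngle, Ne, Circle.exp_eq_exp]
        rintro ⟨m, hm⟩
        have h1 : (0 : ℝ) < -m := by nlinarith [Real.pi_pos, ht.2]
        have h2 : (-m : ℝ) < 1 := by
          by_contra hge; push Not at hge
          nlinarith [Real.pi_pos, halfAngle_le hd, ht.1]
        have h3 : 0 < -m := by exact_mod_cast h1
        have h4 : -m < 1 := by exact_mod_cast h2
        omega
    intro x hx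
    by_cases h : x = arcEnd a
    · rw [h]; exact hend
    · exact hsub x hx h

/-- Semiconjugacy and the images of the rank one cylinders put the n-th iterate of ψ ω in the arc of
the n-th letter, and this itinerary determines the point. -/
theorem isSymbolicCoding_iff {d : ℕ} (hd : 2 ≤ d) (ψ : ShiftSpace d → Circle) :
    IsSymbolicCoding hd ψ ↔ ψ = coding hd := by
  constructor
  · intro h
    funext ω
    refine eq_coding_of_forall_mem_arc hd ω fun n => ?_
    rw [← h.semiconj.iterate_right n ω, ← h.image_cylinder]
    exact ⟨_, by simp [shift_iterate_apply], rfl⟩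
  · rintro rfl
    exact ⟨continuous_coding hd, fun x => ⟨_, coding_ccwItinerary hd x⟩, semiconj_coding hd,
      coding_image_cylinder hd⟩

/-! ## The Parry measure -/

lemma isOpen_cylinder {d : ℕ} (ω : ShiftSpace d) (n : ℕ) : IsOpen (cylinder ω n) := by
  have : cylinder ω n = ⋂ k ∈ Finset.range n, {η : ShiftSpace d | η.1 k = ω.1 k} := by
    ext η; simp [cylinder]
  rw [this]
  exact isOpen_biInter_finset fun k _ => (isOpen_discrete {ω.1 k}).preimage (continuous_coord k)

lemma measurableSet_cylinder {d : ℕ} (ω : ShiftSpace d) (n : ℕ) : MeasurableSet (cylinder ω n) :=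
  (isOpen_cylinder ω n).measurableSet

lemma mem_cylinder_self {d : ℕ} (ω : ShiftSpace d) (n : ℕ) : ω ∈ cylinder ω n := fun _ _ => rfl

lemma cylinder_eq_of_mem {d : ℕ} {ω η : ShiftSpace d} {n : ℕ} (h : η ∈ cylinder ω n) :
    cylinder η n = cylinder ω n := by
  ext ζ
  exact ⟨fun hζ k hk => (hζ k hk).trans (h k hk), fun hζ k hk => (hζ k hk).trans (h k hk).symm⟩

lemma cylinder_zero {d : ℕ} (ω : ShiftSpace d) : cylinder ω 0 = univ := by
  simp [cylinder]

lemma generateFrom_cylinder (d : ℕ) :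
    borel (ShiftSpace d) = MeasurableSpace.generateFrom {s | ∃ ω n, s = cylinder (d := d) ω n} := by
  apply le_antisymm
  · have hmeas : @Measurable (ShiftSpace d) (ShiftSpace d)
        (MeasurableSpace.generateFrom {s | ∃ ω n, s = cylinder (d := d) ω n}) _ id := by
      refine @measurable_shiftSpace d (ShiftSpace d)
        (MeasurableSpace.generateFrom {s | ∃ ω n, s = cylinder (d := d) ω n}) id fun n => ?_
      refine @measurable_to_countable' _ _ _ _
        (MeasurableSpace.generateFrom {s | ∃ ω n, s = cylinder (d := d) ω n}) _ fun a => ?_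
      -- Fixing the n-th letter gives the finite union, over the words of length n + 1 ending in it,
      -- of the corresponding sets of admissible sequences. Each of these is empty or a cylinder.
      have : (fun ω : ShiftSpace d => (id ω : ShiftSpace d).1 n) ⁻¹' {a}
          = ⋃ w ∈ {w : Fin (n + 1) → Letter d | w (Fin.last n) = a},
            {ω : ShiftSpace d | ∀ k, ω.1 k.1 = w k} := by
        ext ω
        simp only [id, mem_preimage, mem_singleton_iff, mem_iUnion, exists_prop, mem_ofPred_eq]
        exact ⟨fun h => ⟨fun k => ω.1 k, h, fun _ => rfl⟩, fun ⟨w, h1, h2⟩ => (h2 _).trans h1⟩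
      rw [this]
      refine @MeasurableSet.biUnion _ _
        (MeasurableSpace.generateFrom {s | ∃ ω n, s = cylinder (d := d) ω n}) _ _
        (to_countable _) fun w _ => ?_
      rcases Set.eq_empty_or_nonempty {ω : ShiftSpace d | ∀ k, ω.1 k.1 = w k} with h | ⟨ω, hω⟩
      · rw [h]; exact @MeasurableSet.empty _
          (MeasurableSpace.generateFrom {s | ∃ ω n, s = cylinder (d := d) ω n})
      · refine MeasurableSpace.measurableSet_generateFrom ⟨ω, n + 1, ?_⟩
        ext η
        constructor
        · exact fun hη k hk => (hη ⟨k, hk⟩).trans (hω ⟨k, hk⟩).symm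
        · exact fun hη k => (hη k k.2).trans (hω k)
    exact fun s hs => hmeas hs
  · refine MeasurableSpace.generateFrom_le ?_
    rintro _ ⟨ω, n, rfl⟩
    exact measurableSet_cylinder ω n

/-- Probability measures on the shift space are determined by their values on cylinders. -/
lemma ext_of_cylinder {d : ℕ} {m m' : Measure (ShiftSpace d)} [IsProbabilityMeasure m]
    [IsProbabilityMeasure m'] (h : ∀ ω n, m (cylinder ω (n + 1)) = m' (cylinder ω (n + 1))) :
    m = m' := by
  refine ext_of_generate_finite _ (generateFrom_cylinder d) ?_ ?_ (by simp)
  · rintro _ ⟨ω, n, rfl⟩ _ ⟨η, k, rfl⟩ ⟨ζ, h1, h2⟩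
    refine ⟨ζ, max n k, ?_⟩
    rw [← cylinder_eq_of_mem h1, ← cylinder_eq_of_mem h2]
    ext ξ
    simp only [cylinder, mem_inter_iff, mem_ofPred_eq, lt_max_iff]
    exact ⟨fun ⟨h1, h2⟩ i hi => hi.elim (h1 i) (h2 i),
      fun h => ⟨fun i hi => h i (Or.inl hi), fun i hi => h i (Or.inr hi)⟩⟩
  · rintro _ ⟨ω, n, rfl⟩
    cases n with
    | zero => simp [cylinder_zero]
    | succ n => exact h ω n

lemma IsParryMeasure.unique {d : ℕ} {P Q : Measure (ShiftSpace d)} (hP : IsParryMeasure P)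
    (hQ : IsParryMeasure Q) : P = Q := by
  have := hP.isProbabilityMeasure
  have := hQ.isProbabilityMeasure
  exact ext_of_cylinder fun ω n => (hP.measure_cylinder ω n).trans (hQ.measure_cylinder ω n).symm

/-! ### Existence of the Parry measure, its invariance and absence of atoms -/

lemma card_letter (d : ℕ) : Fintype.card (Letter d) = 2 * d := by
  simp [mul_comm]

lemma card_filter_ne {d : ℕ} (a : Letter d) :
    (Finset.univ.filter fun b : Letter d => b ≠ a).card = 2 * d - 1 := by
  rw [Finset.filter_ne', Finset.card_erase_of_mem (Finset.mem_univ a), Finset.card_univ,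
    card_letter]

/-- An enumeration of the letters that may follow `a`. -/
def successor {d : ℕ} (a : Letter d) : Fin (2 * d - 1) ≃ {b : Letter d // b ≠ a.neg} :=
  Fintype.equivOfCardEq (by
    rw [Fintype.card_fin, Fintype.card_subtype, card_filter_ne])

/-- The admissible word with a given first letter and given numbers of the successors. -/
def wordOfSuccessors {d : ℕ} (a : Letter d) (x : ℕ → Fin (2 * d - 1)) : ℕ → Letter d
  | 0 => a
  | k + 1 => (successor (wordOfSuccessors a x k) (x k)).1

/-- Parametrization of the shift space by independent choices. -/
def ofSuccessors {d : ℕ} (p : Letter d × (ℕ → Fin (2 * d - 1))) : ShiftSpace d :=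
  ShiftSpace.mk' (wordOfSuccessors p.1 p.2) fun k => by
    rw [wordOfSuccessors]
    exact (successor (wordOfSuccessors p.1 p.2 k) (p.2 k)).2

lemma measurable_ofSuccessors (d : ℕ) : Measurable (ofSuccessors (d := d)) := by
  refine measurable_shiftSpace fun n => ?_
  change Measurable fun p : Letter d × (ℕ → Fin (2 * d - 1)) => wordOfSuccessors p.1 p.2 n
  induction n with
  | zero => exact measurable_fst
  | succ n ih =>
    obtain ⟨F, hF⟩ : ∃ F : Letter d × Fin (2 * d - 1) → Letter d,
        ∀ a i, (successor a i).1 = F (a, i) := ⟨fun q => (successor q.1 q.2).1, fun _ _ => rfl⟩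
    have h : Measurable F := measurable_of_countable _
    simp only [wordOfSuccessors, hF]
    have hx : Measurable fun p : Letter d × (ℕ → Fin (2 * d - 1)) => p.2 n :=
      (measurable_pi_apply n).comp measurable_snd
    exact h.comp (ih.prodMk hx)

/-- In the coordinates formed by the first letter and the numbers of the successors a cylinder is a
box, so a product measure factorises on it. -/
lemma ofSuccessors_preimage_cylinder {d : ℕ} (ω : ShiftSpace d) (n : ℕ) :
    ofSuccessors ⁻¹' cylinder ω (n + 1) = {ω.1 0} ×ˢ Set.pi (Finset.range n)
      fun k => {(successor (ω.1 k)).symm ⟨ω.1 (k + 1), ω.ne_neg k⟩} := by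
  ext ⟨a, x⟩
  simp only [mem_preimage, mem_prod, mem_singleton_iff, Set.mem_pi, Finset.coe_range, mem_Iio,
    Equiv.eq_symm_apply, Subtype.ext_iff]
  change (∀ k < n + 1, wordOfSuccessors a x k = ω.1 k) ↔ _
  constructor
  · intro h
    refine ⟨h 0 (by omega), fun k hk => ?_⟩
    have := h (k + 1) (by omega)
    rwa [wordOfSuccessors, h k (by omega)] at this
  · rintro ⟨h1, h2⟩ k
    induction k with
    | zero => exact fun _ => h1
    | succ k ih =>
      intro hk
      rw [wordOfSuccessors, ih (by omega)]
      exact h2 k (by omega)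

lemma ofReal_parry {d : ℕ} (hd : 2 ≤ d) (n : ℕ) :
    ENNReal.ofReal (1 / (2 * d * (2 * d - 1) ^ n))
      = ((2 * d : ℕ) : ℝ≥0∞)⁻¹ * (((2 * d - 1 : ℕ) : ℝ≥0∞)⁻¹) ^ n := by
  have h2 : (2 : ℝ) ≤ d := by exact_mod_cast hd
  have e1 : ((2 * d - 1 : ℕ) : ℝ) = 2 * d - 1 := by
    rw [Nat.cast_sub (by omega)]; push_cast; ring
  rw [← ENNReal.ofReal_natCast, ← ENNReal.ofReal_natCast, ← ENNReal.ofReal_inv_of_pos,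
    ← ENNReal.ofReal_inv_of_pos, ← ENNReal.ofReal_pow, ← ENNReal.ofReal_mul, e1]
  · congr 1
    push_cast
    rw [one_div, mul_inv, inv_pow]
  · positivity
  · rw [e1]; exact inv_nonneg.2 (by linarith)
  · rw [e1]; linarith
  · push_cast; linarith

/-- The first letter is drawn uniformly among 2d letters and each successor independently and
uniformly among the 2d - 1 admissible ones; a cylinder of rank n + 1 fixes the first draw and n
later ones. -/
theorem exists_isParryMeasure {d : ℕ} (hd : 2 ≤ d) :
    ∃ P : Measure (ShiftSpace d), IsParryMeasure P := by
  have : Nonempty (Letter d) := ⟨(⟨0, by omega⟩, true)⟩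
  have : Nonempty (Fin (2 * d - 1)) := ⟨⟨0, by omega⟩⟩
  let U : Measure (Letter d) := (PMF.uniformOfFintype (Letter d)).toMeasure
  let V : Measure (Fin (2 * d - 1)) := (PMF.uniformOfFintype (Fin (2 * d - 1))).toMeasure
  let W : Measure (Letter d × (ℕ → Fin (2 * d - 1))) := U.prod (Measure.infinitePi fun _ => V)
  refine ⟨W.map ofSuccessors,
    Measure.isProbabilityMeasure_map (measurable_ofSuccessors d).aemeasurable, fun ω n => ?_⟩
  rw [Measure.map_apply (measurable_ofSuccessors d) (measurableSet_cylinder ω _),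
    ofSuccessors_preimage_cylinder, Measure.prod_prod,
    Measure.infinitePi_pi _ fun _ _ => measurableSet_singleton _, ofReal_parry hd]
  have hU : ∀ a, U {a} = ((2 * d : ℕ) : ℝ≥0∞)⁻¹ := fun a => by
    rw [PMF.toMeasure_apply_singleton _ _ (measurableSet_singleton _),
      PMF.uniformOfFintype_apply, card_letter]
  have hV : ∀ a, V {a} = ((2 * d - 1 : ℕ) : ℝ≥0∞)⁻¹ := fun a => by
    rw [PMF.toMeasure_apply_singleton _ _ (measurableSet_singleton _),
      PMF.uniformOfFintype_apply, Fintype.card_fin]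
  simp only [hU, hV, Finset.prod_const, Finset.card_range]

/-- The word `a ω`. -/
def ShiftSpace.cons {d : ℕ} (a : Letter d) (ω : ShiftSpace d) (h : ω.1 0 ≠ a.neg) :
    ShiftSpace d :=
  ShiftSpace.mk' (fun n => Nat.casesOn n a ω.1) fun k => by
    cases k with
    | zero => exact h
    | succ k => exact ω.ne_neg k

lemma ShiftSpace.shift_cons {d : ℕ} (a : Letter d) (ω : ShiftSpace d) (h : ω.1 0 ≠ a.neg) :
    shift (ω.cons a h) = ω := rfl

lemma mem_cylinder_cons {d : ℕ} {a : Letter d} {ω : ShiftSpace d} {h : ω.1 0 ≠ a.neg} {n : ℕ}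
    {η : ShiftSpace d} :
    η ∈ cylinder (ω.cons a h) (n + 1) ↔ η.1 0 = a ∧ shift η ∈ cylinder ω n := by
  constructor
  · exact fun hη => ⟨hη 0 (by omega), fun k hk => hη (k + 1) (by omega)⟩
  · rintro ⟨h1, h2⟩ k hk
    cases k with
    | zero => exact h1
    | succ k => exact h2 k (by omega)

lemma ne_neg_comm {d : ℕ} {a b : Letter d} : a ≠ b.neg ↔ b ≠ a.neg := by
  rw [Ne, Ne, ← Letter.neg_injective.eq_iff, Letter.neg_neg, eq_comm]

lemma shift_preimage_cylinder {d : ℕ} (ω : ShiftSpace d) (n : ℕ) :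
    shift ⁻¹' cylinder ω (n + 1)
      = ⋃ a : {a : Letter d // a ≠ (ω.1 0).neg},
        cylinder (ω.cons a.1 (ne_neg_comm.1 a.2)) (n + 2) := by
  ext η
  simp only [mem_preimage, mem_iUnion, mem_cylinder_cons]
  constructor
  · intro h
    refine ⟨⟨η.1 0, ?_⟩, rfl, h⟩
    have h1 : η.1 1 = ω.1 0 := h 0 (by omega)
    rw [← h1]
    exact ne_neg_comm.1 (η.ne_neg 0)
  · rintro ⟨a, -, h⟩
    exact h

/-- The preimage of a cylinder splits into 2d - 1 cylinders of the next rank, each with 1 / (2d - 1)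
of its mass. The image measure thus satisfies the Parry condition, which has only one solution. -/
lemma IsParryMeasure.measurePreserving_shift {d : ℕ} (hd : 2 ≤ d) {P : Measure (ShiftSpace d)}
    (hP : IsParryMeasure P) : MeasurePreserving shift P P := by
  have hPp := hP.isProbabilityMeasure
  refine ⟨continuous_shift.measurable, IsParryMeasure.unique ⟨?_, fun ω n => ?_⟩ hP⟩
  · exact Measure.isProbabilityMeasure_map continuous_shift.measurable.aemeasurable
  · rw [Measure.map_apply continuous_shift.measurable (measurableSet_cylinder ω _),
      shift_preimage_cylinder, measure_iUnion _ fun _ => measurableSet_cylinder _ _]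
    · simp only [hP.measure_cylinder, ofReal_parry hd]
      rw [tsum_fintype, Finset.sum_const, Finset.card_univ, Fintype.card_subtype, card_filter_ne,
        nsmul_eq_mul, pow_succ, mul_left_comm, mul_left_comm _ (_ ^ n), ENNReal.mul_inv_cancel,
        mul_one]
      · have : 2 * d - 1 ≠ 0 := by omega
        exact_mod_cast this
      · exact ENNReal.natCast_ne_top _
    · intro a b hab
      refine Set.disjoint_left.2 fun η h1 h2 => hab (Subtype.ext ?_)
      exact (mem_cylinder_cons.1 h1).1.symm.trans (mem_cylinder_cons.1 h2).1

lemma IsParryMeasure.measure_singleton {d : ℕ} (hd : 2 ≤ d) {P : Measure (ShiftSpace d)}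
    (hP : IsParryMeasure P) (ω : ShiftSpace d) : P {ω} = 0 := by
  have h2 : 1 < 2 * d - 1 := by omega
  have hlim : Tendsto (fun n => ((2 * d : ℕ) : ℝ≥0∞)⁻¹ * (((2 * d - 1 : ℕ) : ℝ≥0∞)⁻¹) ^ n) atTop
      (𝓝 (((2 * d : ℕ) : ℝ≥0∞)⁻¹ * 0)) := by
    refine ENNReal.Tendsto.const_mul (ENNReal.tendsto_pow_atTop_nhds_zero_of_lt_one ?_) (Or.inr ?_)
    · rw [ENNReal.inv_lt_one]
      exact_mod_cast h2
    · rw [ENNReal.inv_ne_top]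
      have : 2 * d ≠ 0 := by omega
      exact_mod_cast this
  rw [mul_zero] at hlim
  refine le_antisymm (ge_of_tendsto hlim (Eventually.of_forall fun n => ?_)) bot_le
  rw [← ofReal_parry hd, ← hP.measure_cylinder ω n]
  exact measure_mono (singleton_subset_iff.2 (mem_cylinder_self ω _))

/-! ## Averages over spheres -/

/-- The vertex at distance `n` from the base point on the ray coded by `ω`. -/
def rayVertex {d : ℕ} (n : ℕ) (ω : ShiftSpace d) : FreeGroup (Fin d) :=
  FreeGroup.mk (inversePrefix ω n)

lemma norm_rayVertex {d : ℕ} (n : ℕ) (ω : ShiftSpace d) : (rayVertex n ω).norm = n := by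
  rw [FreeGroup.norm, rayVertex, toWord_mk_inversePrefix, length_inversePrefix]

lemma exists_rayVertex_eq {d : ℕ} (hd : 2 ≤ d) (g : FreeGroup (Fin d)) :
    ∃ ω : ShiftSpace d, rayVertex g.norm ω = g := by
  have : Inhabited (Letter d) := ⟨(⟨0, by omega⟩, true)⟩
  set L : List (Letter d) := g.toWord with hL
  have hred : FreeGroup.IsReduced L := FreeGroup.isReduced_toWord
  -- Beyond its end the word is continued by repeating its last letter, which is admissible because
  -- no letter is its own inverse. The value `default` serves only for the empty word.
  let w : ℕ → Letter d := fun k => Letter.neg (L.getD (min k (L.length - 1)) default)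
  have hadm : ∀ k, w (k + 1) ≠ (w k).neg := by
    intro k h
    have h : L.getD (min (k + 1) (L.length - 1)) default
      = Letter.neg (L.getD (min k (L.length - 1)) default) := Letter.neg_injective h
    by_cases hk : k + 1 < L.length
    · rw [min_eq_left (by omega), min_eq_left (by omega), List.getD_eq_getElem _ _ hk,
        List.getD_eq_getElem _ _ (by omega), Letter.eq_neg_iff] at h
      rw [FreeGroup.IsReduced, List.isChain_iff_getElem] at hred
      exact h.2 (hred k hk h.1)
    · rw [min_eq_right (by omega), min_eq_right (by omega)] at h
      exact Letter.neg_ne _ h.symm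
  refine ⟨ShiftSpace.mk' w hadm, ?_⟩
  have : inversePrefix (ShiftSpace.mk' w hadm) g.norm = L := by
    refine List.ext_getElem (by rw [length_inversePrefix]; rfl) fun k h1 h2 => ?_
    simp only [inversePrefix, List.getElem_map, List.getElem_range, ShiftSpace.mk',
      w, Letter.neg_neg]
    rw [min_eq_left (by omega), List.getD_eq_getElem _ _ h2]
  rw [rayVertex, this, hL, FreeGroup.mk_toWord]

/-- The number of vertices at distance `n` from the base point. -/
def sphereCard (d : ℕ) : ℕ → ℕ
  | 0 => 1
  | n + 1 => 2 * d * (2 * d - 1) ^ n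

lemma sphereCard_pos {d : ℕ} (hd : 2 ≤ d) (n : ℕ) : 0 < sphereCard d n := by
  have : 0 < 2 * d - 1 := by omega
  cases n <;> simp only [sphereCard] <;> positivity

lemma IsParryMeasure.measure_cylinder_eq_inv {d : ℕ} (hd : 2 ≤ d) {P : Measure (ShiftSpace d)}
    (hP : IsParryMeasure P) (ω : ShiftSpace d) (n : ℕ) :
    P (cylinder ω n) = (sphereCard d n : ℝ≥0∞)⁻¹ := by
  have := hP.isProbabilityMeasure
  cases n with
  | zero => simp [cylinder_zero, sphereCard]
  | succ n =>
    rw [hP.measure_cylinder, ofReal_parry hd, sphereCard, Nat.cast_mul (2 * d), Nat.cast_pow,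
      ENNReal.mul_inv, ENNReal.inv_pow]
    · right; exact ENNReal.pow_ne_top (ENNReal.natCast_ne_top _)
    · left; exact ENNReal.natCast_ne_top _

/-- The rays through a given vertex form a cylinder, so the Parry measure induces the uniform
distribution on each sphere. -/
lemma IsParryMeasure.measure_rayVertex_eq {d : ℕ} (hd : 2 ≤ d) {P : Measure (ShiftSpace d)}
    (hP : IsParryMeasure P) (g : FreeGroup (Fin d)) :
    P {ω | rayVertex g.norm ω = g} = (sphereCard d g.norm : ℝ≥0∞)⁻¹ := by
  obtain ⟨η, hη⟩ := exists_rayVertex_eq hd g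
  rw [← hP.measure_cylinder_eq_inv hd η]
  congr 1
  ext ω
  rw [← mk_inversePrefix_eq_iff]
  exact ⟨fun h => (show rayVertex g.norm ω = g from h).trans hη.symm, fun h => h.trans hη⟩

lemma continuous_rayVertex {d : ℕ} (n : ℕ) : Continuous (rayVertex (d := d) n) :=
  continuous_mk_inversePrefix n

/-- The image of `P` on the sphere of radius `n`. -/
def sphereMeasure {d : ℕ} (P : Measure (ShiftSpace d)) (n : ℕ) : Measure (Compactification d) :=
  P.map fun ω => ofVertex (rayVertex n ω)

lemma continuous_ofVertex_rayVertex {d : ℕ} (n : ℕ) :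
    Continuous fun ω : ShiftSpace d => ofVertex (rayVertex n ω) :=
  Continuous.comp (g := ofVertex) continuous_of_discreteTopology (continuous_rayVertex n)

lemma sphereMeasure_apply {d : ℕ} (P : Measure (ShiftSpace d)) (n : ℕ)
    {S : Set (Compactification d)} (hS : MeasurableSet S) :
    sphereMeasure P n S
      = ∑' g : FreeGroup (Fin d), P {ω | rayVertex n ω = g} * Measure.dirac (ofVertex g) S := by
  rw [sphereMeasure, Measure.map_apply (continuous_ofVertex_rayVertex n).measurable hS]
  have hU : (fun ω : ShiftSpace d => ofVertex (rayVertex n ω)) ⁻¹' S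
      = ⋃ g : FreeGroup (Fin d), {ω | rayVertex n ω = g ∧ ofVertex g ∈ S} := by
    ext ω
    simp
  have hmeas : ∀ g : FreeGroup (Fin d), MeasurableSet {ω | rayVertex n ω = g} := fun g =>
    ((isOpen_discrete {g}).preimage (continuous_rayVertex n)).measurableSet
  rw [hU, measure_iUnion]
  · refine tsum_congr fun g => ?_
    rw [Measure.dirac_apply' _ hS]
    by_cases h : ofVertex g ∈ S <;> simp [h]
  · intro g h hgh
    refine Set.disjoint_left.2 fun ω h1 h2 => hgh ?_
    exact h1.1.symm.trans h2.1
  · intro g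
    by_cases h : ofVertex g ∈ S <;> simp [h, hmeas g]

/-- Grouping the vertices by norm, each sphere contributes its total weight times its uniform
distribution. All radial orbit measures thus become mixtures of images of the single measure P. -/
lemma sum_dirac_eq_sum_sphereMeasure {d : ℕ} (hd : 2 ≤ d) {P : Measure (ShiftSpace d)}
    (hP : IsParryMeasure P) (c : ℕ → ℝ≥0∞) :
    Measure.sum (fun g : FreeGroup (Fin d) => c g.norm • Measure.dirac (ofVertex g))
      = Measure.sum fun n => (c n * sphereCard d n) • sphereMeasure P n := by
  ext S hS
  rw [Measure.sum_apply _ hS, Measure.sum_apply _ hS]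
  simp only [Measure.smul_apply, smul_eq_mul, sphereMeasure_apply P _ hS, ← ENNReal.tsum_mul_left]
  rw [ENNReal.tsum_comm]
  refine tsum_congr fun g => ?_
  rw [tsum_eq_single g.norm]
  · have h0 : (sphereCard d g.norm : ℝ≥0∞) ≠ 0 := by
      exact_mod_cast (sphereCard_pos hd _).ne'
    rw [hP.measure_rayVertex_eq hd, ← mul_assoc, mul_assoc (c _),
      ENNReal.mul_inv_cancel h0 (ENNReal.natCast_ne_top _), mul_one]
  · intro n hn
    have : {ω : ShiftSpace d | rayVertex n ω = g} = ∅ := by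
      ext ω
      simp only [mem_ofPred_eq, mem_empty_iff_false, iff_false]
      rintro rfl
      exact hn (norm_rayVertex n ω).symm
    simp [this]

/-- Dominated convergence, since the n-th vertex on a ray tends to its end point. -/
lemma tendsto_integral_sphereMeasure {d : ℕ} {P : Measure (ShiftSpace d)}
    [IsProbabilityMeasure P] (f : Compactification d →ᵇ ℝ) :
    Tendsto (fun n => ∫ x, f x ∂sphereMeasure P n) atTop
      (𝓝 (∫ x, f x ∂((P.map toBoundary).map ofBoundary))) := by
  have h1 : ∀ n, ∫ x, f x ∂sphereMeasure P n = ∫ ω, f (ofVertex (rayVertex n ω)) ∂P := fun n =>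
    integral_map (continuous_ofVertex_rayVertex n).measurable.aemeasurable
      f.continuous.aestronglyMeasurable
  have h2 : ∫ x, f x ∂((P.map toBoundary).map ofBoundary)
      = ∫ ω, f (ofBoundary (toBoundary ω)) ∂P := by
    rw [Measure.map_map (isEmbedding_ofBoundary d).continuous.measurable
      (continuous_toBoundary d).measurable]
    exact integral_map ((isEmbedding_ofBoundary d).continuous.comp
      (continuous_toBoundary d)).measurable.aemeasurable f.continuous.aestronglyMeasurable
  simp only [h1, h2]
  refine tendsto_integral_of_dominated_convergence (fun _ => ‖f‖) (fun n => ?_)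
    (integrable_const _) (fun n => ae_of_all _ fun ω => f.norm_coe_le_norm _)
    (ae_of_all _ fun ω => ?_)
  · exact (f.continuous.comp (continuous_ofVertex_rayVertex n)).aestronglyMeasurable
  · exact (f.continuous.tendsto _).comp (tendsto_ofVertex (ofBoundary (toBoundary ω)))

/-- Toeplitz averaging: averages with weights that become small at each index. -/
lemma tendsto_weighted_average {a : ℕ → ℝ} {l : ℝ} (ha : Tendsto a atTop (𝓝 l)) {u : ℕ → ℕ → ℝ}
    (h0 : ∀ k n, 0 ≤ u k n) (hs : ∀ k, Summable (u k)) (hZ : ∀ k, 0 < ∑' n, u k n)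
    (hu : ∀ n, Tendsto (fun k => u k n / ∑' i, u k i) atTop (𝓝 0)) :
    Tendsto (fun k => (∑' n, u k n)⁻¹ * ∑' n, u k n * a n) atTop (𝓝 l) := by
  obtain ⟨M, hM⟩ : ∃ M, ∀ n, |a n - l| ≤ M := by
    have hb := (ha.sub_const l).abs.bddAbove_range
    obtain ⟨M, hM⟩ := hb
    exact ⟨M, fun n => hM ⟨n, rfl⟩⟩
  have hsum : ∀ k, Summable fun n => u k n * |a n - l| := fun k =>
    Summable.of_nonneg_of_le (fun n => mul_nonneg (h0 k n) (abs_nonneg _))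
      (fun n => mul_le_mul_of_nonneg_left (hM n) (h0 k n)) ((hs k).mul_right M)
  have hsum' : ∀ k, Summable fun n => u k n * (a n - l) := fun k =>
    Summable.of_norm ((hsum k).congr fun n => by
      rw [norm_mul, Real.norm_eq_abs, Real.norm_eq_abs, abs_of_nonneg (h0 k n)])
  have hdiff : ∀ k, (∑' n, u k n)⁻¹ * ∑' n, u k n * a n - l
      = (∑' n, u k n)⁻¹ * ∑' n, u k n * (a n - l) := by
    intro k
    have e : ∀ n, u k n * a n = u k n * (a n - l) + u k n * l := fun n => by ring
    simp only [e]
    rw [(hsum' k).tsum_add ((hs k).mul_right l), tsum_mul_right]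
    field_simp [(hZ k).ne']
    ring
  rw [Metric.tendsto_atTop]
  intro ε hε
  obtain ⟨N, hN⟩ := Metric.tendsto_atTop.1 ha (ε / 2) (half_pos hε)
  -- The error is split at N: the finitely many early terms have vanishing relative weight, and the
  -- later ones deviate from the limit by less than ε / 2.
  have hfin : Tendsto (fun k => ∑ n ∈ Finset.range N, u k n / (∑' i, u k i) * |a n - l|) atTop
      (𝓝 0) := by
    have := tendsto_finsetSum (Finset.range N)
      fun n _ => (hu n).mul_const (|a n - l|)
    simpa using this
  obtain ⟨K, hK⟩ := Metric.tendsto_atTop.1 hfin (ε / 2) (half_pos hε)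
  refine ⟨K, fun k hk => ?_⟩
  have hKk := hK k hk
  rw [Real.dist_0_eq_abs] at hKk
  have hKk := (abs_lt.1 hKk).2
  rw [Real.dist_eq, hdiff, abs_mul, abs_of_pos (inv_pos.2 (hZ k))]
  have h1 : |∑' n, u k n * (a n - l)| ≤ ∑' n, u k n * |a n - l| := by
    have := norm_tsum_le_tsum_norm (f := fun n => u k n * (a n - l)) ((hsum k).congr fun n => by
      rw [norm_mul, Real.norm_eq_abs, Real.norm_eq_abs, abs_of_nonneg (h0 k n)])
    refine this.trans_eq (tsum_congr fun n => ?_)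
    rw [norm_mul, Real.norm_eq_abs, Real.norm_eq_abs, abs_of_nonneg (h0 k n)]
  have h2 := (hsum k).sum_add_tsum_nat_add N
  have h3 : ∑' n, u k (n + N) * |a (n + N) - l| ≤ (∑' n, u k n) * (ε / 2) := by
    rw [← tsum_mul_right]
    calc ∑' n, u k (n + N) * |a (n + N) - l| ≤ ∑' n, u k (n + N) * (ε / 2) := by
          refine Summable.tsum_le_tsum (fun n => ?_) ((summable_nat_add_iff N).2 (hsum k))
            ((summable_nat_add_iff N).2 ((hs k).mul_right _))
          have := hN (n + N) (by omega)
          rw [Real.dist_eq] at this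
          exact mul_le_mul_of_nonneg_left this.le (h0 k _)
      _ ≤ ∑' n, u k n * (ε / 2) := by
          have h4 := ((hs k).mul_right (ε / 2)).sum_add_tsum_nat_add N
          have h5 : 0 ≤ ∑ n ∈ Finset.range N, u k n * (ε / 2) :=
            Finset.sum_nonneg fun n _ => mul_nonneg (h0 k n) (half_pos hε).le
          linarith
  have h6 : (∑' n, u k n)⁻¹ * ∑ n ∈ Finset.range N, u k n * |a n - l|
      = ∑ n ∈ Finset.range N, u k n / (∑' i, u k i) * |a n - l| := by
    rw [Finset.mul_sum]
    refine Finset.sum_congr rfl fun n _ => by ring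
  calc (∑' n, u k n)⁻¹ * |∑' n, u k n * (a n - l)|
      ≤ (∑' n, u k n)⁻¹ * (∑ n ∈ Finset.range N, u k n * |a n - l| + (∑' n, u k n) * (ε / 2)) := by
        refine mul_le_mul_of_nonneg_left ?_ (inv_pos.2 (hZ k)).le
        linarith
    _ = ∑ n ∈ Finset.range N, u k n / (∑' i, u k i) * |a n - l| + ε / 2 := by
        rw [mul_add, h6, inv_mul_cancel_left₀ (hZ k).ne']
    _ < ε := by linarith

lemma integral_weighted_sum {X : Type*} [TopologicalSpace X] [MeasurableSpace X] [BorelSpace X]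
    (κ : ℕ → Measure X) [∀ n, IsProbabilityMeasure (κ n)] {u : ℕ → ℝ} (h0 : ∀ n, 0 ≤ u n)
    (hs : Summable u) (f : X →ᵇ ℝ) :
    ∫ x, f x ∂((∑' n, ENNReal.ofReal (u n))⁻¹ •
        Measure.sum fun n => ENNReal.ofReal (u n) • κ n)
      = (∑' n, u n)⁻¹ * ∑' n, u n * ∫ x, f x ∂κ n := by
  have hfin : IsFiniteMeasure (Measure.sum fun n => ENNReal.ofReal (u n) • κ n) := by
    refine ⟨?_⟩
    rw [Measure.sum_apply _ MeasurableSet.univ]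
    simp only [Measure.smul_apply, measure_univ, smul_eq_mul, mul_one]
    exact hs.tsum_ofReal_lt_top
  rw [integral_smul_measure, ENNReal.toReal_inv, ← ENNReal.ofReal_tsum_of_nonneg h0 hs,
    ENNReal.toReal_ofReal (tsum_nonneg h0), smul_eq_mul]
  congr 1
  rw [← (hasSum_integral_measure (f.integrable _)).tsum_eq]
  refine tsum_congr fun n => ?_
  rw [integral_smul_measure, ENNReal.toReal_ofReal (h0 n), smul_eq_mul]

/-! ## Patterson–Sullivan measures -/

/-- Comparing total masses in `sum_dirac_eq_sum_sphereMeasure` counts the spheres without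
enumerating reduced words. -/
lemma tsum_norm_eq {d : ℕ} (hd : 2 ≤ d) (c : ℕ → ℝ≥0∞) :
    ∑' g : FreeGroup (Fin d), c g.norm = ∑' n, c n * sphereCard d n := by
  obtain ⟨P, hP⟩ := exists_isParryMeasure hd
  have := hP.isProbabilityMeasure
  have h := congrArg (fun m => m univ) (sum_dirac_eq_sum_sphereMeasure hd hP c)
  have hp : ∀ n, sphereMeasure P n univ = 1 := fun n => by
    rw [sphereMeasure, Measure.map_apply (continuous_ofVertex_rayVertex n).measurable
      MeasurableSet.univ, preimage_univ, measure_univ]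
  simpa [Measure.sum_apply, hp] using h

lemma orbitMeasure_eq {d : ℕ} (hd : 2 ≤ d) {P : Measure (ShiftSpace d)}
    (hP : IsParryMeasure P) {w : ℕ → ℝ} (hw : ∀ n, 0 ≤ w n) :
    orbitMeasure d w = (∑' n, ENNReal.ofReal (w n * sphereCard d n))⁻¹ •
      Measure.sum fun n => ENNReal.ofReal (w n * sphereCard d n) • sphereMeasure P n := by
  have e : ∀ n, ENNReal.ofReal (w n * sphereCard d n)
      = ENNReal.ofReal (w n) * sphereCard d n := fun n => by
    rw [ENNReal.ofReal_mul (hw n), ENNReal.ofReal_natCast]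
  rw [orbitMeasure, tsum_norm_eq hd fun n => ENNReal.ofReal (w n)]
  simp only [e]
  rw [sum_dirac_eq_sum_sphereMeasure hd hP fun n => ENNReal.ofReal (w n)]

/-- Normalized orbit measures converge to the image of the Parry measure if the relative weight of
each sphere tends to zero. -/
lemma tendstoWeakly_orbitMeasure {d : ℕ} (hd : 2 ≤ d) {P : Measure (ShiftSpace d)}
    (hP : IsParryMeasure P) {w : ℕ → ℕ → ℝ} (hw : ∀ k n, 0 ≤ w k n)
    (hs : ∀ k, Summable fun n => w k n * sphereCard d n)
    (hZ : ∀ k, 0 < ∑' n, w k n * sphereCard d n)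
    (hu : ∀ n, Tendsto (fun k => w k n * sphereCard d n / ∑' i, w k i * sphereCard d i) atTop
      (𝓝 0)) :
    TendstoWeakly (fun k => orbitMeasure d (w k)) (P.map toBoundary) := by
  have := hP.isProbabilityMeasure
  have : ∀ n, IsProbabilityMeasure (sphereMeasure P n) := fun n =>
    Measure.isProbabilityMeasure_map (continuous_ofVertex_rayVertex n).measurable.aemeasurable
  intro f
  have h0 : ∀ k n, 0 ≤ w k n * sphereCard d n := fun k n =>
    mul_nonneg (hw k n) (Nat.cast_nonneg _)
  simp only [orbitMeasure_eq hd hP (hw _), integral_weighted_sum _ (h0 _) (hs _)]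
  exact tendsto_weighted_average (tendsto_integral_sphereMeasure f) h0 hs hZ hu

lemma cast_two_mul_sub_one {d : ℕ} (hd : 2 ≤ d) : ((2 * d - 1 : ℕ) : ℝ) = 2 * d - 1 := by
  rw [Nat.cast_sub (by omega)]; push_cast; ring

lemma three_le_cast {d : ℕ} (hd : 2 ≤ d) : (3 : ℝ) ≤ 2 * d - 1 := by
  have h2 : (2 : ℝ) ≤ d := by exact_mod_cast hd
  linarith

lemma sphereCard_succ_cast {d : ℕ} (hd : 2 ≤ d) (n : ℕ) :
    (sphereCard d (n + 1) : ℝ) = 2 * d * (2 * d - 1) ^ n := by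
  rw [sphereCard, Nat.cast_mul, Nat.cast_pow, cast_two_mul_sub_one hd]
  push_cast; ring

lemma exp_neg_mul_sphereCard_succ {d : ℕ} (hd : 2 ≤ d) (s : ℝ) (n : ℕ) :
    Real.exp (-s * (n + 1 : ℕ)) * sphereCard d (n + 1)
      = 2 * d * Real.exp (-s) * ((2 * d - 1) * Real.exp (-s)) ^ n := by
  rw [sphereCard_succ_cast hd, mul_pow, ← Real.exp_nat_mul]
  have : Real.exp (-s * (n + 1 : ℕ)) = Real.exp (-s) * Real.exp (n * -s) := by
    rw [← Real.exp_add]; congr 1; push_cast; ring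
  rw [this]; ring

lemma exp_ratio_lt_one_iff {d : ℕ} (hd : 2 ≤ d) (s : ℝ) :
    (2 * d - 1) * Real.exp (-s) < 1 ↔ Real.log (2 * d - 1) < s := by
  rw [Real.exp_neg, ← div_eq_mul_inv, div_lt_one (Real.exp_pos s),
    Real.log_lt_iff_lt_exp (by linarith [three_le_cast hd])]

lemma summable_exp_sphereCard_iff {d : ℕ} (hd : 2 ≤ d) (s : ℝ) :
    (Summable fun n : ℕ => Real.exp (-s * n) * sphereCard d n) ↔ Real.log (2 * d - 1) < s := by
  have h3 := three_le_cast hd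
  rw [← summable_nat_add_iff 1]
  simp only [exp_neg_mul_sphereCard_succ hd]
  rw [summable_mul_left_iff (by positivity), summable_geometric_iff_norm_lt_one, Real.norm_eq_abs,
    abs_of_nonneg (mul_nonneg (by linarith) (Real.exp_pos _).le), exp_ratio_lt_one_iff hd]

lemma summable_iff_tsum_ofReal_ne_top {ι : Type*} {f : ι → ℝ} (hf : ∀ i, 0 ≤ f i) :
    Summable f ↔ ∑' i, ENNReal.ofReal (f i) ≠ ⊤ := by
  refine ⟨fun h => h.tsum_ofReal_lt_top.ne, fun h => ?_⟩
  exact (ENNReal.summable_toReal h).congr fun i => ENNReal.toReal_ofReal (hf i)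

/-- From radius 1 on, the contributions of the spheres to the Poincaré series are geometric with
ratio (2d - 1) exp (-s), so convergence holds exactly on an open half line. -/
lemma criticalExponent_eq {d : ℕ} (hd : 2 ≤ d) :
    criticalExponent d = Real.log (2 * d - 1) := by
  have : {s : ℝ | Summable fun g : FreeGroup (Fin d) => Real.exp (-s * g.norm)}
      = Ioi (Real.log (2 * d - 1)) := by
    ext s
    rw [mem_ofPred_eq, mem_Ioi, ← summable_exp_sphereCard_iff hd,
      summable_iff_tsum_ofReal_ne_top fun _ => (Real.exp_pos _).le,
      summable_iff_tsum_ofReal_ne_top fun n => by positivity,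
      tsum_norm_eq hd fun n => ENNReal.ofReal (Real.exp (-s * n))]
    simp only [ENNReal.ofReal_mul (Real.exp_pos _).le, ENNReal.ofReal_natCast]
  rw [criticalExponent, this, csInf_Ioi]

lemma tsum_exp_sphereCard {d : ℕ} (hd : 2 ≤ d) {s : ℝ} (hs : Real.log (2 * d - 1) < s) :
    ∑' n : ℕ, Real.exp (-s * n) * sphereCard d n
      = 1 + 2 * d * Real.exp (-s) * (1 - (2 * d - 1) * Real.exp (-s))⁻¹ := by
  have h3 := three_le_cast hd
  rw [((summable_exp_sphereCard_iff hd s).2 hs).tsum_eq_zero_add]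
  simp only [exp_neg_mul_sphereCard_succ hd]
  rw [tsum_mul_left, tsum_geometric_of_lt_one (mul_nonneg (by linarith) (Real.exp_pos _).le)
    ((exp_ratio_lt_one_iff hd s).2 hs)]
  simp [sphereCard]

/-- With q = (2d - 1) exp (-s) the total mass is at least 1 / (1 - q), while each sphere weighs at
most 2 because 2d ≤ 2 (2d - 1). The relative weight of a sphere is thus at most 2 (1 - q), which
tends to 0 at the critical exponent. -/
lemma tendstoWeakly_patterson {d : ℕ} (hd : 2 ≤ d) {P : Measure (ShiftSpace d)}
    (hP : IsParryMeasure P) {s : ℕ → ℝ} (hs : ∀ k, criticalExponent d < s k)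
    (hlim : Tendsto s atTop (𝓝 (criticalExponent d))) :
    TendstoWeakly (fun k => orbitMeasure d fun r => Real.exp (-s k * r)) (P.map toBoundary) := by
  have h3 := three_le_cast hd
  rw [criticalExponent_eq hd] at hs hlim
  set q : ℕ → ℝ := fun k => (2 * d - 1) * Real.exp (-s k) with hq
  have hq0 : ∀ k, 0 < q k := fun k => mul_pos (by linarith) (Real.exp_pos _)
  have hq1 : ∀ k, q k < 1 := fun k => (exp_ratio_lt_one_iff hd _).2 (hs k)
  have hqlim : Tendsto q atTop (𝓝 1) := by
    have h1 : Tendsto q atTop (𝓝 ((2 * d - 1) * Real.exp (-Real.log (2 * d - 1)))) :=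
      ((Real.continuous_exp.tendsto _).comp hlim.neg).const_mul _
    rwa [Real.exp_neg, Real.exp_log (by linarith), mul_inv_cancel₀ (by linarith)] at h1
  have hZge : ∀ k, (1 - q k)⁻¹ ≤ ∑' n : ℕ, Real.exp (-s k * n) * sphereCard d n := by
    intro k
    rw [tsum_exp_sphereCard hd (hs k)]
    change _ ≤ 1 + 2 * d * Real.exp (-s k) * (1 - q k)⁻¹
    have h1 : 0 < 1 - q k := by linarith [hq1 k]
    have h2 : (1 - q k)⁻¹ = 1 + q k * (1 - q k)⁻¹ := by field_simp; ring
    have h4 : q k ≤ 2 * d * Real.exp (-s k) := by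
      simp only [hq]; nlinarith [Real.exp_pos (-s k)]
    have := mul_le_mul_of_nonneg_right h4 (inv_pos.2 h1).le
    linarith
  have hZpos : ∀ k, 0 < ∑' n : ℕ, Real.exp (-s k * n) * sphereCard d n := fun k =>
    (inv_pos.2 (by linarith [hq1 k])).trans_le (hZge k)
  refine tendstoWeakly_orbitMeasure hd hP (w := fun k n => Real.exp (-s k * n))
    (fun k n => (Real.exp_pos _).le) (fun k => (summable_exp_sphereCard_iff hd _).2 (hs k)) hZpos
    fun n => ?_
  have hle : ∀ k, Real.exp (-s k * n) * sphereCard d n ≤ 2 := by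
    intro k
    cases n with
    | zero => simp [sphereCard]
    | succ n =>
      rw [exp_neg_mul_sphereCard_succ hd]
      have h1 : (q k) ^ n ≤ 1 := pow_le_one₀ (hq0 k).le (hq1 k).le
      have h2 : 2 * d * Real.exp (-s k) ≤ 2 := by
        have := hq1 k
        simp only [hq] at this
        nlinarith [Real.exp_pos (-s k)]
      calc 2 * d * Real.exp (-s k) * q k ^ n ≤ 2 * 1 :=
            mul_le_mul h2 h1 (pow_nonneg (hq0 k).le n) (by norm_num)
        _ = 2 := by ring
  have hup : Tendsto (fun k => 2 * (1 - q k)) atTop (𝓝 0) := by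
    have := (hqlim.const_sub 1).const_mul 2
    simpa using this
  refine squeeze_zero (fun k => by positivity [hZpos k]) (fun k => ?_) hup
  have h1 : 0 < 1 - q k := by linarith [hq1 k]
  rw [div_le_iff₀ (hZpos k)]
  have h2 : 1 ≤ (1 - q k) * ∑' n : ℕ, Real.exp (-s k * n) * sphereCard d n := by
    have := mul_le_mul_of_nonneg_left (hZge k) h1.le
    rwa [mul_inv_cancel₀ h1.ne'] at this
  linarith [hle k]

/-! ### Averages over balls -/

/-- The weight of the sphere of radius `i` in `sphereAverage d n`. -/
def ballWeight (d n i : ℕ) : ℝ := if i ≤ n then 1 / (2 * d - 1) ^ i else 0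

lemma ballWeight_mul_sphereCard {d : ℕ} (hd : 2 ≤ d) (n i : ℕ) :
    ballWeight d n i * sphereCard d i
      = if i ≤ n then (if i = 0 then (1 : ℝ) else 2 * d / (2 * d - 1)) else 0 := by
  have h3 := three_le_cast hd
  have hne : (2 * d - 1 : ℝ) ≠ 0 := by linarith
  rw [ballWeight]
  split_ifs with h1 h2
  · subst h2; simp [sphereCard]
  · obtain ⟨j, rfl⟩ := Nat.exists_eq_succ_of_ne_zero h2
    rw [sphereCard_succ_cast hd]
    have hp := pow_ne_zero j hne
    rw [Nat.succ_eq_add_one, pow_succ]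
    field_simp
  · simp

/-- Every sphere of positive radius up to n has the same weight 2d / (2d - 1), and the centre has
weight 1. -/
lemma hasSum_ballWeight {d : ℕ} (hd : 2 ≤ d) (n : ℕ) :
    HasSum (fun i => ballWeight d n i * sphereCard d i) (1 + 2 * d * n / (2 * d - 1)) := by
  have h : ∑ i ∈ Finset.range (n + 1), ballWeight d n i * sphereCard d i
      = 1 + 2 * d * n / (2 * d - 1) := by
    rw [Finset.sum_range_succ']
    have : ∀ i ∈ Finset.range n, ballWeight d n (i + 1) * sphereCard d (i + 1)
        = 2 * d / (2 * d - 1) := fun i hi => by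
      have := Finset.mem_range.1 hi
      rw [ballWeight_mul_sphereCard hd, if_pos (by omega), if_neg (by omega)]
    rw [Finset.sum_congr rfl this, ballWeight_mul_sphereCard hd]
    simp
    ring
  rw [← h]
  refine hasSum_sum_of_ne_finset_zero fun i hi => ?_
  rw [Finset.mem_range] at hi
  rw [ballWeight_mul_sphereCard hd, if_neg (by omega)]

lemma sphereAverage_eq {d : ℕ} (hd : 2 ≤ d) (n : ℕ) :
    sphereAverage d n = orbitMeasure d (ballWeight d n) := by
  have h3 := three_le_cast hd
  have hw : ∀ i, 0 ≤ ballWeight d n i := fun i => by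
    rw [ballWeight]; split_ifs
    · have : (0 : ℝ) ≤ 2 * d - 1 := by linarith
      positivity
    · rfl
  have e1 : ∀ i, ENNReal.ofReal (ballWeight d n i)
      = if i ≤ n then ENNReal.ofReal (1 / (2 * d - 1) ^ i) else 0 := fun i => by
    rw [ballWeight]; split_ifs <;> simp
  have e2 : ∑' g : FreeGroup (Fin d), ENNReal.ofReal (ballWeight d n g.norm)
      = ENNReal.ofReal (1 + 2 * d * n / (2 * d - 1)) := by
    rw [tsum_norm_eq hd fun i => ENNReal.ofReal (ballWeight d n i),
      ← (hasSum_ballWeight hd n).tsum_eq,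
      ENNReal.ofReal_tsum_of_nonneg (fun i => mul_nonneg (hw i) (Nat.cast_nonneg _))
        (hasSum_ballWeight hd n).summable]
    simp only [ENNReal.ofReal_mul (hw _), ENNReal.ofReal_natCast]
  rw [sphereAverage, orbitMeasure, e2]
  simp only [e1]

/-- The total weight is at least n + 1 and each sphere weighs at most 2, so the averaging principle
used for the Poincaré weights applies. -/
lemma tendstoWeakly_sphereAverage {d : ℕ} (hd : 2 ≤ d) {P : Measure (ShiftSpace d)}
    (hP : IsParryMeasure P) : TendstoWeakly (sphereAverage d) (P.map toBoundary) := by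
  have h3 := three_le_cast hd
  have hsA : sphereAverage d = fun n => orbitMeasure d (ballWeight d n) :=
    funext fun n => sphereAverage_eq hd n
  rw [hsA]
  have hZ : ∀ n : ℕ, (n : ℝ) + 1 ≤ ∑' i, ballWeight d n i * sphereCard d i := by
    intro n
    rw [(hasSum_ballWeight hd n).tsum_eq, add_comm, add_le_add_iff_left, le_div_iff₀ (by linarith)]
    nlinarith [(Nat.cast_nonneg n : (0 : ℝ) ≤ n)]
  have hZ0 : ∀ n : ℕ, 0 < ∑' i, ballWeight d n i * sphereCard d i := fun n =>
    lt_of_lt_of_le (by positivity) (hZ n)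
  refine tendstoWeakly_orbitMeasure hd hP (fun n i => ?_)
    (fun n => (hasSum_ballWeight hd n).summable) hZ0 fun i => ?_
  · rw [ballWeight]; split_ifs
    · have : (0 : ℝ) ≤ 2 * d - 1 := by linarith
      positivity
    · rfl
  have hb : ∀ n, 0 ≤ ballWeight d n i * sphereCard d i ∧
      ballWeight d n i * sphereCard d i ≤ 2 := by
    intro n
    rw [ballWeight_mul_sphereCard hd]
    split_ifs
    · norm_num
    · exact ⟨div_nonneg (by positivity) (by linarith),
        by rw [div_le_iff₀ (by linarith)]; linarith⟩
    · norm_num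
  refine squeeze_zero (fun n => div_nonneg (hb n).1 (hZ0 n).le) (fun n => ?_)
    (tendsto_const_div_atTop_nhds_zero_nat 2 |>.comp (tendsto_add_atTop_nat 1))
  simp only [Function.comp]
  refine div_le_div₀ (by norm_num) (hb n).2 (by positivity) ?_
  push_cast
  exact hZ n

/-- Integrals of bounded continuous functions determine the image measure on the compactification,
and the boundary is compact, hence closed in it, so the measure can be pulled back. -/
lemma TendstoWeakly.unique {d : ℕ} {m : ℕ → Measure (Compactification d)}
    {μ μ' : Measure (Boundary d)} [IsProbabilityMeasure μ] [IsProbabilityMeasure μ']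
    (h : TendstoWeakly m μ) (h' : TendstoWeakly m μ') : μ = μ' := by
  have : CompactSpace (Boundary d) :=
    (isHomeomorph_toBoundary d).homeomorph.compactSpace
  have hemb : IsClosedEmbedding (ofBoundary (d := d)) :=
    (isEmbedding_ofBoundary d).continuous.isClosedEmbedding (isEmbedding_ofBoundary d).injective
  have hm := hemb.continuous.measurable
  have := Measure.isProbabilityMeasure_map (μ := μ) hm.aemeasurable
  have := Measure.isProbabilityMeasure_map (μ := μ') hm.aemeasurable
  have heq : μ.map ofBoundary = μ'.map ofBoundary :=
    ext_of_forall_integral_eq_of_IsFiniteMeasure fun f => tendsto_nhds_unique (h f) (h' f)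
  have := congrArg (Measure.comap ofBoundary) heq
  rwa [hemb.measurableEmbedding.comap_map, hemb.measurableEmbedding.comap_map] at this

/-- All admissible sequences of exponents have the same weak limit, and one such sequence exists. -/
theorem isPattersonSullivan_iff {d : ℕ} (hd : 2 ≤ d) {P : Measure (ShiftSpace d)}
    (hP : IsParryMeasure P) (μ : Measure (Boundary d)) :
    IsPattersonSullivan μ ↔ μ = P.map toBoundary := by
  have hPp := hP.isProbabilityMeasure
  have hPm : IsProbabilityMeasure (P.map toBoundary) :=
    Measure.isProbabilityMeasure_map (continuous_toBoundary d).measurable.aemeasurable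
  constructor
  · rintro ⟨h1, s, hs, hlim, ht⟩
    exact TendstoWeakly.unique ht (tendstoWeakly_patterson hd hP hs hlim)
  · rintro rfl
    refine ⟨hPm, fun k => criticalExponent d + 1 / ((k : ℝ) + 1), fun k => ?_, ?_, ?_⟩
    · have : 0 < 1 / ((k : ℝ) + 1) := by positivity
      linarith
    · have := tendsto_one_div_add_atTop_nhds_zero_nat (𝕜 := ℝ).const_add (criticalExponent d)
      simpa using this
    · refine tendstoWeakly_patterson hd hP (fun k => ?_) ?_
      · have : 0 < 1 / ((k : ℝ) + 1) := by positivity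
        linarith
      · have := tendsto_one_div_add_atTop_nhds_zero_nat (𝕜 := ℝ).const_add (criticalExponent d)
        simpa using this

lemma map_toBoundary_injective {d : ℕ} {P Q : Measure (ShiftSpace d)}
    (h : P.map toBoundary = Q.map toBoundary) : P = Q := by
  have hemb : MeasurableEmbedding (toBoundary (d := d)) :=
    (isHomeomorph_toBoundary d).homeomorph.measurableEmbedding
  have := congrArg (Measure.comap toBoundary) h
  rwa [hemb.comap_map, hemb.comap_map] at this

/-! ## Shannon entropy of finite partitions -/

/-- The right side is the tangent line at q of the strictly concave function `Real.negMulLog`;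
scaling reduces it to q = 1. Sums of this inequality give the entropy bounds and their equality
cases. -/
lemma negMulLog_lt {p q : ℝ} (hp : 0 ≤ p) (hq : 0 < q) (hpq : p ≠ q) :
    Real.negMulLog p < -p * Real.log q + q - p := by
  have h1 := Real.negMulLog_mul q (p / q)
  rw [mul_div_cancel₀ _ hq.ne'] at h1
  have h2 := mul_lt_mul_of_pos_left
    (Real.negMulLog_lt_one_sub_self (div_nonneg hp hq.le)
      (fun h => hpq ((div_eq_one_iff_eq hq.ne').1 h))) hq
  rw [mul_sub, mul_one, mul_div_cancel₀ _ hq.ne'] at h2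
  have h3 : p / q * Real.negMulLog q = -p * Real.log q := by
    rw [Real.negMulLog]; field_simp
  linarith

lemma negMulLog_le {p q : ℝ} (hp : 0 ≤ p) (hq : 0 < q) :
    Real.negMulLog p ≤ -p * Real.log q + q - p := by
  rcases eq_or_ne p q with rfl | h
  · rw [Real.negMulLog]; linarith
  · exact (negMulLog_lt hp hq h).le

lemma negMulLog_sum_le {ι : Type*} (s : Finset ι) {p : ι → ℝ} (hp : ∀ i, 0 ≤ p i) :
    Real.negMulLog (∑ i ∈ s, p i) ≤ ∑ i ∈ s, Real.negMulLog (p i) := by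
  rw [Real.negMulLog, neg_mul, Finset.sum_mul, ← Finset.sum_neg_distrib]
  refine Finset.sum_le_sum fun i hi => ?_
  rw [Real.negMulLog, ← neg_mul]
  rcases (hp i).eq_or_lt with h | h
  · simp [← h]
  · have := Real.log_le_log h (Finset.single_le_sum (fun j _ => hp j) hi)
    nlinarith

/-- Nonnegativity of mutual information for a matrix of arbitrary total mass P. Each entry is
compared, by the tangent inequality, with the product of its marginals divided by P; the linear
corrections cancel in the sum. -/
lemma sum_negMulLog_add_le {ι κ : Type*} [Fintype ι] [Fintype κ] {p : ι → κ → ℝ}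
    (hp : ∀ i j, 0 ≤ p i j) :
    ∑ i, ∑ j, Real.negMulLog (p i j) + Real.negMulLog (∑ i, ∑ j, p i j)
      ≤ ∑ i, Real.negMulLog (∑ j, p i j) + ∑ j, Real.negMulLog (∑ i, p i j) := by
  set r : ι → ℝ := fun i => ∑ j, p i j with hr
  set c : κ → ℝ := fun j => ∑ i, p i j with hc
  set P : ℝ := ∑ i, r i with hP
  have hr0 : ∀ i, 0 ≤ r i := fun i => Finset.sum_nonneg fun j _ => hp i j
  have hc0 : ∀ j, 0 ≤ c j := fun j => Finset.sum_nonneg fun i _ => hp i j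
  have hPc : P = ∑ j, c j := Finset.sum_comm
  have hpr : ∀ i j, p i j ≤ r i := fun i j =>
    Finset.single_le_sum (fun j _ => hp i j) (Finset.mem_univ j)
  have hpc : ∀ i j, p i j ≤ c j := fun i j =>
    Finset.single_le_sum (f := fun i => p i j) (fun i _ => hp i j) (Finset.mem_univ i)
  have hrP : ∀ i, r i ≤ P := fun i => Finset.single_le_sum (fun i _ => hr0 i) (Finset.mem_univ i)
  have key : ∀ i j, Real.negMulLog (p i j)
      ≤ -(p i j) * Real.log (r i) + -(p i j) * Real.log (c j) + p i j * Real.log P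
        + r i * c j / P - p i j := by
    intro i j
    rcases (hp i j).eq_or_lt with h | h
    · rw [← h]
      have : 0 ≤ r i * c j / P :=
        div_nonneg (mul_nonneg (hr0 i) (hc0 j)) (Finset.sum_nonneg fun i _ => hr0 i)
      simpa using this
    · have h1 : 0 < r i := h.trans_le (hpr i j)
      have h2 : 0 < c j := h.trans_le (hpc i j)
      have h3 : 0 < P := h1.trans_le (hrP i)
      have := negMulLog_le (hp i j) (q := r i * c j / P) (by positivity)
      rw [Real.log_div (by positivity) h3.ne', Real.log_mul h1.ne' h2.ne'] at this
      linarith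
  have hsum : ∑ i, ∑ j, Real.negMulLog (p i j) ≤ ∑ i, ∑ j,
      (-(p i j) * Real.log (r i) + -(p i j) * Real.log (c j) + p i j * Real.log P
        + r i * c j / P - p i j) :=
    Finset.sum_le_sum fun i _ => Finset.sum_le_sum fun j _ => key i j
  have e1 : ∑ i, ∑ j, -(p i j) * Real.log (r i) = ∑ i, Real.negMulLog (r i) := by
    refine Finset.sum_congr rfl fun i _ => ?_
    rw [← Finset.sum_mul, Finset.sum_neg_distrib, Real.negMulLog]
  have e2 : ∑ i, ∑ j, -(p i j) * Real.log (c j) = ∑ j, Real.negMulLog (c j) := by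
    rw [Finset.sum_comm]
    refine Finset.sum_congr rfl fun j _ => ?_
    rw [← Finset.sum_mul, Finset.sum_neg_distrib, Real.negMulLog]
  have e3 : ∑ i, ∑ j, p i j * Real.log P = P * Real.log P := by
    simp_rw [← Finset.sum_mul]; rfl
  have e4 : ∑ i, ∑ j, r i * c j / P = P := by
    simp_rw [← Finset.sum_div, ← Finset.mul_sum, ← hPc, ← Finset.sum_mul]
    change P * P / P = P
    rw [mul_self_div_self]
  have e5 : ∑ i, ∑ j, p i j = P := rfl
  simp only [Finset.sum_sub_distrib, Finset.sum_add_distrib] at hsum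
  rw [e1, e2, e3, e4, e5] at hsum
  have e6 : Real.negMulLog P = -(P * Real.log P) := by rw [Real.negMulLog, neg_mul]
  linarith

section Entropy

variable {X : Type*} [MeasurableSpace X] {μ : Measure X} [IsProbabilityMeasure μ]

lemma measureReal_comp_preimage {ι κ : Type*} [Fintype ι] [DecidableEq κ] [MeasurableSpace ι]
    [MeasurableSingletonClass ι] {f : X → ι} (hf : Measurable f) (e : ι → κ) (j : κ) :
    μ.real ((fun x => e (f x)) ⁻¹' {j})
      = ∑ i ∈ Finset.univ.filter (fun i => e i = j), μ.real (f ⁻¹' {i}) := by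
  rw [← measureReal_biUnion_finset]
  · congr 1
    ext x
    simp
  · intro i _ i' _ hii
    exact Disjoint.preimage f (by simpa using hii)
  · exact fun i _ => hf (measurableSet_singleton i)

lemma partitionEntropy_comp_le {ι κ : Type*} [Fintype ι] [Fintype κ] [MeasurableSpace ι]
    [MeasurableSingletonClass ι] {f : X → ι} (hf : Measurable f) (e : ι → κ) :
    partitionEntropy μ (fun x => e (f x)) ≤ partitionEntropy μ f := by
  classical
  rw [partitionEntropy, partitionEntropy, ← Finset.sum_fiberwise Finset.univ e]
  refine Finset.sum_le_sum fun j _ => ?_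
  rw [measureReal_comp_preimage hf e j]
  exact negMulLog_sum_le _ fun i => measureReal_nonneg

lemma partitionEntropy_comp_of_injective {ι κ : Type*} [Fintype ι] [Fintype κ] (μ : Measure X)
    (f : X → ι) {e : ι → κ} (he : Function.Injective e) :
    partitionEntropy μ (fun x => e (f x)) = partitionEntropy μ f := by
  refine (Fintype.sum_of_injective e he _ _ (fun j hj => ?_) fun i => ?_).symm
  · have : (fun x => e (f x)) ⁻¹' {j} = ∅ := by
      ext x
      simp only [mem_preimage, mem_singleton_iff, mem_empty_iff_false, iff_false]
      exact fun h => hj ⟨f x, h⟩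
    simp [this]
  · have : (fun x => e (f x)) ⁻¹' {e i} = f ⁻¹' {i} := by
      ext x
      simp [he.eq_iff]
    rw [this]

lemma partitionEntropy_comp_measurePreserving {ι : Type*} [Fintype ι] [MeasurableSpace ι]
    [MeasurableSingletonClass ι] {Z Y : Type*} [MeasurableSpace Z] [MeasurableSpace Y]
    {μ : Measure Z} {ν : Measure Y} {T : Z → Y} (hT : MeasurePreserving T μ ν) {f : Y → ι} (hf : Measurable f) :
    partitionEntropy μ (fun x => f (T x)) = partitionEntropy ν f := by
  refine Finset.sum_congr rfl fun i _ => ?_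
  congr 1
  exact hT.measureReal_preimage (hf (measurableSet_singleton i)).nullMeasurableSet

/-- Strong subadditivity of entropy. -/
lemma partitionEntropy_strong_subadditive {ι κ τ : Type*} [Fintype ι] [Fintype κ] [Fintype τ]
    [MeasurableSpace ι] [MeasurableSpace κ] [MeasurableSpace τ] [MeasurableSingletonClass ι]
    [MeasurableSingletonClass κ] [MeasurableSingletonClass τ] {f : X → ι} {g : X → κ} {k : X → τ}
    (hf : Measurable f) (hg : Measurable g) (hk : Measurable k) :
    partitionEntropy μ (fun x => (f x, g x, k x)) + partitionEntropy μ g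
      ≤ partitionEntropy μ (fun x => (f x, g x)) + partitionEntropy μ (fun x => (g x, k x)) := by
  classical
  have hF : Measurable fun x => (f x, g x, k x) := hf.prodMk (hg.prodMk hk)
  -- On each atom j of `g` the joint masses of `f` and `k` form a matrix, to which
  -- `sum_negMulLog_add_le` applies; the results are added over j.
  set p : κ → ι → τ → ℝ := fun j i l => μ.real ((fun x => (f x, g x, k x)) ⁻¹' {(i, j, l)}) with hp
  have h1 : ∀ i j, μ.real ((fun x => (f x, g x)) ⁻¹' {(i, j)}) = ∑ l, p j i l := by
    intro i j
    have := measureReal_comp_preimage (μ := μ) hF (fun q => (q.1, q.2.1)) (i, j)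
    rw [this, Finset.sum_filter, Fintype.sum_prod_type, Finset.sum_eq_single i]
    · rw [Fintype.sum_prod_type, Finset.sum_eq_single j]
      · simp [hp]
      · intro b _ hb; simp [hb]
      · simp
    · intro b _ hb; simp [hb]
    · simp
  have h2 : ∀ j l, μ.real ((fun x => (g x, k x)) ⁻¹' {(j, l)}) = ∑ i, p j i l := by
    intro j l
    have := measureReal_comp_preimage (μ := μ) hF (fun q => q.2) (j, l)
    rw [this, Finset.sum_filter, Fintype.sum_prod_type]
    refine Finset.sum_congr rfl fun i _ => ?_
    rw [Finset.sum_eq_single (j, l)]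
    · simp [hp]
    · intro b _ hb; simp [hb]
    · simp
  have h3 : ∀ j, μ.real (g ⁻¹' {j}) = ∑ i, ∑ l, p j i l := by
    intro j
    have := measureReal_comp_preimage (μ := μ) (hf.prodMk hg) (fun q => q.2) j
    rw [this, Finset.sum_filter, Fintype.sum_prod_type]
    refine Finset.sum_congr rfl fun i _ => ?_
    rw [Finset.sum_eq_single j]
    · rw [if_pos rfl, h1]
    · intro b _ hb; simp [hb]
    · simp
  have e1 : partitionEntropy μ (fun x => (f x, g x, k x))
      = ∑ j, ∑ i, ∑ l, Real.negMulLog (p j i l) := by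
    rw [partitionEntropy, Fintype.sum_prod_type]
    simp_rw [Fintype.sum_prod_type]
    exact Finset.sum_comm
  have e2 : partitionEntropy μ (fun x => (f x, g x))
      = ∑ j, ∑ i, Real.negMulLog (∑ l, p j i l) := by
    rw [partitionEntropy, Fintype.sum_prod_type_right]
    simp only [h1]
  have e3 : partitionEntropy μ (fun x => (g x, k x))
      = ∑ j, ∑ l, Real.negMulLog (∑ i, p j i l) := by
    rw [partitionEntropy, Fintype.sum_prod_type]
    simp only [h2]
  rw [e1, e2, e3, partitionEntropy]
  simp only [h3]
  rw [← Finset.sum_add_distrib, ← Finset.sum_add_distrib]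
  exact Finset.sum_le_sum fun j _ => sum_negMulLog_add_le fun i l => measureReal_nonneg

/-- Conditional entropy of the partition labelled by `f` given the one labelled by `g`. -/
def condEntropy {ι κ : Type*} [Fintype ι] [Fintype κ] (μ : Measure X) (f : X → ι) (g : X → κ) :
    ℝ :=
  partitionEntropy μ (fun x => (f x, g x)) - partitionEntropy μ g

/-- Conditioning on a finer partition decreases entropy. -/
lemma condEntropy_le_condEntropy_comp {ι κ τ : Type*} [Fintype ι] [Fintype κ] [Fintype τ]
    [MeasurableSpace ι] [MeasurableSpace κ] [MeasurableSpace τ] [MeasurableSingletonClass ι]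
    [MeasurableSingletonClass κ] [MeasurableSingletonClass τ] {f : X → ι} {k : X → τ}
    (hf : Measurable f) (hk : Measurable k) {e : τ → κ} (he : Measurable e) :
    condEntropy μ f k ≤ condEntropy μ f (fun x => e (k x)) := by
  -- The middle partition is the coarser one. Being a function of `k`, it can be dropped wherever
  -- `k` itself is present.
  have h := partitionEntropy_strong_subadditive (μ := μ) hf (he.comp hk) hk
  have h1 := partitionEntropy_comp_of_injective μ (fun x => (f x, k x))
    (e := fun q : ι × τ => (q.1, e q.2, q.2)) (by rintro ⟨a, b⟩ ⟨a', b'⟩ h; simp_all)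
  have h2 := partitionEntropy_comp_of_injective μ k
    (e := fun q : τ => (e q, q)) (by rintro a a' h; simp_all)
  simp only [Function.comp_def] at h
  rw [condEntropy, condEntropy]
  linarith

variable {ι κ : Type*} [Fintype ι] [Fintype κ] [MeasurableSpace ι] [MeasurableSpace κ]
  [MeasurableSingletonClass ι] [MeasurableSingletonClass κ] {T : X → X}

lemma measurable_itinerary {X ι : Type*} [MeasurableSpace X] [MeasurableSpace ι] {T : X → X}
    (hT : Measurable T) {f : X → ι} (hf : Measurable f) (n : ℕ) :
    Measurable (itinerary T f n) :=
  measurable_pi_iff.2 fun i => hf.comp (hT.iterate i)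

lemma partitionEntropy_itinerary_succ_prod {X ι κ : Type*} [MeasurableSpace X] [Fintype ι]
    [Fintype κ] (μ : Measure X) (T : X → X) (f : X → ι) (k : X → κ) (n : ℕ) :
    partitionEntropy μ (fun x => (itinerary T f (n + 1) x, k x))
      = partitionEntropy μ (fun x => (f (T^[n] x), k x, itinerary T f n x)) := by
  have := partitionEntropy_comp_of_injective μ (fun x => (itinerary T f (n + 1) x, k x))
    (e := fun q : (Fin (n + 1) → ι) × κ => (q.1 (Fin.last n), q.2, fun i : Fin n => q.1 i.castSucc))
    (by
      rintro ⟨u, a⟩ ⟨v, b⟩ h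
      simp only [Prod.mk.injEq] at h
      refine Prod.ext (funext fun i => ?_) h.2.1
      refine Fin.lastCases h.1 (fun j => congrFun h.2.2 j) i)
  rw [← this]
  rfl

/-- Strong subadditivity with `k` in the middle, one time step after the other. -/
lemma condEntropy_itinerary_le (hT : Measurable T) {f : X → ι} (hf : Measurable f) {k : X → κ}
    (hk : Measurable k) (n : ℕ) : condEntropy μ (itinerary T f n) k
      ≤ ∑ i ∈ Finset.range n, condEntropy μ (fun x => f (T^[i] x)) k := by
  induction n with
  | zero =>
    have h : partitionEntropy μ (fun x => (itinerary T f 0 x, k x)) = partitionEntropy μ k := by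
      have := partitionEntropy_comp_of_injective μ (fun x => (itinerary T f 0 x, k x))
        (e := fun q : (Fin 0 → ι) × κ => q.2)
        (by rintro ⟨u, a⟩ ⟨v, b⟩ h; exact Prod.ext (Subsingleton.elim _ _) h)
      exact this.symm
    simp [condEntropy, h]
  | succ n ih =>
    rw [Finset.sum_range_succ]
    have h := partitionEntropy_strong_subadditive (μ := μ) (f := fun x => f (T^[n] x)) (g := k)
      (hf.comp (hT.iterate n)) hk (measurable_itinerary hT hf n)
    rw [← partitionEntropy_itinerary_succ_prod] at h
    have h2 := partitionEntropy_comp_of_injective μ (fun x => (itinerary T f n x, k x))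
      (e := Prod.swap) Prod.swap_injective
    simp only [Prod.swap_prod_mk] at h2
    rw [condEntropy] at ih ⊢
    rw [condEntropy]
    linarith

/-- Comparison of the entropies of the iterated joins of two partitions. -/
lemma partitionEntropy_itinerary_le (hT : MeasurePreserving T μ μ) {f : X → ι} (hf : Measurable f)
    {α : X → κ} (hα : Measurable α) (n r : ℕ) :
    partitionEntropy μ (itinerary T f n)
      ≤ partitionEntropy μ (itinerary T α (n + r)) + n * condEntropy μ f (itinerary T α r) := by
  have hTm := hT.measurable
  have h1 := partitionEntropy_comp_le (μ := μ) (f := fun x => (itinerary T f n x,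
    itinerary T α (n + r) x)) ((measurable_itinerary hTm hf n).prodMk
      (measurable_itinerary hTm hα (n + r))) Prod.fst
  have h2 := condEntropy_itinerary_le (μ := μ) hTm hf (measurable_itinerary hTm hα (n + r)) n
  -- Among the n + r known labels only the window of length r starting at time i is kept. Invariance
  -- moves it back to time 0.
  have h3 : ∀ i ∈ Finset.range n, condEntropy μ (fun x => f (T^[i] x)) (itinerary T α (n + r))
      ≤ condEntropy μ f (itinerary T α r) := by
    intro i hi
    have hi := Finset.mem_range.1 hi
    refine (condEntropy_le_condEntropy_comp (hf.comp (hTm.iterate i))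
      (measurable_itinerary hTm hα (n + r))
      (e := fun w : Fin (n + r) → κ => fun j : Fin r => w ⟨j + i, by omega⟩)
      (measurable_pi_iff.2 fun j => measurable_pi_apply _)).trans_eq ?_
    have e : (fun x => (fun j : Fin r => itinerary T α (n + r) x ⟨j + i, by omega⟩))
        = fun x => itinerary T α r (T^[i] x) := by
      funext x j
      simp only [itinerary, Function.iterate_add_apply]
    have e' : (fun x => ((f ∘ T^[i]) x, fun j : Fin r => itinerary T α (n + r) x ⟨j + i, by omega⟩))
        = fun x => (f (T^[i] x), itinerary T α r (T^[i] x)) :=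
      funext fun x => Prod.ext rfl (congrFun e x)
    rw [condEntropy, condEntropy, e, e']
    have hTi := hT.iterate i
    rw [partitionEntropy_comp_measurePreserving hTi (measurable_itinerary hTm hα r)]
    congr 1
    exact partitionEntropy_comp_measurePreserving hTi (f := fun x => (f x, itinerary T α r x))
      (hf.prodMk (measurable_itinerary hTm hα r))
  have h4 := h2.trans (Finset.sum_le_sum h3)
  rw [Finset.sum_const, Finset.card_range, nsmul_eq_mul] at h4
  rw [condEntropy] at h4
  linarith

lemma abs_measureReal_sub_le {A B D : Set X} (h1 : A ⊆ B ∪ D) (h2 : B ⊆ A ∪ D) :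
    |μ.real A - μ.real B| ≤ μ.real D := by
  have h1 := (measureReal_mono h1 (measure_ne_top μ _)).trans (measureReal_union_le B D)
  have h2 := (measureReal_mono h2 (measure_ne_top μ _)).trans (measureReal_union_le A D)
  rw [abs_le]; constructor <;> linarith

/-- Conditional entropy tends to zero along partitions approximating `f`. -/
lemma tendsto_condEntropy_zero {ι : Type*} [Fintype ι] {f : X → ι} {g : ℕ → X → ι}
    (h : Tendsto (fun n => μ.real {x | f x ≠ g n x}) atTop (𝓝 0)) :
    Tendsto (fun n => condEntropy μ f (g n)) atTop (𝓝 0) := by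
  have hlim : ∀ {A : ℕ → Set X} {B : Set X}, (∀ n, A n ⊆ B ∪ {x | f x ≠ g n x}) →
      (∀ n, B ⊆ A n ∪ {x | f x ≠ g n x}) → Tendsto (fun n => Real.negMulLog (μ.real (A n))) atTop
        (𝓝 (Real.negMulLog (μ.real B))) := by
    intro A B h1 h2
    refine (Real.continuous_negMulLog.tendsto _).comp ?_
    rw [tendsto_iff_dist_tendsto_zero]
    exact squeeze_zero (fun _ => dist_nonneg)
      (fun n => abs_measureReal_sub_le (h1 n) (h2 n)) h
  -- Atom masses involving `g n` converge to those with `f` in its place, so the limit is the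
  -- entropy of `f` given itself.
  have e0 : condEntropy μ f f = 0 := by
    rw [condEntropy, sub_eq_zero]
    exact partitionEntropy_comp_of_injective μ f (e := fun i => (i, i)) fun i j h => by simp_all
  rw [← e0]
  refine Tendsto.sub (tendsto_finsetSum _ fun q _ => hlim (fun n x hx => ?_) fun n x hx => ?_)
    (tendsto_finsetSum _ fun q _ => hlim (fun n x hx => ?_) fun n x hx => ?_)
  all_goals
    by_cases hfx : f x = g n x
    · left; simp_all
    · right; exact hfx

end Entropy

/-! ## Kolmogorov–Sinai entropy -/

section Generator

variable {X : Type*} [m : MeasurableSpace X] {μ : Measure X} [IsProbabilityMeasure μ]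
  {ι κ : Type*} [Fintype ι] [Fintype κ] [MeasurableSpace ι] [MeasurableSpace κ]
  [MeasurableSingletonClass ι] [MeasurableSingletonClass κ] {T : X → X}

/-- The sets determined by finitely many terms of the itinerary. -/
def itinerarySets {X κ : Type*} (T : X → X) (α : X → κ) : Set (Set X) :=
  {s | ∃ (r : ℕ) (S : Set (Fin r → κ)), s = itinerary T α r ⁻¹' S}

lemma itinerary_preimage_extend {X κ : Type*} (T : X → X) (α : X → κ) {r r' : ℕ} (h : r ≤ r')
    (S : Set (Fin r → κ)) : itinerary T α r ⁻¹' S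
      = itinerary T α r' ⁻¹' {w | (fun i => w (Fin.castLE h i)) ∈ S} := rfl

lemma isSetAlgebra_itinerarySets {X κ : Type*} (T : X → X) (α : X → κ) :
    IsSetAlgebra (itinerarySets T α) where
  empty_mem := ⟨0, ∅, rfl⟩
  compl_mem := by
    rintro s ⟨r, S, rfl⟩
    exact ⟨r, Sᶜ, rfl⟩
  union_mem := by
    rintro s t ⟨r, S, rfl⟩ ⟨r', S', rfl⟩
    rw [itinerary_preimage_extend T α (le_max_left r r') S,
      itinerary_preimage_extend T α (le_max_right r r') S', ← preimage_union]
    exact ⟨_, _, rfl⟩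

/-- Each atom of `f` is approximated within δ by a set depending on finitely many labels. Outside
the union of the symmetric differences, exactly one approximating set contains the point, and its
index is the value of `f`. -/
lemma exists_measureReal_ne_le {κ : Type*} {α : X → κ}
    (hgen : m = MeasurableSpace.generateFrom (itinerarySets T α)) {f : X → ι} (hf : Measurable f)
    {δ : ℝ} (hδ : 0 < δ) : ∃ (r : ℕ) (G : (Fin r → κ) → ι),
      μ.real {x | f x ≠ G (itinerary T α r x)} ≤ Fintype.card ι * δ := by
  classical
  have := Measure.MeasureDense.of_generateFrom_isSetAlgebra_finite μ
    (isSetAlgebra_itinerarySets T α) hgen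
  have h : ∀ i, ∃ (r : ℕ) (S : Set (Fin r → κ)),
      μ.real (symmDiff (f ⁻¹' {i}) (itinerary T α r ⁻¹' S)) ≤ δ := by
    intro i
    obtain ⟨_, ⟨r, S, rfl⟩, h⟩ := this.approx _ (hf (measurableSet_singleton i))
      (measure_ne_top μ _) δ hδ
    exact ⟨r, S, ENNReal.toReal_le_of_le_ofReal hδ.le h.le⟩
  choose r S hS using h
  -- `f x₀` is an arbitrary label for itineraries lying in none of the approximating sets.
  obtain ⟨x₀⟩ := μ.nonempty_of_neZero
  set R := Finset.univ.sup r
  have hR : ∀ i, r i ≤ R := fun i => Finset.le_sup (Finset.mem_univ i)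
  refine ⟨R, fun w => if h : ∃ i, (fun j => w (Fin.castLE (hR i) j)) ∈ S i then h.choose
    else f x₀, ?_⟩
  calc μ.real _ ≤ μ.real (⋃ i ∈ (Finset.univ : Finset ι),
        symmDiff (f ⁻¹' {i}) (itinerary T α (r i) ⁻¹' S i)) := by
        refine measureReal_mono (fun x hx => ?_) (measure_ne_top μ _)
        by_contra hx'
        have h1 : ∀ i, itinerary T α (r i) x ∈ S i ↔ f x = i := by
          intro i
          have : x ∉ symmDiff (f ⁻¹' {i}) (itinerary T α (r i) ⁻¹' S i) := fun h =>
            hx' (mem_biUnion (Finset.mem_univ i) h)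
          simp only [mem_symmDiff, mem_preimage, mem_singleton_iff] at this
          tauto
        refine hx ?_
        have h2 : ∃ i, (fun j => itinerary T α R x (Fin.castLE (hR i) j)) ∈ S i :=
          ⟨f x, (h1 (f x)).2 rfl⟩
        refine Eq.trans ?_ (dif_pos h2).symm
        exact (h1 _).1 h2.choose_spec
    _ ≤ ∑ i, μ.real (symmDiff (f ⁻¹' {i}) (itinerary T α (r i) ⁻¹' S i)) :=
        measureReal_biUnion_finset_le _ _
    _ ≤ ∑ _i : ι, δ := Finset.sum_le_sum fun i _ => hS i
    _ = Fintype.card ι * δ := by simp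

lemma exists_condEntropy_le (hT : Measurable T) {α : X → κ} (hα : Measurable α)
    (hgen : m = MeasurableSpace.generateFrom (itinerarySets T α)) {f : X → ι} (hf : Measurable f)
    {ε : ℝ} (hε : 0 < ε) : ∃ r, condEntropy μ f (itinerary T α r) ≤ ε := by
  have h := fun n : ℕ => exists_measureReal_ne_le (μ := μ) hgen hf (Nat.one_div_pos_of_nat (n := n)
    (α := ℝ))
  choose r G hG using h
  have hlim : Tendsto (fun n => μ.real {x | f x ≠ G n (itinerary T α (r n) x)}) atTop (𝓝 0) := by
    refine squeeze_zero (fun _ => measureReal_nonneg) hG ?_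
    simpa using tendsto_one_div_add_atTop_nhds_zero_nat.const_mul (Fintype.card ι : ℝ)
  obtain ⟨n, hn⟩ := ((tendsto_condEntropy_zero hlim).eventually (Iic_mem_nhds hε)).exists
  exact ⟨r n, (condEntropy_le_condEntropy_comp hf (measurable_itinerary hT hα _)
    (measurable_of_finite _)).trans hn⟩

/-- The Kolmogorov–Sinai theorem: the entropy is bounded by the growth of a generator. -/
lemma ksEntropy_le_of_generator (hT : MeasurePreserving T μ μ) {α : X → κ} (hα : Measurable α)
    (hgen : m = MeasurableSpace.generateFrom (itinerarySets T α)) {C L : ℝ}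
    (h : ∀ n : ℕ, partitionEntropy μ (itinerary T α n) ≤ C + n * L) : ksEntropy μ T ≤ L := by
  refine iSup_le fun k => iSup_le fun f => iSup_le fun hf => ?_
  refine EReal.le_of_forall_lt_iff_le.1 fun z hz => ?_
  have hz : 0 < z - L := sub_pos.2 (by exact_mod_cast hz)
  obtain ⟨r, hr⟩ := exists_condEntropy_le hT.measurable hα hgen hf hz (μ := μ)
  -- With conditional entropy at most z - L, the n-fold join of `f` has entropy at most C + (n + r)
  -- L + n (z - L) = C + r L + n z.
  have hlim : Tendsto (fun n : ℕ => (((C + r * L) / n + z : ℝ) : EReal)) atTop (𝓝 (z : EReal)) := by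
    rw [EReal.tendsto_coe]
    simpa using (tendsto_const_div_atTop_nhds_zero_nat (C + r * L)).add_const z
  rw [← hlim.limsup_eq]
  refine limsup_le_limsup ?_
  filter_upwards [eventually_gt_atTop 0] with n hn
  have hn' : (0 : ℝ) < n := by exact_mod_cast hn
  have h1 := partitionEntropy_itinerary_le hT hf hα n r
  have h2 := h (n + r)
  have h3 := mul_le_mul_of_nonneg_left hr hn'.le
  push_cast at h2
  rw [EReal.coe_le_coe_iff, div_add' _ _ _ hn'.ne', div_le_div_iff_of_pos_right hn']
  linarith

end Generator

lemma entropyOfPartition_le_ksEntropy {X κ : Type*} [MeasurableSpace X] [Fintype κ]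
    [MeasurableSpace κ] [MeasurableSingletonClass κ] (μ : Measure X) (T : X → X) {α : X → κ}
    (hα : Measurable α) : entropyOfPartition μ T α ≤ ksEntropy μ T := by
  have h : entropyOfPartition μ T α = entropyOfPartition μ T (Fintype.equivFin κ ∘ α) := by
    rw [entropyOfPartition, entropyOfPartition]
    congr with n
    rw [← partitionEntropy_comp_of_injective μ (itinerary T α n)
      ((Fintype.equivFin κ).injective.comp_left (α := Fin n))]
    rfl
  rw [h]
  exact le_iSup₂_of_le (Fintype.card κ) (Fintype.equivFin κ ∘ α)
    (le_iSup_of_le ((measurable_of_finite _).comp hα) le_rfl)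

/-- Entropy does not increase under passage to a factor. -/
lemma ksEntropy_le_of_semiconj {X Y : Type*} [MeasurableSpace X] [MeasurableSpace Y]
    {μ : Measure X} {ν : Measure Y} {T : X → X} {S : Y → Y} {φ : X → Y}
    (hφ : MeasurePreserving φ μ ν) (hsemi : Function.Semiconj φ T S) (hS : Measurable S) :
    ksEntropy ν S ≤ ksEntropy μ T := by
  refine iSup_le fun k => iSup_le fun f => iSup_le fun hf => ?_
  refine le_trans (le_of_eq ?_) (entropyOfPartition_le_ksEntropy μ T (hf.comp hφ.measurable))
  rw [entropyOfPartition, entropyOfPartition]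
  congr with n
  rw [← partitionEntropy_comp_measurePreserving hφ (measurable_itinerary hS hf n)]
  congr 3 with x i
  simp only [itinerary, Function.comp_apply, (hsemi.iterate_right i).eq]

/-! ## Entropy of shift-invariant measures -/

/-- The first letter of an admissible word. -/
def firstLetter {d : ℕ} (ω : ShiftSpace d) : Letter d := ω.1 0

lemma measurable_firstLetter {d : ℕ} : Measurable (firstLetter (d := d)) := measurable_coord 0

lemma itinerary_firstLetter {d : ℕ} (n : ℕ) (ω : ShiftSpace d) (i : Fin n) :
    itinerary shift firstLetter n ω i = ω.1 i := by
  simp [itinerary, firstLetter, shift_iterate_apply]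

lemma itinerary_preimage_eq_cylinder {d : ℕ} (n : ℕ) (ω : ShiftSpace d) :
    itinerary shift firstLetter n ⁻¹' {itinerary shift firstLetter n ω} = cylinder ω n := by
  ext η
  simp only [mem_preimage, mem_singleton_iff, funext_iff, itinerary_firstLetter]
  exact ⟨fun h k hk => h ⟨k, hk⟩, fun h i => h i i.2⟩

lemma borel_eq_generateFrom_itinerarySets (d : ℕ) :
    borel (ShiftSpace d) = MeasurableSpace.generateFrom (itinerarySets shift firstLetter) := by
  refine le_antisymm ?_ ?_
  · rw [generateFrom_cylinder]
    refine MeasurableSpace.generateFrom_mono ?_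
    rintro _ ⟨ω, n, rfl⟩
    exact ⟨n, _, (itinerary_preimage_eq_cylinder n ω).symm⟩
  · refine MeasurableSpace.generateFrom_le ?_
    rintro _ ⟨n, S, rfl⟩
    exact measurable_itinerary continuous_shift.measurable measurable_firstLetter n
      S.toFinite.measurableSet

/-- The tangent inequality at the common value P / card, with P the total: entropy of given total
mass is maximal for equal masses. -/
lemma sum_negMulLog_le_card {ι : Type*} (s : Finset ι) (hs : s.Nonempty) {p : ι → ℝ}
    (hp : ∀ i, 0 ≤ p i) : ∑ i ∈ s, Real.negMulLog (p i)
      ≤ Real.negMulLog (∑ i ∈ s, p i) + (∑ i ∈ s, p i) * Real.log s.card := by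
  rcases (Finset.sum_nonneg fun i _ => hp i : 0 ≤ ∑ i ∈ s, p i).eq_or_lt with h | h
  · have := (Finset.sum_eq_zero_iff_of_nonneg fun i _ => hp i).1 h.symm
    rw [← h, Finset.sum_eq_zero fun i hi => by rw [this i hi, Real.negMulLog_zero]]
    simp
  set P := ∑ i ∈ s, p i with hP
  have hc : (0 : ℝ) < s.card := by exact_mod_cast hs.card_pos
  have := Finset.sum_le_sum fun i (_ : i ∈ s) => negMulLog_le (hp i) (div_pos h hc)
  simp only [Finset.sum_sub_distrib, Finset.sum_add_distrib, ← Finset.sum_mul,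
    Finset.sum_neg_distrib, ← hP, Finset.sum_const, nsmul_eq_mul, mul_div_cancel₀ _ hc.ne',
    Real.log_div h.ne' hc.ne'] at this
  rw [Real.negMulLog]
  linarith

/-- The tangent inequality is strict at the deviating index. This is the source of uniqueness of the
measure of maximal entropy. -/
lemma sum_negMulLog_lt_card {ι : Type*} (s : Finset ι) {p : ι → ℝ}
    (hp : ∀ i, 0 ≤ p i) {j : ι} (hj : j ∈ s) (h : p j ≠ (∑ i ∈ s, p i) / s.card) :
    ∑ i ∈ s, Real.negMulLog (p i)
      < Real.negMulLog (∑ i ∈ s, p i) + (∑ i ∈ s, p i) * Real.log s.card := by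
  have hc : (0 : ℝ) < s.card := by exact_mod_cast Finset.card_pos.2 ⟨j, hj⟩
  rcases (Finset.sum_nonneg fun i _ => hp i : 0 ≤ ∑ i ∈ s, p i).eq_or_lt with h0 | h0
  · have := (Finset.sum_eq_zero_iff_of_nonneg fun i _ => hp i).1 h0.symm
    rw [← h0, this j hj, zero_div] at h
    exact absurd rfl h
  set P := ∑ i ∈ s, p i with hP
  have := Finset.sum_lt_sum (fun i (_ : i ∈ s) => negMulLog_le (hp i) (div_pos h0 hc))
    ⟨j, hj, negMulLog_lt (hp j) (div_pos h0 hc) h⟩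
  simp only [Finset.sum_sub_distrib, Finset.sum_add_distrib, ← Finset.sum_mul,
    Finset.sum_neg_distrib, ← hP, Finset.sum_const, nsmul_eq_mul, mul_div_cancel₀ _ hc.ne',
    Real.log_div h0.ne' hc.ne'] at this
  rw [Real.negMulLog]
  linarith

section Invariant

variable {d : ℕ} {m : Measure (ShiftSpace d)} [IsProbabilityMeasure m]

/-- Mass of the cylinder given by a finite word. -/
def wordMass {d : ℕ} (m : Measure (ShiftSpace d)) (n : ℕ) (w : Fin n → Letter d) : ℝ :=
  m.real (itinerary shift firstLetter n ⁻¹' {w})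

/-- Entropy of the partition into cylinders of rank `n`. -/
def wordEntropy {d : ℕ} (m : Measure (ShiftSpace d)) (n : ℕ) : ℝ :=
  partitionEntropy m (itinerary shift firstLetter n)

lemma measurable_words {d : ℕ} (n : ℕ) : Measurable (itinerary (shift (d := d)) firstLetter n) :=
  measurable_itinerary continuous_shift.measurable measurable_firstLetter n

lemma preimage_snoc {d n : ℕ} (w : Fin n → Letter d) (b : Letter d) :
    itinerary shift firstLetter (n + 1) ⁻¹' {Fin.snoc w b}
      = itinerary shift firstLetter n ⁻¹' {w} ∩ (fun ω => ω.1 n) ⁻¹' {b} := by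
  ext ω
  simp only [mem_preimage, mem_singleton_iff, mem_inter_iff, funext_iff, Fin.forall_fin_succ',
    Fin.snoc_castSucc, Fin.snoc_last, itinerary_firstLetter, Fin.val_castSucc, Fin.val_last]

lemma sum_wordMass_snoc {n : ℕ} (w : Fin n → Letter d) :
    ∑ b, wordMass m (n + 1) (Fin.snoc w b) = wordMass m n w := by
  simp only [wordMass, preimage_snoc]
  rw [← measureReal_biUnion_finset]
  · congr 1
    ext ω
    simp
  · intro b _ b' _ hb
    exact ((Disjoint.preimage _ (by simpa using hb)).mono inter_subset_right inter_subset_right)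
  · exact fun b _ => (measurable_words n (measurableSet_singleton w)).inter
      (measurable_coord n (measurableSet_singleton b))

lemma wordMass_snoc_neg {d : ℕ} {m : Measure (ShiftSpace d)} {n : ℕ} (w : Fin (n + 1) → Letter d) :
    wordMass m (n + 2) (Fin.snoc w (w (Fin.last n)).neg) = 0 := by
  rw [wordMass, preimage_snoc]
  convert measureReal_empty
  ext ω
  simp only [mem_inter_iff, mem_preimage, mem_singleton_iff, mem_empty_iff_false, iff_false,
    not_and]
  rintro rfl h
  rw [itinerary_firstLetter] at h
  exact ω.ne_neg n h

lemma sum_filter_wordMass_snoc {n : ℕ} (w : Fin (n + 1) → Letter d) :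
    ∑ b ∈ Finset.univ.filter (· ≠ (w (Fin.last n)).neg), wordMass m (n + 2) (Fin.snoc w b)
      = wordMass m (n + 1) w := by
  rw [← sum_wordMass_snoc w, Finset.sum_filter]
  refine Finset.sum_congr rfl fun b _ => ?_
  split_ifs with h
  · rfl
  · rw [not_not.1 h, wordMass_snoc_neg]

lemma wordEntropy_add_two {d : ℕ} {m : Measure (ShiftSpace d)} {n : ℕ} : wordEntropy m (n + 2)
    = ∑ w : Fin (n + 1) → Letter d, ∑ b ∈ Finset.univ.filter (· ≠ (w (Fin.last n)).neg),
        Real.negMulLog (wordMass m (n + 2) (Fin.snoc w b)) := by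
  have h : ∀ w : Fin (n + 1) → Letter d,
      ∑ b ∈ Finset.univ.filter (· ≠ (w (Fin.last n)).neg),
        Real.negMulLog (wordMass m (n + 2) (Fin.snoc w b))
      = ∑ b, Real.negMulLog (wordMass m (n + 2) (Fin.snoc w b)) := by
    intro w
    rw [Finset.sum_filter]
    refine Finset.sum_congr rfl fun b _ => ?_
    split_ifs with h
    · rfl
    · rw [not_not.1 h, wordMass_snoc_neg, Real.negMulLog_zero]
  simp only [h]
  rw [← Fintype.sum_prod_type', wordEntropy, partitionEntropy]
  refine Fintype.sum_equiv ((Fin.snocEquiv fun _ => Letter d).symm.trans (Equiv.prodComm _ _)) _ _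
    fun w => ?_
  simp [wordMass, Fin.snocEquiv, Fin.snoc_init_self]

lemma sum_wordMass (n : ℕ) : ∑ w, wordMass m n w = 1 := by
  simp only [wordMass]
  rw [← measureReal_biUnion_finset]
  · rw [show (⋃ w ∈ Finset.univ, itinerary shift firstLetter n ⁻¹' {w})
      = (univ : Set (ShiftSpace d)) by ext; simp]
    simp
  · intro b _ b' _ hb
    exact Disjoint.preimage _ (by simpa using hb)
  · exact fun w _ => measurable_words n (measurableSet_singleton w)

/-- Every nonempty word has 2d - 1 admissible continuations, so its mass splits with entropy gain at
most mass times log (2d - 1). -/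
lemma wordEntropy_add_two_le (hd : 2 ≤ d) (n : ℕ) :
    wordEntropy m (n + 2) ≤ wordEntropy m (n + 1) + Real.log (2 * d - 1) := by
  calc wordEntropy m (n + 2) ≤ ∑ w : Fin (n + 1) → Letter d,
        (Real.negMulLog (wordMass m (n + 1) w)
          + wordMass m (n + 1) w * Real.log (2 * d - 1)) := by
        rw [wordEntropy_add_two]
        refine Finset.sum_le_sum fun w _ => ?_
        have := sum_negMulLog_le_card (Finset.univ.filter (· ≠ (w (Fin.last n)).neg))
          (Finset.card_pos.1 (by rw [card_filter_ne]; omega))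
          (p := fun b => wordMass m (n + 2) (Fin.snoc w b)) fun b => measureReal_nonneg
        rwa [sum_filter_wordMass_snoc, card_filter_ne, cast_two_mul_sub_one hd] at this
    _ = _ := by
        rw [Finset.sum_add_distrib, ← Finset.sum_mul, sum_wordMass, one_mul]
        rfl

/-- A single word with unequally distributed continuations makes the whole increment strictly
smaller. -/
lemma wordEntropy_add_two_lt (hd : 2 ≤ d) {n : ℕ} {w : Fin (n + 1) → Letter d} {b : Letter d}
    (hb : b ≠ (w (Fin.last n)).neg)
    (h : wordMass m (n + 2) (Fin.snoc w b) ≠ wordMass m (n + 1) w / (2 * d - 1)) :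
    wordEntropy m (n + 2) < wordEntropy m (n + 1) + Real.log (2 * d - 1) := by
  calc wordEntropy m (n + 2) < ∑ w : Fin (n + 1) → Letter d,
        (Real.negMulLog (wordMass m (n + 1) w)
          + wordMass m (n + 1) w * Real.log (2 * d - 1)) := by
        rw [wordEntropy_add_two]
        refine Finset.sum_lt_sum (fun w _ => ?_) ⟨w, Finset.mem_univ _, ?_⟩
        · have := sum_negMulLog_le_card (Finset.univ.filter (· ≠ (w (Fin.last n)).neg))
            (Finset.card_pos.1 (by rw [card_filter_ne]; omega))
            (p := fun b => wordMass m (n + 2) (Fin.snoc w b)) fun b => measureReal_nonneg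
          rwa [sum_filter_wordMass_snoc, card_filter_ne, cast_two_mul_sub_one hd] at this
        · have := sum_negMulLog_lt_card (Finset.univ.filter (· ≠ (w (Fin.last n)).neg))
            (p := fun b => wordMass m (n + 2) (Fin.snoc w b)) (fun b => measureReal_nonneg)
            (j := b) (by simpa using hb)
            (by rwa [sum_filter_wordMass_snoc, card_filter_ne, cast_two_mul_sub_one hd])
          rwa [sum_filter_wordMass_snoc, card_filter_ne, cast_two_mul_sub_one hd] at this
    _ = _ := by
        rw [Finset.sum_add_distrib, ← Finset.sum_mul, sum_wordMass, one_mul]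
        rfl

lemma wordEntropy_le_succ (n : ℕ) : wordEntropy m n ≤ wordEntropy m (n + 1) :=
  partitionEntropy_comp_le (measurable_words (n + 1)) fun w : Fin (n + 1) → Letter d =>
    fun i : Fin n => w i.castSucc

/-- The entropy increments of an invariant measure are antitone. -/
lemma wordEntropy_concave (hm : MeasurePreserving shift m m) (n : ℕ) :
    wordEntropy m (n + 2) + wordEntropy m n ≤ wordEntropy m (n + 1) + wordEntropy m (n + 1) := by
  -- Strong subadditivity for letter 0, the block of letters 1 to n, and letter n + 1. Invariance
  -- identifies the entropies of shifted blocks.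
  have h := partitionEntropy_strong_subadditive (μ := m) measurable_firstLetter
    (g := fun ω => itinerary shift firstLetter n (shift ω)) (k := fun ω => ω.1 (n + 1))
    ((measurable_words n).comp continuous_shift.measurable) (measurable_coord (n + 1))
  have e0 : partitionEntropy m (fun ω => itinerary shift firstLetter n (shift ω))
      = wordEntropy m n := partitionEntropy_comp_measurePreserving hm (measurable_words n)
  have e1 : partitionEntropy m
      (fun ω => (firstLetter ω, itinerary shift firstLetter n (shift ω))) = wordEntropy m (n + 1) :=
    partitionEntropy_comp_of_injective m (itinerary shift firstLetter (n + 1))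
      (e := fun w => (w 0, fun i : Fin n => w i.succ)) fun w w' h => by
        simp only [Prod.mk.injEq] at h
        exact funext (Fin.cases h.1 (congrFun h.2))
  have e2 : partitionEntropy m
      (fun ω => (itinerary shift firstLetter n (shift ω), ω.1 (n + 1))) = wordEntropy m (n + 1) := by
    rw [wordEntropy, ← partitionEntropy_comp_measurePreserving hm (measurable_words (n + 1)),
      ← partitionEntropy_comp_of_injective m
        (fun ω => itinerary shift firstLetter (n + 1) (shift ω))
        (e := fun w => (fun i : Fin n => w i.castSucc, w (Fin.last n))) fun w w' h => by
          simp only [Prod.mk.injEq] at h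
          exact funext (Fin.lastCases h.2 (congrFun h.1))]
    congr with ω : 1
    refine Prod.ext rfl ?_
    simp only [itinerary_firstLetter]
    rfl
  have e3 : partitionEntropy m (fun ω => (firstLetter ω,
      itinerary shift firstLetter n (shift ω), ω.1 (n + 1))) = wordEntropy m (n + 2) := by
    rw [wordEntropy, ← partitionEntropy_comp_of_injective m (itinerary shift firstLetter (n + 2))
        (e := fun w => (w 0, fun i : Fin n => w i.succ.castSucc, w (Fin.last (n + 1))))
        fun w w' h => by
          simp only [Prod.mk.injEq] at h
          exact funext (Fin.lastCases h.2.2 (Fin.cases h.1 (congrFun h.2.1)))]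
    congr with ω : 1
    refine Prod.ext rfl (Prod.ext (funext fun i => ?_) ?_) <;>
    simp only [itinerary_firstLetter] <;> rfl
  rw [e0, e1, e2, e3] at h
  linarith

/-- Increments decrease, so from rank n + 1 on the growth is at most linear with slope the increment
there; lower ranks are covered by monotonicity. -/
lemma wordEntropy_le_linear (hm : MeasurePreserving shift m m) (n k : ℕ) :
    wordEntropy m k ≤ wordEntropy m (n + 1) + k * (wordEntropy m (n + 2) - wordEntropy m (n + 1)) := by
  set L := wordEntropy m (n + 2) - wordEntropy m (n + 1) with hL
  have hL0 : 0 ≤ L := sub_nonneg.2 (wordEntropy_le_succ _)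
  have hinc : ∀ j, wordEntropy m (n + 1 + j + 1) - wordEntropy m (n + 1 + j) ≤ L := by
    intro j
    induction j with
    | zero => exact le_rfl
    | succ j ih =>
      have := wordEntropy_concave hm (n + 1 + j)
      rw [show n + 1 + j + 2 = n + 1 + (j + 1) + 1 by ring] at this
      rw [show n + 1 + (j + 1) = n + 1 + j + 1 by ring] at this ⊢
      linarith
  rcases le_total k (n + 1) with h | h
  · have := monotone_nat_of_le_succ (wordEntropy_le_succ (m := m)) h
    have : 0 ≤ k * L := by positivity
    linarith
  · obtain ⟨j, rfl⟩ := Nat.exists_eq_add_of_le h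
    have : wordEntropy m (n + 1 + j) ≤ wordEntropy m (n + 1) + j * L := by
      clear h
      induction j with
      | zero => simp
      | succ j ih =>
        have := hinc j
        push_cast
        rw [← add_assoc]
        linarith
    have h2 : (j : ℝ) * L ≤ ((n + 1 + j : ℕ) : ℝ) * L := by
      refine mul_le_mul_of_nonneg_right ?_ hL0
      push_cast
      linarith [Nat.cast_nonneg (α := ℝ) n]
    linarith

/-- First letters form a generator, so any single increment bounds the entropy. A deficit at one
rank therefore already prevents maximality. -/
lemma ksEntropy_shift_le_increment (hm : MeasurePreserving shift m m) (n : ℕ) :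
    ksEntropy m shift ≤ ((wordEntropy m (n + 2) - wordEntropy m (n + 1) : ℝ) : EReal) :=
  ksEntropy_le_of_generator hm measurable_firstLetter (borel_eq_generateFrom_itinerarySets d)
    (wordEntropy_le_linear hm n)

lemma ksEntropy_shift_le (hd : 2 ≤ d) (hm : MeasurePreserving shift m m) :
    ksEntropy m shift ≤ (Real.log (2 * d - 1) : EReal) := by
  refine (ksEntropy_shift_le_increment hm 0).trans (EReal.coe_le_coe_iff.2 ?_)
  have := wordEntropy_add_two_le (m := m) hd 0
  linarith

/-- The Parry measure is the only shift-invariant measure with entropy at least `log (2d-1)`. -/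
theorem isParryMeasure_of_le_ksEntropy (hd : 2 ≤ d) (hm : MeasurePreserving shift m m)
    (h : (Real.log (2 * d - 1) : EReal) ≤ ksEntropy m shift) : IsParryMeasure m := by
  have hN := three_le_cast hd
  -- A word with an unequal continuation would give an increment, hence an entropy, below log (2d -
  -- 1).
  have hcond : ∀ (n : ℕ) (w : Fin (n + 1) → Letter d) (b : Letter d), b ≠ (w (Fin.last n)).neg →
      wordMass m (n + 2) (Fin.snoc w b) = wordMass m (n + 1) w / (2 * d - 1) := by
    intro n w b hb
    by_contra hne
    have h1 := EReal.coe_le_coe_iff.1 (h.trans (ksEntropy_shift_le_increment hm n))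
    have h2 := wordEntropy_add_two_lt hd hb hne
    linarith
  have hcyl : ∀ (ω : ShiftSpace d) n, m.real (cylinder ω (n + 2))
      = m.real (cylinder ω (n + 1)) / (2 * d - 1) := by
    intro ω n
    rw [← itinerary_preimage_eq_cylinder, ← itinerary_preimage_eq_cylinder]
    have := hcond n (itinerary shift firstLetter (n + 1) ω) (ω.1 (n + 1)) (by
      rw [itinerary_firstLetter]; exact ω.ne_neg n)
    rw [← wordMass, ← wordMass, ← this]
    congr 1
    refine funext (Fin.lastCases ?_ fun i => ?_)
    · rw [Fin.snoc_last, itinerary_firstLetter]; rfl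
    · rw [Fin.snoc_castSucc, itinerary_firstLetter, itinerary_firstLetter]; rfl
  set u : Letter d → ℝ := fun a => m.real {ω : ShiftSpace d | ω.1 0 = a} with hu
  have hpair : ∀ a b : Letter d, b ≠ a.neg →
      m.real {ω : ShiftSpace d | ω.1 0 = a ∧ ω.1 1 = b} = u a / (2 * d - 1) := by
    intro a b hb
    have := hcond 0 (fun _ => a) b hb
    rw [wordMass, wordMass, preimage_snoc] at this
    have e : itinerary (shift (d := d)) firstLetter (0 + 1) ⁻¹' {fun _ => a} = {ω | ω.1 0 = a} := by
      ext ω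
      simp [funext_iff, itinerary_firstLetter]
    rw [e] at this
    exact this
  have hpair0 : ∀ b : Letter d, m.real {ω : ShiftSpace d | ω.1 0 = b.neg ∧ ω.1 1 = b} = 0 := by
    intro b
    convert measureReal_empty
    refine eq_empty_of_forall_notMem fun ω hω => ω.ne_neg 0 ?_
    rw [hω.1, Letter.neg_neg]
    exact hω.2
  have hsum1 : ∑ a, u a = 1 := by
    simp only [hu]
    rw [← measureReal_biUnion_finset]
    · rw [show (⋃ a ∈ Finset.univ, {ω : ShiftSpace d | ω.1 0 = a}) = univ by ext; simp]
      simp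
    · intro a _ b _ hab
      exact disjoint_left.2 fun ω h1 h2 => hab (h1.symm.trans h2)
    · exact fun a _ => measurable_coord 0 (measurableSet_singleton a)
  -- By stationarity the mass of b as second letter is its mass as first letter, and each first
  -- letter other than -b passes on the fraction 1 / (2d - 1).
  have hstat : ∀ b, u b = (1 - u b.neg) / (2 * d - 1) := by
    intro b
    have h1 : u b = m.real {ω : ShiftSpace d | ω.1 1 = b} :=
      (hm.measureReal_preimage
        (measurable_coord 0 (measurableSet_singleton b)).nullMeasurableSet).symm
    have h2 : m.real {ω : ShiftSpace d | ω.1 1 = b}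
        = ∑ a, m.real {ω : ShiftSpace d | ω.1 0 = a ∧ ω.1 1 = b} := by
      rw [← measureReal_biUnion_finset]
      · congr 1; ext; simp
      · intro a _ b _ hab
        exact disjoint_left.2 fun ω h1 h2 => hab (h1.1.symm.trans h2.1)
      · exact fun a _ => (measurable_coord 0 (measurableSet_singleton a)).inter
          (measurable_coord 1 (measurableSet_singleton b))
    have h3 : 1 - u b.neg = ∑ a ∈ Finset.univ.erase b.neg, u a := by
      rw [← hsum1, ← Finset.add_sum_erase _ u (Finset.mem_univ b.neg), add_sub_cancel_left]
    rw [h1, h2, ← Finset.add_sum_erase _ _ (Finset.mem_univ b.neg), hpair0, zero_add, h3,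
      Finset.sum_div]
    refine Finset.sum_congr rfl fun a ha => hpair a b ?_
    exact ne_neg_comm.1 (Finset.ne_of_mem_erase ha)
  -- Subtracting the equations for b and -b gives (u b - u (-b)) (2d - 2) = 0, so both masses agree
  -- and then equal 1 / (2d).
  have hu1 : ∀ b, u b = 1 / (2 * d) := by
    intro b
    have h1 := hstat b
    have h2 := hstat b.neg
    rw [Letter.neg_neg] at h2
    rw [eq_div_iff (by linarith)] at h1 h2
    have h3 : (u b - u b.neg) * (2 * d - 2) = 0 := by linarith
    have h4 : u b = u b.neg := by
      rcases mul_eq_zero.1 h3 with h | h <;> linarith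
    rw [eq_div_iff (by linarith)]
    rw [← h4] at h1
    linarith
  refine ⟨inferInstance, fun ω n => ?_⟩
  rw [← ofReal_measureReal]
  congr 1
  induction n with
  | zero =>
    rw [pow_zero, mul_one, ← hu1 (ω.1 0)]
    congr 1
    ext η
    simp [cylinder]
  | succ n ih =>
    rw [hcyl, ih, pow_succ]
    field_simp

end Invariant

/-! ## Topological entropy of the Bowen–Series map -/

lemma circleToDisc_coding_eq_wordAct {d : ℕ} (hd : 2 ≤ d) (ω : ShiftSpace d) (n : ℕ) :
    circleToDisc (coding hd ω)
      = wordAct hd (inversePrefix ω n) (circleToDisc (coding hd (shift^[n] ω))) := by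
  induction n with
  | zero => simp [inversePrefix]
  | succ n ih =>
    rw [ih, inversePrefix_succ, wordAct_append, Function.iterate_succ_apply', wordAct_cons,
      wordAct_nil, circleToDisc_coding, circleToDisc_coding, discCoding_eq_piece,
      shift_iterate_apply, zero_add]

/-- Points whose itineraries agree for a long time are close together. -/
lemma exists_dist_coding_lt {d : ℕ} (hd : 2 ≤ d) {ε : ℝ} (hε : 0 < ε) :
    ∃ k, ∀ ω η : ShiftSpace d, (∀ i < k, ω.1 i = η.1 i) →
      dist (coding hd ω) (coding hd η) < ε := by
  obtain ⟨N, hN⟩ := exists_length_dist_wordAct_lt hd hε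
  -- N common letters give the same contracting prefix; one more puts both remaining tails into the
  -- same half disc, on which the prefix contracts.
  refine ⟨N + 1, fun ω η h => ?_⟩
  have hp : inversePrefix η N = inversePrefix ω N :=
    List.map_congr_left fun i hi => by rw [h i (by have := List.mem_range.1 hi; omega)]
  change dist (circleToDisc (coding hd ω)) (circleToDisc (coding hd η)) < ε
  rw [circleToDisc_coding_eq_wordAct hd ω N, circleToDisc_coding_eq_wordAct hd η N, hp]
  have hmem : ∀ ζ : ShiftSpace d, ζ.1 N = ω.1 N →
      circleToDisc (coding hd (shift^[N] ζ)) ∈ wordDomain (inversePrefix ω N) := by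
    intro ζ hζ
    refine halfDisc_subset_wordDomain hd ω N ((circleToDisc_mem_halfDisc hd).2 ?_)
    have := coding_mem_arc hd (shift^[N] ζ)
    rwa [shift_iterate_apply, zero_add, hζ] at this
  exact hN _ (isReduced_inversePrefix ω N) (length_inversePrefix ω N).ge _ (hmem ω rfl) _
    (hmem η (h N (by omega)).symm)

/-- The finite set of admissible words of length `n`. -/
def words (d n : ℕ) : Finset (Fin n → Letter d) :=
  (range (itinerary (shift (d := d)) firstLetter n)).toFinite.toFinset

lemma mem_words {d n : ℕ} {w : Fin n → Letter d} :
    w ∈ words d n ↔ ∃ ω, itinerary shift firstLetter n ω = w := by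
  simp [words]

lemma IsParryMeasure.wordMass_eq {d : ℕ} (hd : 2 ≤ d) {P : Measure (ShiftSpace d)}
    (hP : IsParryMeasure P) {n : ℕ} {w : Fin n → Letter d} (hw : w ∈ words d n) :
    wordMass P n w = (sphereCard d n : ℝ)⁻¹ := by
  obtain ⟨ω, rfl⟩ := mem_words.1 hw
  rw [wordMass, itinerary_preimage_eq_cylinder, measureReal_def, hP.measure_cylinder_eq_inv hd]
  simp

lemma wordMass_eq_zero {d : ℕ} (P : Measure (ShiftSpace d)) {n : ℕ} {w : Fin n → Letter d}
    (hw : w ∉ words d n) : wordMass P n w = 0 := by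
  rw [wordMass]
  convert measureReal_empty
  exact eq_empty_of_forall_notMem fun ω hω => hw (mem_words.2 ⟨ω, hω⟩)

/-- The Parry measure is uniform on admissible words and has total mass 1, so the common mass counts
them. -/
lemma card_words {d : ℕ} (hd : 2 ≤ d) (n : ℕ) : (words d n).card = sphereCard d n := by
  obtain ⟨P, hP⟩ := exists_isParryMeasure hd
  have := hP.isProbabilityMeasure
  have h := sum_wordMass (m := P) n
  rw [← Finset.sum_subset (Finset.subset_univ (words d n)) fun w _ hw => wordMass_eq_zero P hw,
    Finset.sum_congr rfl fun w hw => hP.wordMass_eq hd hw, Finset.sum_const, nsmul_eq_mul,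
    mul_inv_eq_one₀ (by exact_mod_cast (sphereCard_pos hd n).ne')] at h
  exact_mod_cast h

lemma IsParryMeasure.wordEntropy_eq {d : ℕ} (hd : 2 ≤ d) {P : Measure (ShiftSpace d)}
    (hP : IsParryMeasure P) (n : ℕ) : wordEntropy P n = Real.log (sphereCard d n) := by
  have h : ∀ w, Real.negMulLog (wordMass P n w) = wordMass P n w * Real.log (sphereCard d n) := by
    intro w
    by_cases hw : w ∈ words d n
    · rw [hP.wordMass_eq hd hw, Real.negMulLog, Real.log_inv]; ring
    · rw [wordMass_eq_zero P hw]; simp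
  have := hP.isProbabilityMeasure
  calc wordEntropy P n = ∑ w, Real.negMulLog (wordMass P n w) := rfl
    _ = _ := by simp only [h]; rw [← Finset.sum_mul, sum_wordMass, one_mul]

lemma pow_le_sphereCard {d : ℕ} (hd : 2 ≤ d) (n : ℕ) : (2 * d - 1) ^ n ≤ sphereCard d n := by
  cases n with
  | zero => simp [sphereCard]
  | succ n =>
    rw [pow_succ', sphereCard]
    exact Nat.mul_le_mul_right _ (by omega)

lemma sphereCard_le {d : ℕ} (hd : 2 ≤ d) (n : ℕ) : sphereCard d n ≤ 2 * (2 * d - 1) ^ n := by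
  cases n with
  | zero => simp [sphereCard]
  | succ n =>
    rw [pow_succ', sphereCard, ← mul_assoc]
    exact Nat.mul_le_mul_right _ (by omega)

/-- One point is chosen for each word of length n + k. A point with that itinerary shares k letters
with it at every time before n, so their iterates stay ε-close. -/
lemma coverMincard_le {d : ℕ} (hd : 2 ≤ d) {ε : ℝ} (hε : 0 < ε) : ∃ k, ∀ n,
    Dynamics.coverMincard (bowenSeries hd) univ {p : Circle × Circle | dist p.1 p.2 < ε} n
      ≤ sphereCard d (n + k) := by
  obtain ⟨k, hk⟩ := exists_dist_coding_lt hd hε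
  refine ⟨k, fun n => ?_⟩
  classical
  have hrep : ∀ w : Fin (n + k) → Letter d, ∃ x : Circle, w ∈ words d (n + k) →
      ∃ ω, itinerary shift firstLetter (n + k) ω = w ∧ coding hd ω = x := by
    intro w
    by_cases h : w ∈ words d (n + k)
    · obtain ⟨ω, hω⟩ := mem_words.1 h
      exact ⟨coding hd ω, fun _ => ⟨ω, hω, rfl⟩⟩
    · exact ⟨1, fun h' => absurd h' h⟩
  choose r hr using hrep
  have hcov : Dynamics.IsDynCoverOf (bowenSeries hd) univ
      {p : Circle × Circle | dist p.1 p.2 < ε} n ((words d (n + k)).image r : Finset Circle) := by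
    intro x _
    have hw : itinerary shift firstLetter (n + k) (ccwItinerary hd x) ∈ words d (n + k) :=
      mem_words.2 ⟨_, rfl⟩
    obtain ⟨ω, hω, hx⟩ := hr _ hw
    refine ⟨r _, Finset.mem_coe.2 (Finset.mem_image_of_mem r hw),
      Dynamics.mem_dynEntourage.2 fun j hj => ?_⟩
    have e1 : x = coding hd (ccwItinerary hd x) := (coding_ccwItinerary hd x).symm
    rw [← hx]
    nth_rewrite 1 [e1]
    rw [← (semiconj_coding hd).iterate_right j, ← (semiconj_coding hd).iterate_right j]
    refine hk _ _ fun i hi => ?_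
    rw [shift_iterate_apply, shift_iterate_apply]
    have := congrFun hω ⟨i + j, by omega⟩
    rw [itinerary_firstLetter, itinerary_firstLetter] at this
    exact this.symm
  refine hcov.coverMincard_le_card.trans ?_
  rw [← card_words hd]
  exact_mod_cast Finset.card_image_le

lemma ennrealLog_natCast (n : ℕ) (hn : n ≠ 0) :
    ENNReal.log (n : ℝ≥0∞) = (Real.log n : EReal) := by
  rw [ENNReal.log_pos_real (by simpa using hn) (by simp)]
  simp

lemma uniformity_circle_basis : (uniformity Circle).HasBasis (fun ε : ℝ => 0 < ε)
    fun ε => {p : Circle × Circle | dist p.1 p.2 < ε} := Metric.uniformity_basis_dist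

lemma coverEntropy_bowenSeries_le {d : ℕ} (hd : 2 ≤ d) :
    Dynamics.coverEntropy (bowenSeries hd) univ ≤ (Real.log (2 * d - 1) : EReal) := by
  rw [Dynamics.coverEntropy_eq_iSup_basis uniformity_circle_basis]
  refine iSup₂_le fun ε hε => ?_
  obtain ⟨k, hk⟩ := coverMincard_le hd hε
  rw [← cast_two_mul_sub_one hd, ← ennrealLog_natCast _ (by omega), ← ExpGrowth.expGrowthSup_pow]
  refine ExpGrowth.expGrowthSup_le_of_eventually_le (b := 2 * ((2 * d - 1 : ℕ) : ℝ≥0∞) ^ k)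
    (ENNReal.mul_ne_top (by simp) (ENNReal.pow_ne_top (ENNReal.natCast_ne_top _)))
    (Eventually.of_forall fun n => ?_)
  refine (ENat.toENNReal_mono (hk n)).trans ?_
  have := sphereCard_le hd (n + k)
  rw [pow_add] at this
  rw [ENat.toENNReal_coe]
  calc ((sphereCard d (n + k) : ℕ) : ℝ≥0∞) ≤ ((2 * ((2 * d - 1) ^ n * (2 * d - 1) ^ k) : ℕ) : ℝ≥0∞) := by
        exact_mod_cast this
    _ = _ := by push_cast; ring

/-! ### Lower bound for the topological entropy: separated preimages -/

lemma bowenSeries_mem_arc_neg {d : ℕ} (hd : 2 ≤ d) {a b : Letter d} (hab : a ≠ b) {x : Circle}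
    (ha : x ∈ arc a) (hb : x ∈ arc b) :
    bowenSeries hd x ∈ arc a.neg ∧ bowenSeries hd x ∈ arc b.neg := by
  have key : ∀ {a b : Letter d}, a ≠ b → x ∈ arc a → x ∈ arc b →
      bowenSeries hd x ∈ arc a.neg := by
    intro a b hab ha hb
    rw [mem_arc_iff hd] at hb
    have h := (dist_center_eq_and_eq_midpoint hd hab ((mem_arc_iff hd _ _).1 ha) hb).1
    rw [← circleToDisc_mem_halfDisc hd, circleToDisc_bowenSeries hd ha]
    exact piece_mem_halfDisc hd h.ge
  exact ⟨key hab ha hb, key hab.symm hb ha⟩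

/-- Distinct arcs contain no common point whose image lies in an admissible third arc. -/
lemma eq_of_mem_arc_of_bowenSeries_mem {d : ℕ} (hd : 2 ≤ d) {a b c : Letter d} (ha : c ≠ a.neg)
    (hb : c ≠ b.neg) {x : Circle} (hxa : x ∈ arc a) (hxb : x ∈ arc b)
    (hc : bowenSeries hd x ∈ arc c) : a = b := by
  by_contra hab
  obtain ⟨h1, h2⟩ := bowenSeries_mem_arc_neg hd hab hxa hxb
  rw [mem_arc_iff hd] at h1 h2 hc
  exact hab (Letter.neg_injective (eq_of_mem_three hd ha hb hc h1 h2))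

/-- Distinct points with the same image have different labels a, b, as each piece is injective, and
their image lies in an arc c that may follow both. The set of pairs of this kind is compact and, by
`eq_of_mem_arc_of_bowenSeries_mem`, misses the diagonal. -/
lemma exists_pos_le_dist {d : ℕ} (hd : 2 ≤ d) : ∃ ε > 0, ∀ x y : Circle, x ≠ y →
    bowenSeries hd x = bowenSeries hd y → ε ≤ dist x y := by
  set K : Set (Circle × Circle) := ⋃ t ∈ {t : Letter d × Letter d × Letter d |
      t.1 ≠ t.2.1 ∧ t.2.2 ≠ t.1.neg ∧ t.2.2 ≠ t.2.1.neg},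
    (arc t.1 ∩ bowenSeries hd ⁻¹' arc t.2.2) ×ˢ (arc t.2.1 ∩ bowenSeries hd ⁻¹' arc t.2.2) with hK
  have hcl : ∀ a c : Letter d, IsClosed (arc a ∩ bowenSeries hd ⁻¹' arc c) := fun a c =>
    (isClosed_arc hd a).inter ((isClosed_arc hd c).preimage (continuous_bowenSeries hd))
  have hKc : IsCompact K :=
    (Set.toFinite _).isCompact_biUnion fun t _ => ((hcl _ _).prod (hcl _ _)).isCompact
  have hpos : ∀ p ∈ K, 0 < dist p.1 p.2 := by
    rintro ⟨x, y⟩ hp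
    obtain ⟨⟨a, b, c⟩, ⟨hab, hca, hcb⟩, hx, hy⟩ := mem_iUnion₂.1 hp
    rw [dist_pos]
    intro hxy
    change x = y at hxy
    subst hxy
    exact hab (eq_of_mem_arc_of_bowenSeries_mem hd hca hcb hx.1 hy.1 hx.2)
  obtain ⟨ε, hε, h⟩ := hKc.exists_forall_le' continuous_dist.continuousOn hpos
  refine ⟨ε, hε, fun x y hxy he => h (x, y) (mem_iUnion₂.2
    ⟨(ccwLabel hd x, ccwLabel hd y, ccwLabel hd (bowenSeries hd x)), ⟨fun hl => ?_,
      ccwLabel_bowenSeries_ne hd x, by rw [he]; exact ccwLabel_bowenSeries_ne hd y⟩,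
      ⟨mem_arc_ccwLabel hd x, mem_arc_ccwLabel hd _⟩,
      ⟨mem_arc_ccwLabel hd y, by rw [he]; exact mem_arc_ccwLabel hd _⟩⟩)⟩
  have hx := circleToDisc_bowenSeries hd (mem_arc_ccwLabel hd x)
  have hy := circleToDisc_bowenSeries hd (mem_arc_ccwLabel hd y)
  simp only at hl
  rw [he, hy, hl] at hx
  exact hxy (circleToDisc_injective ((piece hd _).injective hx)).symm

/-- The half-open itinerary of y is preceded by each of the 2d - 1 letters it can follow; different
letters give different points of the circle. -/
lemma exists_finset_bowenSeries_eq {d : ℕ} (hd : 2 ≤ d) (y : Circle) :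
    ∃ t : Finset Circle, t.card = 2 * d - 1 ∧ ∀ x ∈ t, bowenSeries hd x = y := by
  let F : {a : Letter d // a ≠ (ccwLabel hd y).neg} → Circle := fun a =>
    coding hd (ShiftSpace.cons a.1 (ccwItinerary hd y) (ne_neg_comm.1 a.2))
  have hA : ∀ a, bowenSeries hd (F a) = y := fun a => by
    rw [bowenSeries_coding, ShiftSpace.shift_cons, coding_ccwItinerary]
  have hF : ∀ a, F a ∈ arc a.1 := fun a =>
    coding_mem_arc hd (ShiftSpace.cons a.1 (ccwItinerary hd y) (ne_neg_comm.1 a.2))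
  have hinj : Function.Injective F := by
    intro a b hab
    refine Subtype.ext (eq_of_mem_arc_of_bowenSeries_mem hd (ne_neg_comm.1 a.2)
      (ne_neg_comm.1 b.2) (hF a) (hab ▸ hF b) ?_)
    rw [hA]
    exact mem_arc_ccwLabel hd y
  refine ⟨Finset.univ.map ⟨F, hinj⟩, ?_, ?_⟩
  · rw [Finset.card_map, Finset.card_univ, Fintype.card_subtype, card_filter_ne]
  · intro x hx
    obtain ⟨a, _, rfl⟩ := Finset.mem_map.1 hx
    exact hA a

lemma exists_finset_iterate_eq {d : ℕ} (hd : 2 ≤ d) (n : ℕ) :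
    ∃ t : Finset Circle, t.card = (2 * d - 1) ^ n ∧ ∀ x ∈ t, (bowenSeries hd)^[n] x = 1 := by
  classical
  choose t ht hA using exists_finset_bowenSeries_eq hd
  induction n with
  | zero => exact ⟨{1}, by simp, by simp⟩
  | succ n ih =>
    obtain ⟨s, hs, h⟩ := ih
    refine ⟨s.biUnion t, ?_, ?_⟩
    · rw [Finset.card_biUnion, Finset.sum_congr rfl fun y _ => ht y, Finset.sum_const, hs,
        smul_eq_mul, pow_succ]
      intro y _ z _ hyz
      exact Finset.disjoint_left.2 fun x h1 h2 => hyz ((hA y x h1).symm.trans (hA z x h2))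
    · intro x hx
      obtain ⟨y, hy, hxy⟩ := Finset.mem_biUnion.1 hx
      rw [Function.iterate_succ_apply, hA y x hxy, h y hy]

lemma exists_iterate_ne {X : Type*} {T : X → X} {x y : X} (hxy : x ≠ y) {n : ℕ}
    (h : T^[n] x = T^[n] y) : ∃ k < n, T^[k] x ≠ T^[k] y ∧ T (T^[k] x) = T (T^[k] y) := by
  induction n with
  | zero => exact absurd h hxy
  | succ n ih =>
    by_cases h' : T^[n] x = T^[n] y
    · obtain ⟨k, hk, hk'⟩ := ih h'
      exact ⟨k, by omega, hk'⟩
    · rw [Function.iterate_succ_apply', Function.iterate_succ_apply'] at h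
      exact ⟨n, by omega, h', h⟩

/-- Two of the (2d - 1)^n points mapped to 1 in n steps are, just before their orbits merge,
distinct with equal images, hence at least ε apart. No orbit can stay ε / 2-close to both. -/
lemma le_coverEntropy_bowenSeries {d : ℕ} (hd : 2 ≤ d) :
    (Real.log (2 * d - 1) : EReal) ≤ Dynamics.coverEntropy (bowenSeries hd) univ := by
  obtain ⟨ε, hε, hsep⟩ := exists_pos_le_dist hd
  refine le_trans ?_ (Dynamics.netEntropyEntourage_le_coverEntropy (T := bowenSeries hd) univ
    (uniformity_circle_basis.mem_of_mem (half_pos hε)))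
  rw [← cast_two_mul_sub_one hd, ← ennrealLog_natCast _ (by omega), ← ExpGrowth.expGrowthSup_pow]
  refine ExpGrowth.expGrowthSup_monotone fun n => ?_
  obtain ⟨t, ht, hn⟩ := exists_finset_iterate_eq hd n
  have hnet : Dynamics.IsDynNetIn (bowenSeries hd) univ
      {p : Circle × Circle | dist p.1 p.2 < ε / 2} n (t : Set Circle) := by
    refine ⟨subset_univ _, fun x hx y hy hxy => disjoint_left.2 fun z hzx hzy => ?_⟩
    obtain ⟨k, hk, hne, he⟩ := exists_iterate_ne hxy ((hn x hx).trans (hn y hy).symm)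
    have h1 := Dynamics.mem_ball_dynEntourage.1 hzx k hk
    have h2 := Dynamics.mem_ball_dynEntourage.1 hzy k hk
    have h1 : dist ((bowenSeries hd)^[k] x) ((bowenSeries hd)^[k] z) < ε / 2 := h1
    have h2 : dist ((bowenSeries hd)^[k] y) ((bowenSeries hd)^[k] z) < ε / 2 := h2
    have h3 := hsep _ _ hne he
    have h4 := dist_triangle_right ((bowenSeries hd)^[k] x) ((bowenSeries hd)^[k] y)
      ((bowenSeries hd)^[k] z)
    linarith
  have h := ENat.toENNReal_mono hnet.card_le_netMaxcard
  rw [ht, ENat.toENNReal_coe] at h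
  simp only [← Nat.cast_pow]
  exact h

theorem coverEntropy_bowenSeries {d : ℕ} (hd : 2 ≤ d) :
    Dynamics.coverEntropy (bowenSeries hd) univ = (Real.log (2 * d - 1) : EReal) :=
  (coverEntropy_bowenSeries_le hd).antisymm (le_coverEntropy_bowenSeries hd)

/-! ## The measure of maximal entropy -/

lemma dist_arcEnd_center {d : ℕ} (hd : 2 ≤ d) (a : Letter d) :
    dist (arcEnd a : ℂ) (center a) = geodesicRadius d := by
  have hne : a ≠ ccwLabel hd (arcEnd a) := fun h =>
    ne_arcEnd_ccwLabel hd (arcEnd a) (congrArg arcEnd h)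
  exact (dist_center_eq_and_eq_midpoint hd hne ((mem_arc_iff hd _ _).1 (arcEnd_mem_arc hd a))
    ((mem_arc_iff hd _ _).1 (mem_arc_ccwLabel hd _))).1

lemma coding_shift_of_eq_arcEnd {d : ℕ} (hd : 2 ≤ d) {ω : ShiftSpace d}
    (h : coding hd ω = arcEnd (ω.1 0)) : coding hd (shift ω) = arcStart (ω.1 0).neg := by
  have h1 : coding hd ω = (arcStart (ω.1 0).neg)⁻¹ := by
    rw [h, ← arcEnd_neg hd, Letter.neg_neg]
  have h2 : dist (coding hd ω : ℂ) (center (ω.1 0)) = geodesicRadius d := by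
    rw [h]; exact dist_arcEnd_center hd _
  rw [← bowenSeries_coding, bowenSeries_of_dist_eq hd h2, h1, inv_inv]

/-- The words whose image is the final point of the arc of their first letter. -/
def terminalWords {d : ℕ} (hd : 2 ≤ d) : Set (ShiftSpace d) :=
  {ω | coding hd ω = arcEnd (ω.1 0)}

/-- The final point of the arc of a is mapped to the initial point of the arc of -a. Since the next
letter is not -a, its arc is the neighbouring one that ends there, which makes the next word
terminal and determines its first letter. -/
lemma shift_mem_terminalWords {d : ℕ} (hd : 2 ≤ d) {ω : ShiftSpace d}
    (h : ω ∈ terminalWords hd) : shift ω ∈ terminalWords hd ∧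
      arcEnd ((shift ω).1 0) = arcStart (ω.1 0).neg := by
  have h1 := coding_shift_of_eq_arcEnd hd h
  have hne : (shift ω).1 0 ≠ (ω.1 0).neg := ω.ne_neg 0
  have h2 := (mem_arc_iff hd _ _).1 (coding_mem_arc hd (shift ω))
  have h3 := (mem_arc_iff hd _ _).1 (arcStart_mem_arc hd (ω.1 0).neg)
  rw [← h1] at h3
  rcases eq_arcStart_or_arcEnd hd _ (dist_center_eq_and_eq_midpoint hd hne h2 h3).1 with h4 | h4
  · exact absurd (arcStart_injective hd (h4.symm.trans h1)) hne
  · exact ⟨h4, h4.symm.trans h1⟩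

lemma arcEnd_injective {d : ℕ} (hd : 2 ≤ d) : Function.Injective (arcEnd (d := d)) := by
  intro a b h
  rw [← Letter.neg_neg a, ← Letter.neg_neg b, arcEnd_neg hd, arcEnd_neg hd, inv_inj] at h
  exact Letter.neg_injective (arcStart_injective hd h)

/-- Each letter of a terminal word determines the next one, so there are only finitely many such
words. -/
lemma injOn_firstLetter_terminalWords {d : ℕ} (hd : 2 ≤ d) :
    InjOn firstLetter (terminalWords hd) := by
  intro ω hω η hη h
  refine Subtype.ext (funext fun n => ?_)
  induction n generalizing ω η with
  | zero => exact h
  | succ n ih =>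
    obtain ⟨h1, h2⟩ := shift_mem_terminalWords hd hω
    obtain ⟨h3, h4⟩ := shift_mem_terminalWords hd hη
    refine ih h1 h3 (arcEnd_injective hd ?_)
    have h : ω.1 0 = η.1 0 := h
    change arcEnd ((shift ω).1 0) = arcEnd ((shift η).1 0)
    rw [h2, h4, h]

lemma IsParryMeasure.measure_terminalWords {d : ℕ} (hd : 2 ≤ d) {P : Measure (ShiftSpace d)}
    (hP : IsParryMeasure P) : P (terminalWords hd) = 0 := by
  have hfin : (terminalWords hd).Finite :=
    Set.Finite.of_finite_image (Set.toFinite _) (injOn_firstLetter_terminalWords hd)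
  rw [← biUnion_of_singleton (terminalWords hd), measure_biUnion_null_iff hfin.countable]
  exact fun ω _ => hP.measure_singleton hd ω

/-- Label and letter can differ only at terminal words, a finite set without mass; invariance
extends this to all times at once. -/
lemma IsParryMeasure.ae_ccwLabel_coding {d : ℕ} (hd : 2 ≤ d) {P : Measure (ShiftSpace d)}
    (hP : IsParryMeasure P) : ∀ᵐ ω ∂P, ∀ n, ccwLabel hd (coding hd (shift^[n] ω)) = ω.1 n := by
  have h0 : ∀ᵐ ω ∂P, ω ∉ terminalWords hd := measure_eq_zero_iff_ae_notMem.1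
    (hP.measure_terminalWords hd)
  refine ae_all_iff.2 fun n => ?_
  have hσ := (hP.measurePreserving_shift hd).iterate n
  filter_upwards [hσ.quasiMeasurePreserving.ae h0] with ω hω
  rw [ccwLabel_eq_iff]
  have h1 := coding_mem_arc hd (shift^[n] ω)
  have h2 : ¬ coding hd (shift^[n] ω) = arcEnd ((shift^[n] ω).1 0) := hω
  rw [shift_iterate_apply, zero_add] at h1 h2
  exact ⟨h1, h2⟩

lemma IsParryMeasure.measurePreserving_bowenSeries {d : ℕ} (hd : 2 ≤ d)
    {P : Measure (ShiftSpace d)} (hP : IsParryMeasure P) :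
    MeasurePreserving (bowenSeries hd) (P.map (coding hd)) (P.map (coding hd)) := by
  have hc := (continuous_coding hd).measurable
  have hA := (continuous_bowenSeries hd).measurable
  refine ⟨hA, ?_⟩
  rw [Measure.map_map hA hc, ← (semiconj_coding hd).comp_eq, ← Measure.map_map hc
    continuous_shift.measurable, (hP.measurePreserving_shift hd).map_eq]

/-- The partition into half-open arcs suffices: almost surely its itinerary is the coded word, so
its n-fold join has the entropy of the uniform distribution on the words of length n. -/
lemma IsParryMeasure.le_ksEntropy_map_coding {d : ℕ} (hd : 2 ≤ d) {P : Measure (ShiftSpace d)}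
    (hP : IsParryMeasure P) :
    (Real.log (2 * d - 1) : EReal) ≤ ksEntropy (P.map (coding hd)) (bowenSeries hd) := by
  refine le_trans ?_ (entropyOfPartition_le_ksEntropy _ _ (measurable_ccwLabel hd))
  have hc : MeasurePreserving (coding hd) P (P.map (coding hd)) :=
    (continuous_coding hd).measurable.measurePreserving P
  have key : ∀ n, partitionEntropy (P.map (coding hd)) (itinerary (bowenSeries hd) (ccwLabel hd) n)
      = Real.log (sphereCard d n) := by
    intro n
    rw [← partitionEntropy_comp_measurePreserving hc (measurable_itinerary
      (continuous_bowenSeries hd).measurable (measurable_ccwLabel hd) n), ← hP.wordEntropy_eq hd]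
    refine Finset.sum_congr rfl fun w _ => ?_
    congr 1
    refine measureReal_congr ?_
    filter_upwards [hP.ae_ccwLabel_coding hd] with ω hω
    refine propext ?_
    have : itinerary (bowenSeries hd) (ccwLabel hd) n (coding hd ω)
        = itinerary shift firstLetter n ω := by
      funext i
      rw [itinerary_firstLetter, itinerary, ← (semiconj_coding hd).iterate_right, hω]
    change itinerary (bowenSeries hd) (ccwLabel hd) n (coding hd ω) = w ↔ _
    rw [this]
    rfl
  refine le_limsup_of_frequently_le (Eventually.frequently ?_)
  filter_upwards [eventually_gt_atTop 0] with n hn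
  have hn' : (0 : ℝ) < n := by exact_mod_cast hn
  have h1 : ((2 * d - 1 : ℝ)) ^ n ≤ sphereCard d n := by
    rw [← cast_two_mul_sub_one hd]
    exact_mod_cast pow_le_sphereCard hd n
  have h3 := three_le_cast hd
  rw [EReal.coe_le_coe_iff, key, le_div_iff₀ hn', mul_comm, ← Real.log_pow]
  exact Real.log_le_log (by positivity) h1

theorem IsParryMeasure.isMeasureOfMaximalEntropy {d : ℕ} (hd : 2 ≤ d) {P : Measure (ShiftSpace d)}
    (hP : IsParryMeasure P) :
    IsMeasureOfMaximalEntropy (bowenSeries hd) (P.map (coding hd)) := by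
  have := hP.isProbabilityMeasure
  have hc := (continuous_coding hd).measurable
  refine ⟨Measure.isProbabilityMeasure_map hc.aemeasurable, hP.measurePreserving_bowenSeries hd,
    ?_⟩
  rw [coverEntropy_bowenSeries]
  exact ((ksEntropy_le_of_semiconj (hc.measurePreserving P) (semiconj_coding hd)
    (continuous_bowenSeries hd).measurable).trans
      (ksEntropy_shift_le hd (hP.measurePreserving_shift hd))).antisymm
    (hP.le_ksEntropy_map_coding hd)

/-- The lift of ν by half-open itineraries is shift-invariant and has ν as a factor under `coding`.
Its entropy is therefore at least log (2d - 1), which makes it the Parry measure. -/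
theorem IsParryMeasure.eq_map_coding {d : ℕ} (hd : 2 ≤ d) {P : Measure (ShiftSpace d)}
    (hP : IsParryMeasure P) {ν : Measure Circle}
    (hν : IsMeasureOfMaximalEntropy (bowenSeries hd) ν) : ν = P.map (coding hd) := by
  have := hν.isProbabilityMeasure
  have hs := measurable_ccwItinerary hd
  have hA := (continuous_bowenSeries hd).measurable
  have hσ := continuous_shift.measurable (f := shift (d := d))
  have hc := (continuous_coding hd).measurable
  set m := ν.map (ccwItinerary hd)
  have hm1 : IsProbabilityMeasure m := Measure.isProbabilityMeasure_map hs.aemeasurable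
  have hm : MeasurePreserving shift m m := by
    refine ⟨hσ, ?_⟩
    have h : shift ∘ ccwItinerary hd = ccwItinerary hd ∘ bowenSeries hd :=
      funext (shift_ccwItinerary hd)
    rw [Measure.map_map hσ hs, h, ← Measure.map_map hs hA, hν.measurePreserving.map_eq]
  have hcm : m.map (coding hd) = ν := by
    have h : coding hd ∘ ccwItinerary hd = id := funext (coding_ccwItinerary hd)
    rw [Measure.map_map hc hs, h, Measure.map_id]
  have hent : (Real.log (2 * d - 1) : EReal) ≤ ksEntropy m shift := by
    rw [← coverEntropy_bowenSeries hd, ← hν.entropy_eq]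
    exact ksEntropy_le_of_semiconj ⟨hc, hcm⟩ (semiconj_coding hd) hA
  rw [← hcm, (isParryMeasure_of_le_ksEntropy hd hm hent).unique hP]

end BowenSeries

/-- The measure of maximal entropy of the Bowen–Series map `A_{G_d}` is the push-forward of the
Patterson–Sullivan measure (equivalently, of the Parry measure) under the Cannon–Thurston map. -/
theorem mainTheorem3 (d : ℕ) (hd : 2 ≤ d) :
    (∃! ν : Measure Circle, IsMeasureOfMaximalEntropy (BowenSeries.bowenSeries hd) ν) ∧
    (∃! μ : Measure (BowenSeries.Boundary d), BowenSeries.IsPattersonSullivan μ) ∧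
    (∃! ψ : BowenSeries.Boundary d → Circle, BowenSeries.IsCannonThurston hd ψ) ∧
    IsHomeomorph (BowenSeries.toBoundary (d := d)) ∧
    ∀ (ν : Measure Circle) (μ : Measure (BowenSeries.Boundary d))
      (ψ : BowenSeries.Boundary d → Circle),
      IsMeasureOfMaximalEntropy (BowenSeries.bowenSeries hd) ν →
      BowenSeries.IsPattersonSullivan μ →
      BowenSeries.IsCannonThurston hd ψ →
        ν = μ.map ψ ∧
        BowenSeries.TendstoWeakly (BowenSeries.sphereAverage d) μ ∧
        (∀ P : Measure (BowenSeries.ShiftSpace d),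
          BowenSeries.IsParryMeasure P ↔ P.map BowenSeries.toBoundary = μ) ∧
        (∀ ψ' : BowenSeries.ShiftSpace d → Circle,
          BowenSeries.IsSymbolicCoding hd ψ' ↔ ψ' = ψ ∘ BowenSeries.toBoundary) := by
  obtain ⟨P, hP⟩ := BowenSeries.exists_isParryMeasure hd
  refine ⟨⟨P.map (BowenSeries.coding hd), hP.isMeasureOfMaximalEntropy hd,
      fun ν hν => hP.eq_map_coding hd hν⟩,
    ⟨P.map BowenSeries.toBoundary, (BowenSeries.isPattersonSullivan_iff hd hP _).2 rfl,
      fun μ hμ => (BowenSeries.isPattersonSullivan_iff hd hP μ).1 hμ⟩,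
    BowenSeries.existsUnique_isCannonThurston hd, BowenSeries.isHomeomorph_toBoundary d,
    fun ν μ ψ hν hμ hψ => ?_⟩
  have hψc := (BowenSeries.isCannonThurston_iff hd ψ).1 hψ
  obtain rfl := (BowenSeries.isPattersonSullivan_iff hd hP μ).1 hμ
  -- ψ is continuous because it is so after composition with the homeomorphism from the shift space.
  have hψm : Measurable ψ := by
    refine ((BowenSeries.isHomeomorph_toBoundary d).isQuotientMap.continuous_iff.2 ?_).measurable
    rw [hψc]
    exact BowenSeries.continuous_coding hd
  refine ⟨?_, BowenSeries.tendstoWeakly_sphereAverage hd hP, fun Q => ⟨fun hQ => ?_, fun hQ => ?_⟩,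
    fun ψ' => ?_⟩
  · rw [Measure.map_map hψm (BowenSeries.continuous_toBoundary d).measurable, hψc]
    exact hP.eq_map_coding hd hν
  · rw [hQ.unique hP]
  · rwa [BowenSeries.map_toBoundary_injective hQ]
  · rw [hψc]
    exact BowenSeries.isSymbolicCoding_iff hd ψ'
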